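/- Let $p$ be a prime, let $E/\mathbb{Q}_p$ and $F/\mathbb{Q}_p$ be finite extensions, and let $\mathcal{O}$ be the ring of integers of $E$, with residue field $k$. Let $\mathrm{Noe}(\mathcal{O})$ be the category of complete Noetherian local $\mathcal{O}$-algebras $A$ for which $\mathcal{O}\to A$ is local and induces an isomorphism $k\cong A/\mathfrak{m}_A$; morphisms are local $\mathcal{O}$-algebra homomorphisms. Let $G$ be a connected reductive group over $F$, let $P\subset G$ be a parabolic subgroup with Levi factor $L$, and let $P^-$ be the parabolic subgroup opposite to $P$ with respect to $L$ (so $P\cap P^-=L$). Write $G,P^-,L$ also for the groups of $F$-points, with their $p$-adic topology. Let $A\in\mathrm{Noe}(\mathcal{O})$. For $H=G$ or $H=L$, an $\mathfrak{m}_A$-adically continuous $A[H]$-module is an $\mathfrak{m}_A$-adically complete and separated $A$-module $\pi$ with an $A$-linear $H$-action such that $H\times\pi\to\pi$ is continuous for the $\mathfrak{m}_A$-adic topology on $\pi$. An $A$-module $U$ is orthonormalizable if it is $\mathfrak{m}_A$-adically complete and separated and $U/\mathfrak{m}_A^nU$ is free over $A/\mathfrak{m}_A^n$ for all $n\ge 1$.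 For an $\mathfrak{m}_A$-adically complete and separated $A$-module $U$ and a morphism $A\to A'$ in $\mathrm{Noe}(\mathcal{O})$ put $U\mathbin{\widehat\otimes}_A A':=\varprojlim_n U\otimes_A A'/\mathfrak{m}_{A'}^n$. Let $\sigma$ be an $\mathfrak{m}_A$-adically continuous $A[L]$-module, inflated to $P^-$ along $P^-\twoheadrightarrow L$, and let $$\mathrm{Ind}_{P^-}^G\sigma=\{f:G\to\sigma \text{ continuous}\mid f(pg)=p\,f(g)\text{ for all }p\in P^-,\ g\in G\},$$ where $\sigma$ has the $\mathfrak{m}_A$-adic topology and $G$ acts by right translation. Then: 1. $\mathrm{Ind}_{P^-}^G\sigma$ is an $\mathfrak{m}_A$-adically continuous $A[G]$-module, and it is orthonormalizable if and only if $\sigma$ is orthonormalizable. 2. For any morphism $A\to A'$ in $\mathrm{Noe}(\mathcal{O})$, $\sigma\mathbin{\widehat\otimes}_AA'$ is an $\mathfrak{m}_{A'}$-adically continuous $A'[L]$-module, and there is a natural $A'$-linear and $G$-equivariant isomorphism $$(\mathrm{Ind}_{P^-}^G\sigma)\mathbin{\widehat\otimes}_AA'\;\xrightarrow{\ \sim\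 }\;\mathrm{Ind}_{P^-}^G(\sigma\mathbin{\widehat\otimes}_AA'),$$ which sends $f\otimes a'$ to the function $g\mapsto f(g)\otimes a'$. -/

import Mathlib

open scoped TensorProduct

noncomputable section

/-! ### Linear algebraic groups over a field of characteristic zero

A linear algebraic group over a perfect field `F` is described in the classical way, through its
group of points over an algebraic closure: a subgroup of `GL_n` cut out by polynomials with
coefficients in `F`. -/

namespace LinAlg

variable {n : ℕ}

/-- The matrix entries of an element of `GL_n(K)`, as a point of affine `n²`-space. -/
def coords {K : Type*} [Field K] (g : GL (Fin n) K) : Fin n × Fin n → K :=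
  fun ij => (g : Matrix (Fin n) (Fin n) K) ij.1 ij.2

/-- Zariski closed subsets of `GL_n(K)`. -/
def IsZariskiClosed {K : Type*} [Field K] (Z : Set (GL (Fin n) K)) : Prop :=
  ∃ S : Set (MvPolynomial (Fin n × Fin n) K),
    ∀ g, g ∈ Z ↔ ∀ p ∈ S, MvPolynomial.eval (coords g) p = 0

/-- A subgroup is connected in the Zariski topology: it is not the union of two disjoint nonempty
relatively closed subsets. -/
def IsZariskiConnected {K : Type*} [Field K] (H : Subgroup (GL (Fin n) K)) : Prop :=
  ∀ Z₁ Z₂ : Set (GL (Fin n) K), IsZariskiClosed Z₁ → IsZariskiClosed Z₂ →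
    (H : Set (GL (Fin n) K)) ⊆ Z₁ ∪ Z₂ → (H : Set (GL (Fin n) K)) ∩ (Z₁ ∩ Z₂) = ∅ →
    (H : Set (GL (Fin n) K)) ⊆ Z₁ ∨ (H : Set (GL (Fin n) K)) ⊆ Z₂

/-- All elements `g` of the subgroup are unipotent, i.e. `g - 1` is a nilpotent matrix. -/
def IsUnipotentSubgroup {K : Type*} [Field K] (H : Subgroup (GL (Fin n) K)) : Prop :=
  ∀ g ∈ H, IsNilpotent ((g : Matrix (Fin n) (Fin n) K) - 1)

/-- The Zariski closed, connected, unipotent, normal subgroups of `H`. -/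
def unipotentNormalSubgroups {K : Type*} [Field K] (H : Subgroup (GL (Fin n) K)) :
    Set (Subgroup (GL (Fin n) K)) :=
  {N | N ≤ H ∧ (∀ h ∈ H, ∀ u ∈ N, h * u * h⁻¹ ∈ N) ∧
    IsZariskiClosed (N : Set (GL (Fin n) K)) ∧ IsZariskiConnected N ∧ IsUnipotentSubgroup N}

end LinAlg

/-- A linear algebraic group over (the perfect field) `F`, given as a closed subgroup of `GL_n`:
its group of geometric points, which is the set of common zeros in `GL_n` of a set of polynomials
with coefficients in `F`. -/
structure LinearAlgebraicGroup (F : Type*) [Field F] (n : ℕ) where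
  /-- the group of points over the algebraic closure -/
  geom : Subgroup (GL (Fin n) (AlgebraicClosure F))
  definedOver : ∃ S : Set (MvPolynomial (Fin n × Fin n) F),
    ∀ g, g ∈ geom ↔ ∀ p ∈ S, MvPolynomial.aeval (LinAlg.coords g) p = 0

namespace LinearAlgebraicGroup

open LinAlg

variable {F : Type*} [Field F] {n : ℕ}

/-- The group of `F`-rational points, as a subgroup of `GL_n(F)`. When `F` is a topological field
it carries the topology induced by that of `GL_n(F)`. -/
def points (G : LinearAlgebraicGroup F n) : Subgroup (GL (Fin n) F) :=
  G.geom.comap (Matrix.GeneralLinearGroup.map (algebraMap F (AlgebraicClosure F)))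

/-- `G` is connected reductive: it is connected and its unipotent radical is trivial. -/
structure IsConnectedReductive (G : LinearAlgebraicGroup F n) : Prop where
  connected : IsZariskiConnected G.geom
  reductive : ∀ N ∈ unipotentNormalSubgroups G.geom, N = ⊥

/-- A homomorphism from the geometric points of `G` to `GL_m` is a rational representation over `F`
if its matrix entries are regular functions on `G` with coefficients in `F`: polynomials over `F` in
the entries of `g` and `g⁻¹`. -/
def IsRationalRep (G : LinearAlgebraicGroup F n) {m : ℕ}
    (r : G.geom →* GL (Fin m) (AlgebraicClosure F)) : Prop :=
  ∃ a : Fin m → Fin m → MvPolynomial ((Fin n × Fin n) ⊕ (Fin n × Fin n)) F,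
    ∀ (g : G.geom) (i j : Fin m),
      (r g : Matrix (Fin m) (Fin m) (AlgebraicClosure F)) i j =
        MvPolynomial.aeval
          (Sum.elim (coords (g : GL (Fin n) (AlgebraicClosure F)))
            (coords ((g : GL (Fin n) (AlgebraicClosure F))⁻¹))) (a i j)

/-- The affine cone over the orbit of the line spanned by `v` in the projective space of
the representation `r`: all scalar multiples of the vectors `r(g) v`. -/
def orbitCone (G : LinearAlgebraicGroup F n) {m : ℕ}
    (r : G.geom →* GL (Fin m) (AlgebraicClosure F)) (v : Fin m → AlgebraicClosure F) :
    Set (Fin m → AlgebraicClosure F) :=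
  {w | ∃ (c : AlgebraicClosure F) (g : G.geom),
    w = c • ((r g : Matrix (Fin m) (Fin m) (AlgebraicClosure F)).mulVec v)}

/-- `P` is a parabolic `F`-subgroup of `G` (in characteristic zero): the homogeneous variety `G/P`
is complete. Here `G/P` is realised, as in its usual construction, as the orbit of an `F`-rational
line `[v]` with stabiliser `P` in the projective space of a rational representation of `G` over `F`;
this orbit is complete if and only if it is Zariski closed in projective space, that is, if and only
if the cone over it is closed. -/
structure IsParabolic (G P : LinearAlgebraicGroup F n) : Prop where
  le : P.geom ≤ G.geom
  complete : ∃ (m : ℕ) (r : G.geom →* GL (Fin m) (AlgebraicClosure F)) (v : Fin m → F),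
    G.IsRationalRep r ∧ v ≠ 0 ∧
    (∀ g : G.geom, (g : GL (Fin n) (AlgebraicClosure F)) ∈ P.geom ↔
      ∃ c : AlgebraicClosure F,
        (r g : Matrix (Fin m) (Fin m) (AlgebraicClosure F)).mulVec
          (fun i => algebraMap F (AlgebraicClosure F) (v i)) =
            c • fun i => algebraMap F (AlgebraicClosure F) (v i)) ∧
    ∃ S : Set (MvPolynomial (Fin m) (AlgebraicClosure F)), ∀ w,
      w ∈ G.orbitCone r (fun i => algebraMap F (AlgebraicClosure F) (v i)) ↔
        ∀ p ∈ S, MvPolynomial.eval w p = 0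

/-- `U` is the unipotent radical of `H`: the greatest closed connected unipotent normal subgroup. -/
def IsUnipotentRadical (H U : LinearAlgebraicGroup F n) : Prop :=
  IsGreatest (unipotentNormalSubgroups H.geom) U.geom

/-- `H = L ⋉ U` is a Levi decomposition over `F` (in characteristic zero): `U` is the unipotent
radical of `H`, and `H` is the semidirect product of `L` and `U`. -/
structure IsLeviDecomposition (H L U : LinearAlgebraicGroup F n) : Prop where
  radical : IsUnipotentRadical H U
  inf_eq : L.geom ⊓ U.geom = ⊥
  sup_eq : L.geom ⊔ U.geom = H.geom

/-- `P` and `P'` are parabolic subgroups of `G` that are opposite with respect to `L`: their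
intersection `L` is a Levi factor of both. The groups `U` and `U'` are their unipotent radicals. -/
structure IsOppositePair (G P P' L U U' : LinearAlgebraicGroup F n) : Prop where
  parabolic : IsParabolic G P
  parabolic' : IsParabolic G P'
  levi : IsLeviDecomposition P L U
  levi' : IsLeviDecomposition P' L U'
  inf_eq : P.geom ⊓ P'.geom = L.geom

end LinearAlgebraicGroup

/-! ### Coefficient rings and modules -/

/-- `A` is an object of `Noe(𝒪)`, for a local ring `𝒪`: a Noetherian complete local `𝒪`-algebra such
that `𝒪 → A` is local and induces an isomorphism on residue fields. (For a local homomorphism the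
map on residue fields is injective, and it is surjective exactly if `𝒪 → A/𝔪_A` is.) -/
structure IsNoe (𝒪 A : Type*) [CommRing 𝒪] [CommRing A] [Algebra 𝒪 A] [IsLocalRing A] : Prop where
  noetherian : IsNoetherianRing A
  complete : IsAdicComplete (IsLocalRing.maximalIdeal A) A
  isLocalHom : IsLocalHom (algebraMap 𝒪 A)
  residue_surjective :
    Function.Surjective ((IsLocalRing.residue A).comp (algebraMap 𝒪 A))

section Modules

variable (A : Type*) [CommRing A] [IsLocalRing A]
variable (M : Type*) [AddCommGroup M] [Module A M]

/-- The `𝔪_A`-adic topology on an `A`-module. -/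
abbrev madicTopology : TopologicalSpace M :=
  (IsLocalRing.maximalIdeal A).adicModuleTopology M

/-- `M` is orthonormalizable: it is `𝔪_A`-adically complete and separated, and `M/𝔪_A^n M` is free
over `A/𝔪_A^n` for all `n ≥ 1`. -/
structure IsOrthonormalizable : Prop where
  complete : IsAdicComplete (IsLocalRing.maximalIdeal A) M
  free : ∀ n : ℕ, 1 ≤ n →
    Module.Free (A ⧸ IsLocalRing.maximalIdeal A ^ n)
      (M ⧸ (IsLocalRing.maximalIdeal A ^ n • (⊤ : Submodule A M)))

variable {M}

/-- The `A[H]`-module `M` is `𝔪_A`-adically continuous: `M` is `𝔪_A`-adically complete and separated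
and the action map `H × M → M` is continuous for the `𝔪_A`-adic topology on `M`. -/
structure IsMadicContinuous {H : Type*} [Group H] [TopologicalSpace H]
    (ρ : Representation A H M) : Prop where
  complete : IsAdicComplete (IsLocalRing.maximalIdeal A) M
  continuous : letI : TopologicalSpace M := madicTopology A M
    Continuous fun x : H × M => ρ x.1 x.2

end Modules

section BaseChange

variable (A A' : Type*) [CommRing A] [CommRing A'] [IsLocalRing A'] [Algebra A A']
variable (M : Type*) [AddCommGroup M] [Module A M]

/-- The completed base change `M ⊗̂_A A' = lim_n (M ⊗_A A')/𝔪_{A'}^n (M ⊗_A A')`, where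
`(M ⊗_A A')/𝔪_{A'}^n (M ⊗_A A') = M ⊗_A A'/𝔪_{A'}^n`. -/
abbrev CompletedBaseChange : Type _ :=
  AdicCompletion (IsLocalRing.maximalIdeal A') (A' ⊗[A] M)

variable {M}

/-- The image of `m ⊗ a'` in `M ⊗̂_A A'`. -/
def completedTmul (a' : A') (m : M) : CompletedBaseChange A A' M :=
  AdicCompletion.of (IsLocalRing.maximalIdeal A') (A' ⊗[A] M) (a' ⊗ₜ[A] m)

/-- The `A'`-linear action of `H` on `M ⊗̂_A A'` induced by an `A`-linear action on `M`. -/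
def completedBaseChangeRep {H : Type*} [Group H] (ρ : Representation A H M) :
    Representation A' H (CompletedBaseChange A A' M) where
  toFun h := (AdicCompletion.map (IsLocalRing.maximalIdeal A')
    (LinearMap.baseChange A' (ρ h))).restrictScalars A'
  map_one' := by
    ext x
    simp [Module.End.one_eq_id, AdicCompletion.map_id]
  map_mul' g h := by
    apply LinearMap.ext
    intro x
    simp [Module.End.mul_eq_comp, LinearMap.baseChange_comp, AdicCompletion.map_comp_apply]

end BaseChange

/-! ### Continuous induction -/

section Induction

variable {Γ : Type*} [Group Γ] [TopologicalSpace Γ]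
variable (A : Type*) [CommRing A] [IsLocalRing A]
variable {M : Type*} [AddCommGroup M] [Module A M]
variable (G P : Subgroup Γ) {L : Subgroup Γ} (U : Subgroup Γ)

/-- For subgroups `P = L ⋉ U` of `G` and an `A`-linear action `ρ` of `L` on `M`, which is inflated
to `P` by letting `p` act as the `l ∈ L` with `p ∈ l U`: the `A`-module of all continuous functions
`f : G → M` with `f(pg) = p f(g)` for all `p ∈ P` and `g ∈ G`. -/
def contInd (ρ : Representation A L M) : Submodule A (G → M) where
  carrier := {f |
    @Continuous G M inferInstance (madicTopology A M) f ∧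
    ∀ (p : P) (l : L) (g h : G), (l : Γ)⁻¹ * (p : Γ) ∈ U → (h : Γ) = (p : Γ) * (g : Γ) →
      f h = ρ l (f g)}
  add_mem' := by
    rintro f₁ f₂ ⟨c₁, e₁⟩ ⟨c₂, e₂⟩
    refine ⟨?_, fun p l g h hl hh => ?_⟩
    · let _ : TopologicalSpace A := (IsLocalRing.maximalIdeal A).adicTopology
      let _ : TopologicalSpace M := madicTopology A M
      have : ContinuousAdd M := by
        have : IsTopologicalAddGroup M := AddGroupFilterBasis.isTopologicalAddGroup _
        infer_instance
      exact Continuous.add c₁ c₂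
    · simp [e₁ p l g h hl hh, e₂ p l g h hl hh]
  zero_mem' := by
    refine ⟨?_, fun p l g h hl hh => by simp⟩
    let _ : TopologicalSpace M := madicTopology A M
    exact continuous_const
  smul_mem' := by
    rintro a f ⟨c, e⟩
    refine ⟨?_, fun p l g h hl hh => by simp [e p l g h hl hh]⟩
    let _ : TopologicalSpace A := (IsLocalRing.maximalIdeal A).adicTopology
    let _ : TopologicalSpace M := madicTopology A M
    have : ContinuousSMul A M := ModuleFilterBasis.continuousSMul _
    exact Continuous.const_smul c a

/-- The action of `G` on the continuous induction by right translation, `(x f)(g) = f(g x)`. -/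
def contIndRep [IsTopologicalGroup Γ] (ρ : Representation A L M) :
    Representation A G (contInd A G P U ρ) where
  toFun x :=
    { toFun := fun f => ⟨fun g => f.1 (g * x), by
        refine ⟨?_, fun p l g h hl hh => f.2.2 p l (g * x) (h * x) hl ?_⟩
        · let _ : TopologicalSpace M := madicTopology A M
          exact Continuous.comp f.2.1 (continuous_mul_const x)
        · simp [hh, mul_assoc]⟩
      map_add' := fun _ _ => rfl
      map_smul' := fun _ _ => rfl }
  map_one' := by
    ext f g
    simp
  map_mul' x y := by
    ext f g
    simp [mul_assoc]

end Induction

end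

/-! Write `P'` for the opposite parabolic. The quotient `P'\G` of rational points is a profinite
set, and `G → P'\G` has a continuous section with compact image `X`. By equivariance a function in
the induction is determined by its restriction to `X`, which may be any continuous function. So, as
a module, the induction is `C(X, σ)` (`ContSection`, `contIndEquiv`), and the theorem becomes a
statement about `C(X, M)` for `M` complete and `X` profinite.

For such modules everything follows from `I ^ n C(X, M) = C(X, I ^ n M)`
(`mem_pow_smul_top_adicContFun_iff`), where `I` is finitely generated. It gives completeness, and
`C(X, M) / I ^ n` is the module of locally constant functions with values in `M / I ^ n`, that is
`(M / I ^ n) ⊗ LC(X, ℤ)`. Nöbeling's theorem says that `LC(X, ℤ)` is free, so freeness of `M / I ^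
n` passes to functions. Conversely, `M / I ^ n` is a direct summand of the functions, hence
projective, hence free over a local ring with nilpotent maximal ideal. Base change holds because
step functions are dense and tensor products commute with the finite sums that define them
(`exists_completedBaseChange_adicContFun_equiv`).

The section needs compactness of `G(F)/P'(F)` (`IsParabolic.exists_isCompact`). The rational points
of the cone over the closed orbit `G/P'`, taken in a shell, form a compact set. Orbits of `G(F)` are
open among the rational points of a geometric orbit, so finitely many compact pieces of orbits cover
it. Openness is the inverse function theorem for the exponential chart, and needs two facts. The
orbit map is surjective on tangent spaces, by generic smoothness in characteristic zero and
homogeneity (`exists_tangent_lift`). The exponential of a small element of the Lie algebra lies in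
`G(F)` (`aeval_formalExp`). Given compactness, the section picks in each coset the point at which an
injective real function on a compact open set is minimal (`Subgroup.exists_continuous_section`). -/

noncomputable section

/-! ### Continuous functions with values in an adically complete module -/

/-- A surjection from a complete module has a set-theoretic section that is uniformly continuous
for the adic topologies. -/
theorem exists_adic_section {A M N : Type*} [CommRing A] (I : Ideal A) [AddCommGroup M] [Module A M]
    [AddCommGroup N] [Module A N] [IsPrecomplete I M] [IsHausdorff I N] (φ : M →ₗ[A] N)
    (hφ : Function.Surjective φ) :
    ∃ s : N → M, (∀ y, φ (s y) = y) ∧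
      ∀ n y z, y - z ∈ (I ^ n • ⊤ : Submodule A N) → s y - s z ∈ (I ^ n • ⊤ : Submodule A M) := by
  have hmap (k : ℕ) : (I ^ k • ⊤ : Submodule A M).map φ = I ^ k • ⊤ := by
    rw [Submodule.map_smul'', Submodule.map_top, LinearMap.range_eq_top.2 hφ]
  have hδ (k : ℕ) (y : N) (hy : y ∈ (I ^ k • ⊤ : Submodule A N)) :
      ∃ x ∈ (I ^ k • ⊤ : Submodule A M), φ x = y := by
    rwa [← hmap, Submodule.mem_map] at hy
  choose! δ hδ1 hδ2 using hδ
  have hle (k : ℕ) : (I ^ (k + 1) • ⊤ : Submodule A N) ≤ I ^ k • ⊤ :=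
    Submodule.smul_mono_left (Ideal.pow_le_pow_right k.le_succ)
  -- `r k y` is a representative that depends only on the class of `y` modulo `I ^ k`.
  let r (k : ℕ) (y : N) : N :=
    Quotient.out ((I ^ k • ⊤ : Submodule A N).mkQ y)
  have hr (k : ℕ) (y : N) : y - r k y ∈ (I ^ k • ⊤ : Submodule A N) := by
    rw [← Submodule.Quotient.eq]
    exact (Quotient.out_eq ((I ^ k • ⊤ : Submodule A N).mkQ y)).symm
  have hr' (k : ℕ) (y z : N) (h : y - z ∈ (I ^ k • ⊤ : Submodule A N)) : r k y = r k z := by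
    have : (I ^ k • ⊤ : Submodule A N).mkQ y = (I ^ k • ⊤ : Submodule A N).mkQ z :=
      (Submodule.Quotient.eq _).2 h
    simp only [r, this]
  -- Successive approximation. The approximation at stage `k + 1` sees `y` only through `r (k + 1)
  -- y`, which will make the limit uniformly continuous. The error at stage `k` lies in `I ^ k N`,
  -- so its lift `δ k` can be taken in `I ^ k M` and the sequence is Cauchy.
  let s : ℕ → N → M := fun k => Nat.rec (fun _ => 0)
    (fun k sk y => sk (r (k + 1) y) + δ k (r (k + 1) y - φ (sk (r (k + 1) y)))) k
  have hs (k : ℕ) (y : N) : s (k + 1) y =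
    s k (r (k + 1) y) + δ k (r (k + 1) y - φ (s k (r (k + 1) y))) := rfl
  have hdep (k : ℕ) (y z : N) (h : y - z ∈ (I ^ k • ⊤ : Submodule A N)) : s k y = s k z := by
    cases k with
    | zero => rfl
    | succ k => rw [hs, hs, hr' _ _ _ h]
  have happ (k : ℕ) : ∀ y, y - φ (s k y) ∈ (I ^ k • ⊤ : Submodule A N) := by
    induction k with
    | zero => intro y; simp
    | succ k ih =>
      intro y
      rw [hs, map_add, hδ2 _ _ (ih _), add_sub_cancel]
      exact hr _ _
  have hstep (k : ℕ) (y : N) : s k y - s (k + 1) y ∈ (I ^ k • ⊤ : Submodule A M) := by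
    rw [hs, hdep k y _ (hle k (hr (k + 1) y)), sub_add_cancel_left]
    exact neg_mem (hδ1 _ _ (happ _ _))
  have hcau (y : N) : ∃ L : M, ∀ n, s n y ≡ L [SMOD (I ^ n • ⊤ : Submodule A M)] := by
    refine IsPrecomplete.prec inferInstance (f := fun n => s n y) ?_
    intro m n hmn
    induction n, hmn using Nat.le_induction with
    | base => rfl
    | succ n hmn ih =>
      refine ih.trans (SModEq.sub_mem.2 ?_)
      exact Submodule.smul_mono_left (Ideal.pow_le_pow_right hmn) (hstep n y)
  choose L hL using hcau
  refine ⟨L, fun y => ?_, fun n y z h => ?_⟩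
  · rw [IsHausdorff.eq_iff_smodEq (I := I)]
    intro n
    have h1 : φ (s n y) ≡ φ (L y) [SMOD (I ^ n • ⊤ : Submodule A N)] := by
      rw [SModEq.sub_mem, ← map_sub, ← hmap]
      exact Submodule.mem_map_of_mem (SModEq.sub_mem.1 (hL y n))
    exact h1.symm.trans (SModEq.sub_mem.2 (happ n y)).symm
  · have := hdep n y z h
    exact SModEq.sub_mem.1 ((hL y n).symm.trans (this ▸ hL z n))

theorem Submodule.smul_le_smul_top {A M : Type*} [CommRing A] [AddCommGroup M] [Module A M]
    (J : Ideal A) (N : Submodule A M) : J • N ≤ J • ⊤ :=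
  Submodule.smul_mono le_rfl le_top

theorem Submodule.mem_smul_top_pi {A M ι : Type*} [CommRing A] [AddCommGroup M] [Module A M]
    [Finite ι] {J : Ideal A} {u : ι → M} :
    u ∈ J • (⊤ : Submodule A (ι → M)) ↔ ∀ i, u i ∈ J • (⊤ : Submodule A M) := by
  classical
  cases nonempty_fintype ι
  constructor
  · intro h i
    have := Submodule.mem_map_of_mem (f := LinearMap.proj i) h
    rw [Submodule.map_smul''] at this
    exact Submodule.smul_le_smul_top _ _ this
  · intro h
    rw [← Finset.univ_sum_single u]
    refine sum_mem fun i _ => ?_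
    have := Submodule.mem_map_of_mem (f := LinearMap.single A (fun _ => M) i) (h i)
    rw [Submodule.map_smul''] at this
    exact Submodule.smul_le_smul_top _ _ this

theorem IsPrecomplete.pi {A M : Type*} [CommRing A] (I : Ideal A) [AddCommGroup M] [Module A M]
    [IsPrecomplete I M] (ι : Type*) [Finite ι] : IsPrecomplete I (ι → M) where
  prec' f hf := by
    have h (i : ι) : ∃ L : M, ∀ n, f n i ≡ L [SMOD (I ^ n • ⊤ : Submodule A M)] :=
      IsPrecomplete.prec inferInstance (f := fun n => f n i) fun hmn =>
        SModEq.sub_mem.2 (Submodule.mem_smul_top_pi.1 (SModEq.sub_mem.1 (hf hmn)) i)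
    choose L hL using h
    exact ⟨L, fun n => SModEq.sub_mem.2 (Submodule.mem_smul_top_pi.2
      fun i => SModEq.sub_mem.1 (hL i n))⟩

section ContFun

variable {A : Type*} [CommRing A] (I : Ideal A) (X : Type*) [TopologicalSpace X]
variable (M : Type*) [AddCommGroup M] [Module A M]

/-- The functions `X → M` that are continuous for the `I`-adic topology on `M`. -/
def adicContFun : Submodule A (X → M) where
  carrier := {h | ∀ n, IsLocallyConstant fun x => (I ^ n • ⊤ : Submodule A M).mkQ (h x)}
  add_mem' := by
    intro f g hf hg n
    simpa only [Pi.add_apply, map_add] using! (hf n).add (hg n)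
  zero_mem' := fun _ => (IsLocallyConstant.const (0 : M)).comp _
  smul_mem' := by
    intro a f hf n
    exact (hf n).comp (fun y => a • y)

variable {X M}

theorem IsLocallyConstant.mem_adicContFun {h : X → M} (hh : IsLocallyConstant h) :
    h ∈ adicContFun I X M :=
  fun n => hh.comp (I ^ n • ⊤ : Submodule A M).mkQ

variable {I}

theorem adicContFun_comp {N : Type*} [AddCommGroup N] [Module A N] {s : M → N}
    (hs : ∀ n y z, y - z ∈ (I ^ n • ⊤ : Submodule A M) → s y - s z ∈ (I ^ n • ⊤ : Submodule A N))
    {h : X → M} (hh : h ∈ adicContFun I X M) : (fun x => s (h x)) ∈ adicContFun I X N := by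
  intro n
  rw [IsLocallyConstant.iff_eventually_eq]
  intro x
  filter_upwards [(IsLocallyConstant.iff_eventually_eq _).1 (hh n) x] with y hy
  exact (Submodule.Quotient.eq _).2 (hs n _ _ ((Submodule.Quotient.eq _).1 hy))

theorem apply_mem_of_mem_smul_top (J : Ideal A) {f : adicContFun I X M}
    (hf : f ∈ J • (⊤ : Submodule A (adicContFun I X M))) (x : X) :
    f.1 x ∈ J • (⊤ : Submodule A M) := by
  have := Submodule.mem_map_of_mem (f := (LinearMap.proj x).comp (adicContFun I X M).subtype) hf
  rw [Submodule.map_smul''] at this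
  exact Submodule.smul_le_smul_top _ _ this

/-- If `a₁, …, a_r` generate `I ^ n`, the map `u ↦ ∑ a_j u_j` from `M^r` onto `I ^ n M` has a
uniformly continuous section. Composing `f` with it writes `f` as `∑ a_j f_j` with continuous `f_j`.
This is where finite generation of `I` enters. -/
theorem mem_pow_smul_top_adicContFun_iff (hI : I.FG) [IsAdicComplete I M] (n : ℕ)
    (f : adicContFun I X M) :
    f ∈ (I ^ n • ⊤ : Submodule A (adicContFun I X M)) ↔
      ∀ x, f.1 x ∈ (I ^ n • ⊤ : Submodule A M) := by
  refine ⟨fun hf x => apply_mem_of_mem_smul_top _ hf x, fun hf => ?_⟩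
  obtain ⟨r, a, ha⟩ := Submodule.fg_iff_exists_fin_generating_family.1 (hI.pow (n := n))
  let N : Submodule A M := I ^ n • ⊤
  have haI (j : Fin r) : a j ∈ I ^ n := by
    rw [← ha]; exact Submodule.subset_span ⟨j, rfl⟩
  let φ : (Fin r → M) →ₗ[A] N :=
    LinearMap.codRestrict N (∑ j, a j • LinearMap.proj j) (fun u => by
      simp only [LinearMap.sum_apply, LinearMap.smul_apply, LinearMap.proj_apply]
      exact sum_mem fun j _ => Submodule.smul_mem_smul (haI j) trivial)
  have hφ : Function.Surjective φ := by
    rintro ⟨y, hy⟩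
    suffices h : y ∈ LinearMap.range (∑ j, a j • LinearMap.proj j : (Fin r → M) →ₗ[A] M) by
      obtain ⟨u, hu⟩ := h
      exact ⟨u, Subtype.ext hu⟩
    refine Submodule.smul_induction_on hy (fun c hc m _ => ?_) (fun _ _ => add_mem)
    rw [← ha] at hc
    refine Submodule.span_induction (p := fun c _ => c • m ∈ LinearMap.range
      (∑ j, a j • LinearMap.proj j : (Fin r → M) →ₗ[A] M)) ?_ ?_ ?_ ?_ hc
    · rintro _ ⟨j, rfl⟩
      refine ⟨Pi.single j m, ?_⟩
      simp [LinearMap.sum_apply, Pi.single_apply]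
    · simp
    · intro c d _ _ hc hd
      rw [add_smul]; exact add_mem hc hd
    · intro c d _ hd
      rw [smul_eq_mul, mul_smul]; exact Submodule.smul_mem _ _ hd
  -- Since `I ^ k N = I ^ (k + n) M`, the adic topology of `N` is the one induced from `M`, up to a
  -- shift by `n`.
  have hN (k : ℕ) (y : N) : y ∈ (I ^ k • ⊤ : Submodule A N) ↔
      (y : M) ∈ (I ^ (k + n) • ⊤ : Submodule A M) := by
    rw [pow_add, ← smul_eq_mul, Submodule.smul_assoc]
    have h : (I ^ k • ⊤ : Submodule A N).map N.subtype = I ^ k • N := by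
      rw [Submodule.map_smul'', Submodule.map_top, Submodule.range_subtype]
    rw [← h]
    exact (N.injective_subtype.mem_set_image (s := (I ^ k • ⊤ : Submodule A N))).symm
  have hH : IsHausdorff I N := ⟨fun y hy => by
    refine Subtype.ext (IsHausdorff.haus (I := I) inferInstance (y : M) fun k => ?_)
    have h := (hN k y).1 (by simpa [SModEq.zero] using hy k)
    rw [SModEq.zero]
    exact Submodule.smul_mono_left (Ideal.pow_le_pow_right (Nat.le_add_right k n)) h⟩
  have := IsPrecomplete.pi (M := M) I (Fin r)
  obtain ⟨s, hs1, hs2⟩ := exists_adic_section I φ hφ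
  have hf' : (fun x => (⟨f.1 x, hf x⟩ : N)) ∈ adicContFun I X N := by
    intro k
    rw [IsLocallyConstant.iff_eventually_eq]
    intro x
    filter_upwards [(IsLocallyConstant.iff_eventually_eq _).1 (f.2 (k + n)) x] with y hy
    refine (Submodule.Quotient.eq _).2 ((hN _ _).2 ?_)
    exact (Submodule.Quotient.eq _).1 hy
  have hu := adicContFun_comp hs2 hf'
  have huj (j : Fin r) : (fun x => s ⟨f.1 x, hf x⟩ j) ∈ adicContFun I X M := by
    refine adicContFun_comp (s := fun u : Fin r → M => u j) (fun k y z h => ?_) hu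
    exact Submodule.mem_smul_top_pi.1 h j
  have : f = ∑ j, a j • (⟨_, huj j⟩ : adicContFun I X M) := by
    refine Subtype.ext (funext fun x => ?_)
    have := congrArg Subtype.val (hs1 ⟨f.1 x, hf x⟩)
    simp only [φ, LinearMap.codRestrict_apply, LinearMap.sum_apply, LinearMap.smul_apply,
      LinearMap.proj_apply] at this
    simp only [AddSubmonoidClass.coe_finsetSum, Finset.sum_apply, SetLike.val_smul, Pi.smul_apply]
    exact this.symm
  rw [this]
  exact sum_mem fun j _ => Submodule.smul_mem_smul (haI j) trivial

/-- Limits are taken pointwise. The pointwise congruences hold with the same `n` at all points, so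
the preceding criterion turns them into adic convergence. -/
theorem isAdicComplete_adicContFun (hI : I.FG) [IsAdicComplete I M] :
    IsAdicComplete I (adicContFun I X M) where
  haus' f hf := by
    refine Subtype.ext (funext fun x => IsHausdorff.haus (I := I) inferInstance (f.1 x) fun n => ?_)
    rw [SModEq.zero]
    exact apply_mem_of_mem_smul_top _ (SModEq.zero.1 (hf n)) x
  prec' f hf := by
    have h (x : X) : ∃ L : M, ∀ n, (f n).1 x ≡ L [SMOD (I ^ n • ⊤ : Submodule A M)] := by
      refine IsPrecomplete.prec IsAdicComplete.toIsPrecomplete (f := fun n => (f n).1 x) ?_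
      intro m n hmn
      rw [SModEq.sub_mem]
      exact apply_mem_of_mem_smul_top _ (SModEq.sub_mem.1 (hf hmn)) x
    choose L hL using h
    have hLc : L ∈ adicContFun I X M := fun n => by
      have : (fun x => (I ^ n • ⊤ : Submodule A M).mkQ (L x)) =
          fun x => (I ^ n • ⊤ : Submodule A M).mkQ ((f n).1 x) := funext fun x => (hL x n).symm
      rw [this]
      exact (f n).2 n
    refine ⟨⟨L, hLc⟩, fun n => ?_⟩
    rw [SModEq.sub_mem, mem_pow_smul_top_adicContFun_iff hI]
    exact fun x => SModEq.sub_mem.1 (hL x n)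

/-- Reduction modulo `I ^ n` of continuous functions. -/
def adicContFunReduce (n : ℕ) :
    adicContFun I X M →ₗ[A] LocallyConstant X (M ⧸ (I ^ n • ⊤ : Submodule A M)) where
  toFun f := ⟨_, f.2 n⟩
  map_add' _ _ := by ext; simp
  map_smul' _ _ := by ext; simp

theorem exists_lift_locallyConstant {N : Type*} [AddCommGroup N] [Module A N]
    {π : M →ₗ[A] N} (hπ : Function.Surjective π) (g : LocallyConstant X N) :
    ∃ u : LocallyConstant X M, ∀ x, π (u x) = g x :=
  ⟨g.map (Function.surjInv hπ), fun _ => Function.surjInv_eq hπ _⟩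

theorem adicContFunReduce_surjective (n : ℕ) :
    Function.Surjective (adicContFunReduce (I := I) (X := X) (M := M) n) := by
  intro g
  obtain ⟨u, hu⟩ := exists_lift_locallyConstant (Submodule.mkQ_surjective _) g
  exact ⟨⟨u, u.isLocallyConstant.mem_adicContFun I⟩, LocallyConstant.ext hu⟩

theorem ker_adicContFunReduce (hI : I.FG) [IsAdicComplete I M] (n : ℕ) :
    LinearMap.ker (adicContFunReduce (I := I) (X := X) (M := M) n) = I ^ n • ⊤ := by
  ext f
  rw [mem_pow_smul_top_adicContFun_iff hI, LinearMap.mem_ker, LocallyConstant.ext_iff]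
  exact forall_congr' fun x => Submodule.Quotient.mk_eq_zero _

instance LocallyConstant.isScalarTower {R S N : Type*} [SMul R S] [SMul S N] [SMul R N]
    [IsScalarTower R S N] : IsScalarTower R S (LocallyConstant X N) :=
  ⟨fun r s f => LocallyConstant.ext fun x => smul_assoc r s (f x)⟩

/-- `C(X, M) / I ^ n` is the module of locally constant functions with values in `M / I ^ n`. -/
def adicContFunQuotEquiv (hI : I.FG) [IsAdicComplete I M] (n : ℕ) :
    (adicContFun I X M ⧸ (I ^ n • ⊤ : Submodule A (adicContFun I X M))) ≃ₗ[A ⧸ I ^ n]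
      LocallyConstant X (M ⧸ (I ^ n • ⊤ : Submodule A M)) :=
  LinearEquiv.extendScalarsOfSurjective (R := A) Ideal.Quotient.mk_surjective
    ((Submodule.quotEquivOfEq _ _ (ker_adicContFunReduce hI n).symm).trans
      (LinearMap.quotKerEquivOfSurjective _ (adicContFunReduce_surjective n)))

end ContFun
end


noncomputable section

/-! ### Locally constant functions as a tensor product -/

section StepFunctions

variable {X : Type*} [TopologicalSpace X] {V : Type*} [AddCommGroup V]

/-- The integral characteristic function of a fibre of a locally constant function. -/
def LocallyConstant.fiberChar {Y : Type*} (ψ : LocallyConstant X Y) (y : Y) : LocallyConstant X ℤ :=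
  LocallyConstant.charFn ℤ (ψ.isLocallyConstant.isClopen_fiber y)

open Classical in
theorem LocallyConstant.fiberChar_apply {Y : Type*} (ψ : LocallyConstant X Y) (y : Y) (x : X) :
    ψ.fiberChar y x = if ψ x = y then 1 else 0 := by
  simp [LocallyConstant.fiberChar, LocallyConstant.coe_charFn, Set.indicator_apply]

variable (R : Type*) [CommRing R] [Module R V] (X V)

/-- The product of a vector and an integral locally constant function. -/
def LocallyConstant.tensorMap : V ⊗[ℤ] LocallyConstant X ℤ →ₗ[R] LocallyConstant X V :=
  TensorProduct.AlgebraTensorModule.lift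
    { toFun := fun v =>
        { toFun := fun χ => χ.map (fun k => k • v)
          map_add' := fun _ _ => LocallyConstant.ext fun _ => add_smul _ _ _
          map_smul' := fun _ _ => LocallyConstant.ext fun _ => mul_smul _ _ _ }
      map_add' := fun _ _ => LinearMap.ext fun _ => LocallyConstant.ext fun _ => smul_add _ _ _
      map_smul' := fun _ _ => LinearMap.ext fun _ => LocallyConstant.ext fun _ => smul_comm _ _ _ }

@[simp]
theorem LocallyConstant.tensorMap_tmul_apply (v : V) (χ : LocallyConstant X ℤ) (x : X) :
    LocallyConstant.tensorMap X V R (v ⊗ₜ χ) x = χ x • v := rfl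

variable {X V} [CompactSpace X]

/-- A locally constant function on a compact space as a sum of vectors times characteristic
functions. -/
def LocallyConstant.toTensor (w : LocallyConstant X V) : V ⊗[ℤ] LocallyConstant X ℤ :=
  ∑ y ∈ w.range_finite.toFinset, y ⊗ₜ w.fiberChar y

/-- The sum over the values of a function may be replaced by a sum over the fibres of any finer
locally constant function. Additivity of `toTensor` follows by comparing two functions on their
common refinement. -/
theorem LocallyConstant.toTensor_map {Y : Type*} (ψ : LocallyConstant X Y) (g : Y → V) :
    (ψ.map g).toTensor = ∑ y ∈ ψ.range_finite.toFinset, g y ⊗ₜ[ℤ] ψ.fiberChar y := by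
  classical
  rw [LocallyConstant.toTensor, ← Finset.sum_fiberwise_of_maps_to
    (t := (ψ.map g).range_finite.toFinset) (g := g)]
  · refine Finset.sum_congr rfl fun v _ => ?_
    have : (ψ.map g).fiberChar v =
        ∑ y ∈ ψ.range_finite.toFinset with g y = v, ψ.fiberChar y := by
      ext x
      have : (∑ y ∈ ψ.range_finite.toFinset with g y = v, ψ.fiberChar y) x =
          ∑ y ∈ ψ.range_finite.toFinset with g y = v, ψ.fiberChar y x :=
        map_sum (LocallyConstant.evalₗ ℤ x) _ _
      rw [this]
      simp_rw [LocallyConstant.fiberChar_apply, Finset.sum_ite_eq]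
      simp [eq_comm]
    rw [this, TensorProduct.tmul_sum]
    exact Finset.sum_congr rfl fun y hy => by rw [(Finset.mem_filter.1 hy).2]
  · intro y hy
    obtain ⟨x, rfl⟩ := (Set.Finite.mem_toFinset _).1 hy
    exact (Set.Finite.mem_toFinset _).2 ⟨x, rfl⟩

theorem LocallyConstant.toTensor_add (w₁ w₂ : LocallyConstant X V) :
    (w₁ + w₂).toTensor = w₁.toTensor + w₂.toTensor := by
  let ψ : LocallyConstant X (V × V) := ⟨_, w₁.isLocallyConstant.prodMk w₂.isLocallyConstant⟩
  have h1 : w₁ = ψ.map Prod.fst := rfl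
  have h2 : w₂ = ψ.map Prod.snd := rfl
  have h3 : w₁ + w₂ = ψ.map (fun y => y.1 + y.2) := rfl
  rw [h3, h1, h2, toTensor_map, toTensor_map, toTensor_map, ← Finset.sum_add_distrib]
  exact Finset.sum_congr rfl fun y _ => TensorProduct.add_tmul _ _ _

theorem LocallyConstant.eq_sum_fiberChar {Y : Type*} (ψ : LocallyConstant X Y) (g : Y → V)
    (x : X) : ∑ y ∈ ψ.range_finite.toFinset, ψ.fiberChar y x • g y = g (ψ x) := by
  classical
  simp [LocallyConstant.fiberChar_apply, ite_smul]

theorem LocallyConstant.tensorMap_toTensor (w : LocallyConstant X V) :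
    LocallyConstant.tensorMap X V R w.toTensor = w := by
  ext x
  rw [LocallyConstant.toTensor, map_sum]
  exact (map_sum (LocallyConstant.evalₗ ℤ x) _ _).trans (w.eq_sum_fiberChar id x)

theorem LocallyConstant.toTensor_tensorMap (q : V ⊗[ℤ] LocallyConstant X ℤ) :
    (LocallyConstant.tensorMap X V R q).toTensor = q := by
  induction q with
  | zero =>
    have h := toTensor_add (0 : LocallyConstant X V) 0
    rw [map_zero]
    simpa using h
  | add a b ha hb => rw [map_add, toTensor_add, ha, hb]
  | tmul v χ =>
    have : LocallyConstant.tensorMap X V R (v ⊗ₜ χ) = χ.map (fun k => k • v) := rfl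
    rw [this, toTensor_map]
    simp_rw [TensorProduct.smul_tmul]
    rw [← TensorProduct.tmul_sum]
    congr 1
    ext x
    refine (map_sum (LocallyConstant.evalₗ ℤ x) _ _).trans
      (Eq.trans (Finset.sum_congr rfl fun k _ => ?_) (χ.eq_sum_fiberChar (V := ℤ) id x))
    exact mul_comm k _

theorem LocallyConstant.tensorMap_bijective :
    Function.Bijective (LocallyConstant.tensorMap X V R) :=
  Function.bijective_iff_has_inverse.2
    ⟨_, LocallyConstant.toTensor_tensorMap R, LocallyConstant.tensorMap_toTensor R⟩

/-- Freeness of `LocallyConstant X ℤ` is Nöbeling's theorem; tensoring over `ℤ` with a free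
`R`-module preserves it. -/
instance LocallyConstant.free_of_free [T2Space X] [TotallyDisconnectedSpace X] [Module.Free R V] :
    Module.Free R (LocallyConstant X V) := by
  have : Module.Free ℤ (LocallyConstant X ℤ) := LocallyConstant.freeOfProfinite (Profinite.of X)
  exact Module.Free.of_equiv (LinearEquiv.ofBijective _ (LocallyConstant.tensorMap_bijective R))

end StepFunctions

/-! ### Projective modules over local rings with nilpotent maximal ideal -/

/-- Nakayama's lemma in a form that needs no finiteness of `N`: iterating the inclusion reaches `J ^
k = 0`. -/
theorem Submodule.eq_bot_of_le_nilpotent_smul {R M : Type*} [CommRing R] [AddCommGroup M]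
    [Module R M] {J : Ideal R} (hJ : IsNilpotent J) {N : Submodule R M} (h : N ≤ J • N) :
    N = ⊥ := by
  obtain ⟨k, hk⟩ := hJ
  have key (j : ℕ) : N ≤ J ^ j • N := by
    induction j with
    | zero => simp
    | succ j ih =>
      rw [pow_succ, ← smul_eq_mul, Submodule.smul_assoc]
      exact ih.trans (Submodule.smul_mono le_rfl h)
  simpa [hk] using key k

theorem Submodule.eq_top_of_sup_nilpotent_smul {R M : Type*} [CommRing R] [AddCommGroup M]
    [Module R M] {J : Ideal R} (hJ : IsNilpotent J) {N : Submodule R M} (h : N ⊔ J • ⊤ = ⊤) :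
    N = ⊤ := by
  have h2 : (⊤ : Submodule R (M ⧸ N)) ≤ J • ⊤ := by
    have := congrArg (Submodule.map N.mkQ) h
    rw [Submodule.map_sup, Submodule.map_smul'', Submodule.map_top, Submodule.range_mkQ,
      LinearMap.le_ker_iff_map.1 (Submodule.ker_mkQ N).ge, bot_sup_eq] at this
    exact this.ge
  have := Submodule.eq_bot_of_le_nilpotent_smul hJ h2
  rw [← Submodule.ker_mkQ N, ← Submodule.comap_bot, ← this, Submodule.comap_top]

/-- Lift a basis of `P / JP` to a map `φ` from a free module. It is onto by the nilpotent Nakayama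
lemma, so it splits by projectivity, and its kernel `N` satisfies `N ≤ J N`, hence vanishes. -/
theorem Module.free_of_projective_of_isNilpotent {R P : Type*} [CommRing R] [IsLocalRing R]
    [AddCommGroup P] [Module R P] [Module.Projective R P]
    (h : IsNilpotent (IsLocalRing.maximalIdeal R)) : Module.Free R P := by
  set J := IsLocalRing.maximalIdeal R
  let _ : Field (R ⧸ J) := Ideal.Quotient.field J
  let Q := P ⧸ (J • ⊤ : Submodule R P)
  let b := Module.Basis.ofVectorSpace (R ⧸ J) Q
  choose f hf using fun i => Submodule.mkQ_surjective (J • ⊤ : Submodule R P) (b i)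
  let φ : (_ →₀ R) →ₗ[R] P := Finsupp.linearCombination R f
  have hφ : LinearMap.range φ = ⊤ := by
    refine Submodule.eq_top_of_sup_nilpotent_smul h ?_
    rw [eq_top_iff]
    intro x _
    have hT : (LinearMap.range φ).map (J • ⊤ : Submodule R P).mkQ = ⊤ := by
      have hspan : Submodule.span R (Set.range b) = ⊤ := by
        rw [← Submodule.restrictScalars_span R (R ⧸ J) Ideal.Quotient.mk_surjective, b.span_eq,
          Submodule.restrictScalars_top]
      refine top_le_iff.1 (hspan.ge.trans (Submodule.span_le.2 ?_))
      rintro _ ⟨i, rfl⟩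
      exact ⟨f i, ⟨Finsupp.single i 1, by simp [φ]⟩, hf i⟩
    obtain ⟨y, hy, hxy⟩ := hT.ge (Submodule.mem_top (x := (J • ⊤ : Submodule R P).mkQ x))
    rw [← sub_add_cancel x y]
    exact add_mem (Submodule.mem_sup_right ((Submodule.Quotient.eq _).1 hxy.symm))
      (Submodule.mem_sup_left hy)
  obtain ⟨s, hs⟩ := Module.projective_lifting_property φ LinearMap.id (LinearMap.range_eq_top.1 hφ)
  have hker : LinearMap.ker φ = ⊥ := by
    refine Submodule.eq_bot_of_le_nilpotent_smul h fun n hn => ?_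
    have hnJ (i) : n i ∈ J := by
      have h0 : Finsupp.linearCombination (R ⧸ J) b
          (n.mapRange (Ideal.Quotient.mk J) (map_zero _)) = 0 := by
        have := congrArg (J • ⊤ : Submodule R P).mkQ (LinearMap.mem_ker.1 hn)
        rw [map_zero, Finsupp.linearCombination_apply, map_finsuppSum] at this
        rw [Finsupp.linearCombination_apply, Finsupp.sum_mapRange_index (by simp), ← this]
        refine Finsupp.sum_congr fun i _ => ?_
        rw [map_smul, hf]
        rfl
      have := DFunLike.congr_fun ((linearIndependent_iff.1 b.linearIndependent) _ h0) i
      exact Ideal.Quotient.eq_zero_iff_mem.1 (by simpa using this)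
    -- For `n` in the kernel, `s (φ n) = 0` can be subtracted from `n = ∑ n_i e_i`. The coefficients
    -- lie in `J`, and each `e_i - s (f i)` lies in the kernel because `φ ∘ s = id`.
    have h1 : n = n.sum fun i c => c • (Finsupp.single i 1 - s (f i)) := by
      have h2 : (n.sum fun i c => c • s (f i)) = 0 := by
        have := congrArg s (LinearMap.mem_ker.1 hn)
        simpa [φ, Finsupp.linearCombination_apply, map_finsuppSum] using this
      simp_rw [smul_sub]
      rw [Finsupp.sum_sub, h2, sub_zero]
      simp
    rw [h1]
    refine sum_mem fun i _ => Submodule.smul_mem_smul (hnJ i) ?_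
    have := LinearMap.congr_fun hs (f i)
    simp only [LinearMap.comp_apply, LinearMap.id_apply] at this
    rw [LinearMap.mem_ker, map_sub, this]
    simp [φ]
  exact Module.Free.of_equiv (LinearEquiv.ofBijective φ
    ⟨LinearMap.ker_eq_bot.1 hker, LinearMap.range_eq_top.1 hφ⟩)
end


noncomputable section

/-! ### Freeness modulo powers of the maximal ideal -/

/-- Constant functions and evaluation at a point make `V` a direct summand of the function module.
This gives only projectivity, which suffices because the maximal ideal is nilpotent. -/
theorem LocallyConstant.free_iff {X R V : Type*} [TopologicalSpace X] [CompactSpace X] [T2Space X]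
    [TotallyDisconnectedSpace X] [Nonempty X] [CommRing R] [IsLocalRing R] [AddCommGroup V]
    [Module R V] (h : IsNilpotent (IsLocalRing.maximalIdeal R)) :
    Module.Free R (LocallyConstant X V) ↔ Module.Free R V := by
  refine ⟨fun _ => ?_, fun _ => inferInstance⟩
  obtain ⟨x⟩ := ‹Nonempty X›
  have : Module.Projective R V := Module.Projective.of_split (LocallyConstant.constₗ R)
    (LocallyConstant.evalₗ R x) rfl
  exact Module.free_of_projective_of_isNilpotent h

theorem IsLocalRing.exists_quotient_pow {A : Type*} [CommRing A] [IsLocalRing A] {n : ℕ}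
    (hn : 1 ≤ n) : ∃ _ : IsLocalRing (A ⧸ IsLocalRing.maximalIdeal A ^ n),
      IsNilpotent (IsLocalRing.maximalIdeal (A ⧸ IsLocalRing.maximalIdeal A ^ n)) := by
  set J := IsLocalRing.maximalIdeal A
  have hJ : J ^ n ≠ ⊤ := fun h => (IsLocalRing.maximalIdeal.isMaximal A).ne_top
    (top_le_iff.1 (h.ge.trans (Ideal.pow_le_self (by omega))))
  have : Nontrivial (A ⧸ J ^ n) := Ideal.Quotient.nontrivial_iff.2 hJ
  have hloc : IsLocalRing (A ⧸ J ^ n) :=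
    IsLocalRing.of_surjective' (Ideal.Quotient.mk _) Ideal.Quotient.mk_surjective
  refine ⟨hloc, n, ?_⟩
  have hmap : IsLocalRing.maximalIdeal (A ⧸ J ^ n) = J.map (Ideal.Quotient.mk (J ^ n)) := by
    have h := Ideal.comap_isMaximal_of_surjective (Ideal.Quotient.mk (J ^ n))
      Ideal.Quotient.mk_surjective (K := IsLocalRing.maximalIdeal (A ⧸ J ^ n))
    have hJ' := IsLocalRing.eq_maximalIdeal h
    have := Ideal.map_comap_of_surjective _ (Ideal.Quotient.mk_surjective (I := J ^ n))
      (IsLocalRing.maximalIdeal (A ⧸ J ^ n))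
    rw [hJ'] at this
    exact this.symm
  rw [hmap, ← Ideal.map_pow, Ideal.map_quotient_self, Ideal.zero_eq_bot]

theorem IsAdicComplete.of_equiv {A M N : Type*} [CommRing A] (I : Ideal A) [AddCommGroup M]
    [Module A M] [AddCommGroup N] [Module A N] (e : M ≃ₗ[A] N) [IsAdicComplete I M] :
    IsAdicComplete I N := by
  have hmem (n : ℕ) (x : N) : x ∈ (I ^ n • ⊤ : Submodule A N) ↔
      e.symm x ∈ (I ^ n • ⊤ : Submodule A M) := by
    have : (I ^ n • ⊤ : Submodule A N) = (I ^ n • ⊤ : Submodule A M).map (e : M →ₗ[A] N) := by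
      rw [Submodule.map_smul'', Submodule.map_top, LinearEquiv.range]
    rw [this, Submodule.mem_map_equiv]
  refine { haus' := fun x hx => ?_, prec' := fun f hf => ?_ }
  · rw [← e.symm.map_eq_zero_iff]
    refine IsHausdorff.haus (I := I) inferInstance _ fun n => ?_
    rw [SModEq.zero, ← hmem]
    exact SModEq.zero.1 (hx n)
  · obtain ⟨L, hL⟩ := IsPrecomplete.prec (I := I) inferInstance (f := fun n => e.symm (f n))
      fun hmn => by
        rw [SModEq.sub_mem, ← map_sub, ← hmem]
        exact SModEq.sub_mem.1 (hf hmn)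
    refine ⟨e L, fun n => ?_⟩
    rw [SModEq.sub_mem, hmem, map_sub, e.symm_apply_apply]
    exact SModEq.sub_mem.1 (hL n)

theorem isOrthonormalizable_adicContFun_iff {A : Type*} [CommRing A] [IsLocalRing A]
    (hA : (IsLocalRing.maximalIdeal A).FG) {X : Type*} [TopologicalSpace X] [CompactSpace X]
    [T2Space X] [TotallyDisconnectedSpace X] [Nonempty X] {M : Type*} [AddCommGroup M] [Module A M]
    (hM : IsAdicComplete (IsLocalRing.maximalIdeal A) M) :
    IsOrthonormalizable A (adicContFun (IsLocalRing.maximalIdeal A) X M) ↔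
      IsOrthonormalizable A M := by
  have key (n : ℕ) (hn : 1 ≤ n) :
      Module.Free (A ⧸ IsLocalRing.maximalIdeal A ^ n)
        (adicContFun (IsLocalRing.maximalIdeal A) X M ⧸
          (IsLocalRing.maximalIdeal A ^ n • ⊤ : Submodule A (adicContFun _ X M))) ↔
      Module.Free (A ⧸ IsLocalRing.maximalIdeal A ^ n)
        (M ⧸ (IsLocalRing.maximalIdeal A ^ n • ⊤ : Submodule A M)) := by
    obtain ⟨hloc, hnil⟩ := IsLocalRing.exists_quotient_pow (A := A) hn
    rw [← LocallyConstant.free_iff (X := X)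
      (V := M ⧸ (IsLocalRing.maximalIdeal A ^ n • ⊤ : Submodule A M)) hnil]
    exact Module.Free.iff_of_equiv (adicContFunQuotEquiv hA n)
  exact ⟨fun h => ⟨hM, fun n hn => (key n hn).1 (h.free n hn)⟩,
    fun h => ⟨isAdicComplete_adicContFun hA, fun n hn => (key n hn).2 (h.free n hn)⟩⟩

/-! ### Completed base change of continuous functions -/

theorem Submodule.map_mem_smul_top {A N N' : Type*} [CommRing A] [AddCommGroup N] [Module A N]
    [AddCommGroup N'] [Module A N'] {J : Ideal A} (g : N →ₗ[A] N') {y : N}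
    (hy : y ∈ J • (⊤ : Submodule A N)) : g y ∈ J • (⊤ : Submodule A N') := by
  have := Submodule.mem_map_of_mem (f := g) hy
  rw [Submodule.map_smul''] at this
  exact Submodule.smul_le_smul_top _ _ this

/-- By `h1`, `θ` is injective modulo every `I ^ n`, hence injective on completions. For surjectivity
of a map of completions, surjectivity modulo `I` is enough, which is `h2`. -/
theorem AdicCompletion.exists_equiv_of_approx {R N B : Type*} [CommRing R] (I : Ideal R)
    [AddCommGroup N] [Module R N] [AddCommGroup B] [Module R B] [IsAdicComplete I B]
    (θ : N →ₗ[R] B)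
    (h1 : ∀ n z, θ z ∈ (I ^ n • ⊤ : Submodule R B) → z ∈ (I ^ n • ⊤ : Submodule R N))
    (h2 : ∀ b, ∃ z, b - θ z ∈ (I • ⊤ : Submodule R B)) :
    ∃ e : AdicCompletion I N ≃ₗ[R] B, ∀ z, e (AdicCompletion.of I N z) = θ z := by
  let f : AdicCompletion I N →ₗ[R] AdicCompletion I B :=
    (AdicCompletion.map I θ).restrictScalars R
  have hf : Function.Bijective f := by
    constructor
    · rw [injective_iff_map_eq_zero]
      intro x hx
      ext n
      obtain ⟨z, hz⟩ := Submodule.mkQ_surjective _ (x.val n)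
      have h : (f x).val n = 0 := by rw [hx]; rfl
      have h' : (f x).val n = (I ^ n • ⊤ : Submodule R B).mkQ (θ z) := by
        change (AdicCompletion.map I θ x).val n = _
        rw [AdicCompletion.map_val_apply, ← hz]
        rfl
      rw [h'] at h
      rw [← hz]
      exact (Submodule.Quotient.mk_eq_zero _).2 (h1 n z ((Submodule.Quotient.mk_eq_zero _).1 h))
    · refine AdicCompletion.map_surjective_of_mkQ_comp_surjective fun y => ?_
      obtain ⟨b, rfl⟩ := Submodule.mkQ_surjective _ y
      obtain ⟨z, hz⟩ := h2 b
      exact ⟨z, ((Submodule.Quotient.eq _).2 hz).symm⟩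
  refine ⟨(LinearEquiv.ofBijective f hf).trans (AdicCompletion.ofLinearEquiv I B).symm, fun z => ?_⟩
  have : f (AdicCompletion.of I N z) = AdicCompletion.of I B (θ z) := AdicCompletion.map_of I θ z
  simp [this]

section BaseChangeContFun

variable {A A' : Type*} [CommRing A] [CommRing A'] [Algebra A A'] {I : Ideal A} {I' : Ideal A'}
variable {X : Type*} [TopologicalSpace X] {M : Type*} [AddCommGroup M] [Module A M]

theorem TensorProduct.tmul_mem_pow_smul_top (hI : I.map (algebraMap A A') ≤ I') {n : ℕ} (a : A')
    {m : M} (hm : m ∈ (I ^ n • ⊤ : Submodule A M)) :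
    a ⊗ₜ[A] m ∈ (I' ^ n • ⊤ : Submodule A' (A' ⊗[A] M)) := by
  refine Submodule.smul_induction_on hm (fun c hc m _ => ?_) (fun x y hx hy => ?_)
  · rw [TensorProduct.tmul_smul, ← algebraMap_smul A' c]
    refine Submodule.smul_mem_smul ?_ trivial
    refine Ideal.pow_right_mono hI n ?_
    rw [← Ideal.map_pow]
    exact Ideal.mem_map_of_mem _ hc
  · rw [TensorProduct.tmul_add]; exact add_mem hx hy

variable (I A')

/-- Evaluation at a point, after extension of scalars. -/
def adicContFunEval (x : X) : A' ⊗[A] adicContFun I X M →ₗ[A'] A' ⊗[A] M :=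
  LinearMap.baseChange A' ((LinearMap.proj x).comp (adicContFun I X M).subtype)

variable (X M)

/-- Locally constant functions are continuous. -/
def locallyConstantToAdicContFun : LocallyConstant X M →ₗ[A] adicContFun I X M where
  toFun u := ⟨u, u.isLocallyConstant.mem_adicContFun I⟩
  map_add' _ _ := rfl
  map_smul' _ _ := rfl

/-- Multiplication of vectors by an integral locally constant function. -/
def charMul (χ : LocallyConstant X ℤ) : M →ₗ[A] adicContFun I X M :=
  (locallyConstantToAdicContFun I X M).comp
    ({ toFun := fun m => χ.map (fun k => k • m)
       map_add' := fun _ _ => LocallyConstant.ext fun _ => smul_add _ _ _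
       map_smul' := fun _ _ => LocallyConstant.ext fun _ => smul_comm _ _ _ } :
      M →ₗ[A] LocallyConstant X M)

theorem charMul_apply (χ : LocallyConstant X ℤ) (m : M) (x : X) :
    (charMul I X M χ m).1 x = χ x • m := rfl

/-- Locally constant functions with values in `A' ⊗ M`, as elements of `A' ⊗ C(X, M)`. -/
def stepTensor : (A' ⊗[A] M) ⊗[ℤ] LocallyConstant X ℤ →ₗ[A'] A' ⊗[A] adicContFun I X M :=
  TensorProduct.AlgebraTensorModule.lift <| LinearMap.flip <| AddMonoidHom.toIntLinearMap <|
    AddMonoidHom.mk' (fun χ => LinearMap.baseChange A' (charMul I X M χ)) fun χ₁ χ₂ => by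
      rw [← LinearMap.baseChange_add]
      congr 1
      ext m x
      simp [charMul_apply, add_smul]

theorem stepTensor_tmul (y : A' ⊗[A] M) (χ : LocallyConstant X ℤ) :
    stepTensor A' I X M (y ⊗ₜ χ) = LinearMap.baseChange A' (charMul I X M χ) y := rfl

variable {X M}

theorem adicContFunEval_tmul (x : X) (a : A') (f : adicContFun I X M) :
    adicContFunEval A' I x (a ⊗ₜ f) = a ⊗ₜ f.1 x := rfl

theorem adicContFunEval_stepTensor (x : X) (q : (A' ⊗[A] M) ⊗[ℤ] LocallyConstant X ℤ) :
    adicContFunEval A' I x (stepTensor A' I X M q) =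
      LocallyConstant.tensorMap X (A' ⊗[A] M) A' q x := by
  induction q with
  | zero => simp
  | add a b ha hb => simp [ha, hb]
  | tmul y χ =>
    rw [stepTensor_tmul, LocallyConstant.tensorMap_tmul_apply]
    induction y with
    | zero => simp
    | add a b ha hb => rw [map_add, map_add, ha, hb, smul_add]
    | tmul a m =>
      rw [LinearMap.baseChange_tmul, adicContFunEval_tmul, charMul_apply, TensorProduct.tmul_smul]

variable {I A'} [CompactSpace X]

/-- Density of step functions: modulo `I ^ n` a continuous function is locally constant, so it is
congruent to a locally constant `M`-valued function, which is a finite sum of vectors times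
characteristic functions because `X` is compact. -/
theorem exists_stepTensor_approx (hFG : I.FG) [IsAdicComplete I M]
    (hI : I.map (algebraMap A A') ≤ I') (n : ℕ) (z : A' ⊗[A] adicContFun I X M) :
    ∃ q, z - stepTensor A' I X M q ∈
      (I' ^ n • ⊤ : Submodule A' (A' ⊗[A] adicContFun I X M)) := by
  induction z with
  | zero => exact ⟨0, by simp⟩
  | add a b ha hb =>
    obtain ⟨q₁, h₁⟩ := ha
    obtain ⟨q₂, h₂⟩ := hb
    refine ⟨q₁ + q₂, ?_⟩
    rw [map_add, add_sub_add_comm]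
    exact add_mem h₁ h₂
  | tmul a f =>
    obtain ⟨u, hu⟩ := exists_lift_locallyConstant (Submodule.mkQ_surjective _)
      (adicContFunReduce n f)
    have h1 : f - locallyConstantToAdicContFun I X M u ∈
        (I ^ n • ⊤ : Submodule A (adicContFun I X M)) := by
      rw [mem_pow_smul_top_adicContFun_iff hFG]
      exact fun x => (Submodule.Quotient.eq _).1 (hu x).symm
    have h2 (q₀ : M ⊗[ℤ] LocallyConstant X ℤ) : ∃ q, stepTensor A' I X M q =
        a ⊗ₜ locallyConstantToAdicContFun I X M (LocallyConstant.tensorMap X M A q₀) := by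
      induction q₀ with
      | zero => exact ⟨0, by simp⟩
      | add q₁ q₂ h₁ h₂ =>
        obtain ⟨p₁, h₁⟩ := h₁
        obtain ⟨p₂, h₂⟩ := h₂
        exact ⟨p₁ + p₂, by rw [map_add, map_add, map_add, TensorProduct.tmul_add, h₁, h₂]⟩
      | tmul m χ => exact ⟨(a ⊗ₜ m) ⊗ₜ χ, rfl⟩
    obtain ⟨q₀, rfl⟩ := (LocallyConstant.tensorMap_bijective A).2 u
    obtain ⟨q, hq⟩ := h2 q₀
    refine ⟨q, ?_⟩
    rw [hq, ← TensorProduct.tmul_sub]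
    exact TensorProduct.tmul_mem_pow_smul_top hI a h1

/-- Strictness of the comparison map, obtained without flatness of `A'` over `A`. Up to `I' ^ n`,
the tensor `z` is a step tensor; written as a sum over the fibres of its own evaluation, every term
has its coefficient in `I' ^ n`. -/
theorem mem_pow_smul_top_of_forall_eval (hFG : I.FG) [IsAdicComplete I M]
    (hI : I.map (algebraMap A A') ≤ I') (n : ℕ) (z : A' ⊗[A] adicContFun I X M)
    (hz : ∀ x, adicContFunEval A' I x z ∈ (I' ^ n • ⊤ : Submodule A' (A' ⊗[A] M))) :
    z ∈ (I' ^ n • ⊤ : Submodule A' (A' ⊗[A] adicContFun I X M)) := by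
  obtain ⟨q, hq⟩ := exists_stepTensor_approx hFG hI n z
  have hw (x : X) : LocallyConstant.tensorMap X (A' ⊗[A] M) A' q x ∈
      (I' ^ n • ⊤ : Submodule A' (A' ⊗[A] M)) := by
    rw [← adicContFunEval_stepTensor, ← sub_sub_cancel z (stepTensor A' I X M q), map_sub]
    exact sub_mem (hz x) (Submodule.map_mem_smul_top _ hq)
  rw [← sub_add_cancel z (stepTensor A' I X M q)]
  refine add_mem hq ?_
  rw [← LocallyConstant.toTensor_tensorMap A' q, LocallyConstant.toTensor, map_sum]
  refine sum_mem fun y hy => ?_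
  obtain ⟨x, rfl⟩ := (Set.Finite.mem_toFinset _).1 hy
  rw [stepTensor_tmul]
  exact Submodule.map_mem_smul_top _ (hw x)

theorem AdicCompletion.of_mem_pow_smul_top_iff {N : Type*} [AddCommGroup N] [Module A' N] {n : ℕ}
    {y : N} : AdicCompletion.of I' N y ∈ (I' ^ n • ⊤ : Submodule A' (AdicCompletion I' N)) ↔
      y ∈ (I' ^ n • ⊤ : Submodule A' N) := by
  constructor
  · intro h
    have := AdicCompletion.pow_smul_top_le_ker_eval I' n h
    rw [LinearMap.mem_ker, AdicCompletion.eval_of] at this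
    exact (Submodule.Quotient.mk_eq_zero _).1 this
  · intro h
    exact Submodule.map_mem_smul_top _ h

theorem AdicCompletion.exists_of_sub_mem (hI' : I'.FG) {N : Type*} [AddCommGroup N] [Module A' N]
    (n : ℕ) (b : AdicCompletion I' N) :
    ∃ y : N, b - AdicCompletion.of I' N y ∈ (I' ^ n • ⊤ : Submodule A' (AdicCompletion I' N)) := by
  obtain ⟨y, hy⟩ := Submodule.mkQ_surjective _ (b.val n)
  refine ⟨y, ?_⟩
  rw [AdicCompletion.pow_smul_top_eq_ker_eval hI', LinearMap.mem_ker, map_sub,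
    AdicCompletion.eval_of, hy]
  exact sub_self _

/-- Completed base change commutes with continuous functions on a compact space. -/
theorem exists_completedBaseChange_adicContFun_equiv (hFG : I.FG) (hFG' : I'.FG)
    [IsAdicComplete I M] (hI : I.map (algebraMap A A') ≤ I') :
    ∃ e : AdicCompletion I' (A' ⊗[A] adicContFun I X M) ≃ₗ[A']
        adicContFun I' X (AdicCompletion I' (A' ⊗[A] M)),
      ∀ (a : A') (f : adicContFun I X M) (x : X),
        (e (AdicCompletion.of I' _ (a ⊗ₜ f))).1 x = AdicCompletion.of I' _ (a ⊗ₜ f.1 x) := by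
  have : IsAdicComplete I' (AdicCompletion I' (A' ⊗[A] M)) := AdicCompletion.isAdicComplete hFG'
  have hcont (z : A' ⊗[A] adicContFun I X M) :
      (fun x => AdicCompletion.of I' (A' ⊗[A] M) (adicContFunEval A' I x z)) ∈
        adicContFun I' X (AdicCompletion I' (A' ⊗[A] M)) := by
    induction z with
    | zero =>
      simp only [map_zero]
      exact zero_mem (adicContFun I' X (AdicCompletion I' (A' ⊗[A] M)))
    | add a b ha hb => simpa using! add_mem ha hb
    | tmul a f =>
      intro n
      rw [IsLocallyConstant.iff_eventually_eq]
      intro x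
      filter_upwards [(IsLocallyConstant.iff_eventually_eq _).1 (f.2 n) x] with y hy
      refine (Submodule.Quotient.eq _).2 ?_
      rw [← map_sub, AdicCompletion.of_mem_pow_smul_top_iff, adicContFunEval_tmul,
        adicContFunEval_tmul, ← TensorProduct.tmul_sub]
      exact TensorProduct.tmul_mem_pow_smul_top hI a ((Submodule.Quotient.eq _).1 hy)
  let θ : A' ⊗[A] adicContFun I X M →ₗ[A'] adicContFun I' X (AdicCompletion I' (A' ⊗[A] M)) :=
    { toFun := fun z => ⟨_, hcont z⟩
      map_add' := fun z w => Subtype.ext (funext fun x => by simp)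
      map_smul' := fun c z => Subtype.ext (funext fun x => by simp) }
  have hC := isAdicComplete_adicContFun (X := X) (M := AdicCompletion I' (A' ⊗[A] M)) hFG'
  have h1 (n : ℕ) (z) (hz : θ z ∈ (I' ^ n • ⊤ : Submodule A' (adicContFun I' X _))) :
      z ∈ (I' ^ n • ⊤ : Submodule A' (A' ⊗[A] adicContFun I X M)) := by
    refine mem_pow_smul_top_of_forall_eval hFG hI n z fun x => ?_
    rw [← AdicCompletion.of_mem_pow_smul_top_iff]
    exact apply_mem_of_mem_smul_top _ hz x
  have h2 (b) : ∃ z, b - θ z ∈ (I' • ⊤ : Submodule A' (adicContFun I' X _)) := by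
    -- Modulo `I'` the completion is a quotient of `A' ⊗ M`, so the reduction of `b` lifts to a
    -- locally constant function with values in `A' ⊗ M`, which is a step tensor.
    have hsurj : Function.Surjective ((I' ^ 1 • ⊤ : Submodule A' _).mkQ.comp
        (AdicCompletion.of I' (A' ⊗[A] M))) := by
      intro y
      obtain ⟨b, rfl⟩ := Submodule.mkQ_surjective _ y
      obtain ⟨y, hy⟩ := AdicCompletion.exists_of_sub_mem hFG' 1 b
      exact ⟨y, ((Submodule.Quotient.eq _).2 hy).symm⟩
    obtain ⟨w, hw⟩ := exists_lift_locallyConstant hsurj (adicContFunReduce 1 b)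
    obtain ⟨q, rfl⟩ := (LocallyConstant.tensorMap_bijective A').2 w
    refine ⟨stepTensor A' I X M q, ?_⟩
    have h := (mem_pow_smul_top_adicContFun_iff hFG' 1 (b - θ (stepTensor A' I X M q))).2
      fun x => by
        have := (Submodule.Quotient.eq _).1 (hw x).symm
        rw [← adicContFunEval_stepTensor A' I x q] at this
        exact this
    rwa [pow_one] at h
  obtain ⟨e, he⟩ := AdicCompletion.exists_equiv_of_approx I' θ h1 h2
  refine ⟨e, fun a f x => ?_⟩
  rw [he]
  rfl

end BaseChangeContFun
end


noncomputable section

open Filter Topology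

/-! ### The adic topology -/

section MadicTopology

variable {A : Type*} [CommRing A] [IsLocalRing A] {M : Type*} [AddCommGroup M] [Module A M]

local notation "𝔪" => IsLocalRing.maximalIdeal A

theorem madic_nhds_hasBasis (x : M) : (@nhds M (madicTopology A M) x).HasBasis (fun _ : ℕ => True)
    fun n => {y | y - x ∈ (𝔪 ^ n • ⊤ : Submodule A M)} := by
  let _ : TopologicalSpace A := (IsLocalRing.maximalIdeal A).adicTopology
  let B := ((𝔪).ringFilterBasis.moduleFilterBasis
    ((𝔪).adic_module_basis M)).toAddGroupFilterBasis
  refine ⟨fun t => ?_⟩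
  rw [(AddGroupFilterBasis.nhds_hasBasis B x).mem_iff]
  constructor
  · rintro ⟨_, ⟨n, rfl⟩, h⟩
    exact ⟨n, trivial, fun y hy => h ⟨y - x, hy, add_sub_cancel x y⟩⟩
  · rintro ⟨n, -, h⟩
    refine ⟨_, ⟨n, rfl⟩, ?_⟩
    rintro _ ⟨y, hy, rfl⟩
    exact h (by simpa using hy)

theorem continuous_madic_iff {Y : Type*} [TopologicalSpace Y] {f : Y → M} :
    @Continuous Y M _ (madicTopology A M) f ↔
      ∀ y n, ∀ᶠ z in 𝓝 y, f z - f y ∈ (𝔪 ^ n • ⊤ : Submodule A M) := by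
  let _ := madicTopology A M
  rw [continuous_iff_continuousAt]
  refine forall_congr' fun y => ?_
  rw [ContinuousAt, (madic_nhds_hasBasis (A := A) (f y)).tendsto_right_iff]
  simp

theorem continuous_madic_iff_mem_adicContFun {Y : Type*} [TopologicalSpace Y] {f : Y → M} :
    @Continuous Y M _ (madicTopology A M) f ↔ f ∈ adicContFun 𝔪 Y M := by
  rw [continuous_madic_iff, forall_comm]
  refine forall_congr' fun n => ?_
  rw [IsLocallyConstant.iff_eventually_eq]
  exact forall_congr' fun y => eventually_congr (Eventually.of_forall fun z =>
    (Submodule.Quotient.eq _).symm)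

/-- The operators `ρ h` are linear, so they all preserve `𝔪 ^ n M`. By this equicontinuity, joint
continuity reduces to continuity at `1` of each orbit map. -/
theorem isMadicContinuous_iff {H : Type*} [Group H] [TopologicalSpace H] [IsTopologicalGroup H]
    (ρ : Representation A H M) : IsMadicContinuous A ρ ↔ IsAdicComplete 𝔪 M ∧
      ∀ m n, ∀ᶠ h in 𝓝 (1 : H), ρ h m - m ∈ (𝔪 ^ n • ⊤ : Submodule A M) := by
  let _ := madicTopology A M
  constructor
  · refine fun ⟨h1, h2⟩ => ⟨h1, fun m n => ?_⟩
    have h3 : Continuous fun h : H => ρ h m := h2.comp (Continuous.prodMk_left m)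
    simpa using continuous_madic_iff.1 h3 1 n
  · refine fun ⟨h1, h2⟩ => ⟨h1, ?_⟩
    rw [continuous_iff_continuousAt]
    rintro ⟨h₀, m₀⟩
    rw [ContinuousAt, (madic_nhds_hasBasis (A := A) _).tendsto_right_iff]
    intro n _
    have e1 : ∀ᶠ x : H × M in 𝓝 (h₀, m₀), x.2 - m₀ ∈ (𝔪 ^ n • ⊤ : Submodule A M) := by
      have := (madic_nhds_hasBasis (A := A) m₀).mem_of_mem (i := n) trivial
      exact (continuous_snd.tendsto (h₀, m₀)).eventually this
    have e2 : ∀ᶠ x : H × M in 𝓝 (h₀, m₀),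
        ρ (h₀⁻¹ * x.1) m₀ - m₀ ∈ (𝔪 ^ n • ⊤ : Submodule A M) := by
      have hc : Continuous fun x : H × M => h₀⁻¹ * x.1 := continuous_const.mul continuous_fst
      have := hc.tendsto (h₀, m₀)
      simp only [inv_mul_cancel] at this
      exact this.eventually (h2 m₀ n)
    filter_upwards [e1, e2] with x hx1 hx2
    have : ρ x.1 x.2 - ρ h₀ m₀ = ρ x.1 (x.2 - m₀) + ρ h₀ (ρ (h₀⁻¹ * x.1) m₀ - m₀) := by
      rw [map_sub, map_sub, ← Module.End.mul_apply, ← map_mul, mul_inv_cancel_left]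
      abel
    rw [this]
    exact add_mem (Submodule.map_mem_smul_top _ hx1) (Submodule.map_mem_smul_top _ hx2)

end MadicTopology

theorem IsOrthonormalizable.of_equiv {A M N : Type*} [CommRing A] [IsLocalRing A] [AddCommGroup M]
    [Module A M] [AddCommGroup N] [Module A N] (h : IsOrthonormalizable A M) (e : M ≃ₗ[A] N) :
    IsOrthonormalizable A N where
  complete := by
    have := h.complete
    exact IsAdicComplete.of_equiv _ e
  free n hn := by
    have := h.free n hn
    have hmap : (IsLocalRing.maximalIdeal A ^ n • ⊤ : Submodule A M).map (e : M →ₗ[A] N) =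
        IsLocalRing.maximalIdeal A ^ n • ⊤ := by
      rw [Submodule.map_smul'', Submodule.map_top, LinearEquiv.range]
    exact Module.Free.of_equiv (LinearEquiv.extendScalarsOfSurjective (R := A)
      (S := A ⧸ IsLocalRing.maximalIdeal A ^ n) Ideal.Quotient.mk_surjective
      (Submodule.Quotient.equiv _ _ e hmap))

/-! ### Base change of continuous representations -/

/-- Modulo `𝔪_{A'} ^ n`, which the action preserves, a vector can be replaced by a finite sum of
pure tensors. For these, continuity is inherited from `ρ`. -/
theorem isMadicContinuous_completedBaseChangeRep {A A' : Type*} [CommRing A] [IsLocalRing A]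
    [CommRing A'] [IsLocalRing A'] [Algebra A A']
    (hI : (IsLocalRing.maximalIdeal A).map (algebraMap A A') ≤ IsLocalRing.maximalIdeal A')
    (hFG' : (IsLocalRing.maximalIdeal A').FG) {M : Type*} [AddCommGroup M] [Module A M]
    {H : Type*} [Group H] [TopologicalSpace H] [IsTopologicalGroup H] (ρ : Representation A H M)
    (hρ : IsMadicContinuous A ρ) : IsMadicContinuous A' (completedBaseChangeRep A A' ρ) := by
  rw [isMadicContinuous_iff] at hρ ⊢
  refine ⟨AdicCompletion.isAdicComplete hFG', fun b n => ?_⟩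
  obtain ⟨y, hy⟩ := AdicCompletion.exists_of_sub_mem hFG' n b
  have h1 : ∀ᶠ h in 𝓝 (1 : H), LinearMap.baseChange A' (ρ h) y - y ∈
      (IsLocalRing.maximalIdeal A' ^ n • ⊤ : Submodule A' (A' ⊗[A] M)) := by
    clear hy
    induction y with
    | zero => simp
    | add y z hy hz =>
      filter_upwards [hy, hz] with h h1 h2
      rw [map_add, add_sub_add_comm]
      exact add_mem h1 h2
    | tmul a m =>
      filter_upwards [hρ.2 m n] with h h1
      rw [LinearMap.baseChange_tmul, ← TensorProduct.tmul_sub]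
      exact TensorProduct.tmul_mem_pow_smul_top hI a h1
  filter_upwards [h1] with h h1
  have h2 : completedBaseChangeRep A A' ρ h (AdicCompletion.of _ _ y) =
      AdicCompletion.of _ _ (LinearMap.baseChange A' (ρ h) y) := AdicCompletion.map_of _ _ _
  have h3 : completedBaseChangeRep A A' ρ h b - b =
      completedBaseChangeRep A A' ρ h (b - AdicCompletion.of _ _ y) -
        (b - AdicCompletion.of _ _ y) +
        AdicCompletion.of _ _ (LinearMap.baseChange A' (ρ h) y - y) := by
    rw [map_sub, map_sub, h2]; abel
  rw [h3]
  exact add_mem (sub_mem (Submodule.map_mem_smul_top _ hy) hy)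
    (AdicCompletion.of_mem_pow_smul_top_iff.2 h1)

/-- Linear maps are automatically adically continuous, and the image of `N` is dense in its
completion. -/
theorem AdicCompletion.linearMap_ext_of {R N B : Type*} [CommRing R] {I : Ideal R} (hI : I.FG)
    [AddCommGroup N] [Module R N] [AddCommGroup B] [Module R B] [IsHausdorff I B]
    {φ ψ : AdicCompletion I N →ₗ[R] B}
    (h : ∀ y, φ (AdicCompletion.of I N y) = ψ (AdicCompletion.of I N y)) : φ = ψ := by
  refine LinearMap.ext fun b => ?_
  rw [← sub_eq_zero]
  refine IsHausdorff.haus (I := I) inferInstance _ fun n => ?_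
  obtain ⟨y, hy⟩ := AdicCompletion.exists_of_sub_mem hI n b
  have := Submodule.map_mem_smul_top (φ - ψ) hy
  rw [map_sub, LinearMap.sub_apply, LinearMap.sub_apply, h y, sub_self, sub_zero] at this
  exact SModEq.zero.2 this

/-! ### Induction in the presence of a continuous section -/

/-- A continuous section of `G → P \ G` with compact image, and a continuous projection
`P = L ⋉ U → L`. -/
structure ContSection {Γ : Type*} [Group Γ] [TopologicalSpace Γ] (G P L U : Subgroup Γ) where
  /-- the image of the section -/
  X : Set G
  isCompact : IsCompact X
  nonempty : X.Nonempty
  /-- the representative in `X` of a coset of `P` -/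
  sec : G → G
  continuous_sec : Continuous sec
  sec_mem : ∀ g, sec g ∈ X
  sec_of_mem : ∀ x ∈ X, sec x = x
  sec_mul : ∀ (p : P) (g h : G), (h : Γ) = p * g → sec h = sec g
  /-- the component in `P` -/
  fact : G → P
  continuous_fact : Continuous fact
  fact_mul_sec : ∀ g : G, (g : Γ) = fact g * sec g
  /-- the projection onto the Levi factor -/
  lev : P →* L
  continuous_lev : Continuous lev
  lev_iff : ∀ (p : P) (l : L), (l : Γ)⁻¹ * p ∈ U ↔ l = lev p

namespace ContSection

variable {Γ : Type*} [Group Γ] [TopologicalSpace Γ] {G P L U : Subgroup Γ}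
variable (S : ContSection G P L U)

theorem fact_mul (p : P) (g h : G) (hh : (h : Γ) = p * g) : S.fact h = p * S.fact g := by
  have h1 := S.fact_mul_sec h
  rw [S.sec_mul p g h hh, hh] at h1
  nth_rewrite 1 [S.fact_mul_sec g] at h1
  rw [← mul_assoc] at h1
  exact Subtype.ext (mul_right_cancel h1).symm

theorem fact_of_mem (x : G) (hx : x ∈ S.X) : S.fact x = 1 := by
  have h1 := S.fact_mul_sec x
  rw [S.sec_of_mem x hx] at h1
  exact Subtype.ext (by simpa using h1)

variable {A : Type*} [CommRing A] [IsLocalRing A] {M : Type*} [AddCommGroup M] [Module A M]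

local notation "𝔪" => IsLocalRing.maximalIdeal A

theorem apply_eq {ρ : Representation A L M} (f : contInd A G P U ρ) (g : G) :
    f.1 g = ρ (S.lev (S.fact g)) (f.1 (S.sec g)) :=
  f.2.2 (S.fact g) _ (S.sec g) g ((S.lev_iff _ _).2 rfl) (S.fact_mul_sec g)

/-- A continuous function in the induced representation is determined by its values on the image
of the section, which can be prescribed. -/
def contIndEquiv (ρ : Representation A L M) (hρ : IsMadicContinuous A ρ) :
    contInd A G P U ρ ≃ₗ[A] adicContFun 𝔪 S.X M where
  toFun f := ⟨fun x => f.1 x, continuous_madic_iff_mem_adicContFun.1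
    (@Continuous.comp _ _ _ _ _ (madicTopology A M) _ _ f.2.1 continuous_subtype_val)⟩
  map_add' _ _ := rfl
  map_smul' _ _ := rfl
  invFun h := ⟨fun g => ρ (S.lev (S.fact g)) (h.1 ⟨S.sec g, S.sec_mem g⟩), by
    refine ⟨?_, fun p l g g' hl hg => ?_⟩
    · let _ : TopologicalSpace M := madicTopology A M
      have h1 : Continuous h.1 := continuous_madic_iff_mem_adicContFun.2 h.2
      have h2 : Continuous fun g : G => (S.lev (S.fact g), h.1 ⟨S.sec g, S.sec_mem g⟩) :=
        (S.continuous_lev.comp S.continuous_fact).prodMk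
          (h1.comp (S.continuous_sec.subtype_mk S.sec_mem))
      -- Both the operator and the vector vary with `g`, so joint continuity of the action is needed
      -- here.
      exact hρ.continuous.comp h2
    · have h1 : (⟨S.sec g', S.sec_mem g'⟩ : S.X) = ⟨S.sec g, S.sec_mem g⟩ :=
        Subtype.ext (S.sec_mul p g g' hg)
      beta_reduce
      rw [h1, S.fact_mul p g g' hg, map_mul, map_mul, (S.lev_iff p l).1 hl]
      rfl⟩
  left_inv f := Subtype.ext (funext fun g => (S.apply_eq f g).symm)
  right_inv h := Subtype.ext (funext fun x => by
    have h1 : (⟨S.sec x, S.sec_mem x⟩ : S.X) = x := Subtype.ext (S.sec_of_mem x x.2)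
    simp only [h1, S.fact_of_mem x x.2, map_one, Module.End.one_apply])

variable {ρ : Representation A L M}

/-- On `X` this is the criterion for `C(X, M)`. The other values are obtained from those on `X` by
operators of `L`, which preserve `𝔪 ^ n M`. -/
theorem mem_pow_smul_top_contInd_iff (S : ContSection G P L U) (hA : (𝔪).FG) (hρ : IsMadicContinuous A ρ) (n : ℕ)
    (f : contInd A G P U ρ) : f ∈ (𝔪 ^ n • ⊤ : Submodule A (contInd A G P U ρ)) ↔
      ∀ g, f.1 g ∈ (𝔪 ^ n • ⊤ : Submodule A M) := by
  have := hρ.complete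
  have h1 : f ∈ (𝔪 ^ n • ⊤ : Submodule A (contInd A G P U ρ)) ↔
      S.contIndEquiv ρ hρ f ∈ (𝔪 ^ n • ⊤ : Submodule A (adicContFun 𝔪 S.X M)) := by
    constructor
    · exact Submodule.map_mem_smul_top (S.contIndEquiv ρ hρ).toLinearMap
    · intro h
      have := Submodule.map_mem_smul_top (S.contIndEquiv ρ hρ).symm.toLinearMap h
      simpa using this
  rw [h1, mem_pow_smul_top_adicContFun_iff hA]
  refine ⟨fun h g => ?_, fun h x => h x⟩
  rw [S.apply_eq f g]
  exact Submodule.map_mem_smul_top _ (h ⟨S.sec g, S.sec_mem g⟩)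

theorem isOrthonormalizable_contInd_iff (S : ContSection G P L U) [T2Space G]
    [TotallyDisconnectedSpace G] (hA : (𝔪).FG) (hρ : IsMadicContinuous A ρ) :
    IsOrthonormalizable A (contInd A G P U ρ) ↔ IsOrthonormalizable A M := by
  have : CompactSpace S.X := isCompact_iff_compactSpace.1 S.isCompact
  have : Nonempty S.X := S.nonempty.to_subtype
  rw [← isOrthonormalizable_adicContFun_iff hA (X := S.X) hρ.complete]
  exact ⟨fun h => h.of_equiv (S.contIndEquiv ρ hρ), fun h => h.of_equiv (S.contIndEquiv ρ hρ).symm⟩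

variable [IsTopologicalGroup Γ]

/-- By compactness of `X`, translation by `k` close to `1` moves `f` by elements of `𝔪 ^ n M`
uniformly on `X`. Equivariance spreads the estimate to all of `G`. -/
theorem isMadicContinuous_contIndRep (S : ContSection G P L U) (hA : (𝔪).FG) (hρ : IsMadicContinuous A ρ) :
    IsMadicContinuous A (contIndRep A G P U ρ) := by
  have := hρ.complete
  rw [isMadicContinuous_iff]
  refine ⟨?_, fun f n => ?_⟩
  · have := isAdicComplete_adicContFun (X := S.X) (M := M) hA
    exact IsAdicComplete.of_equiv _ (S.contIndEquiv ρ hρ).symm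
  · have h1 : ∀ᶠ k in 𝓝 (1 : G), ∀ x ∈ S.X, f.1 (x * k) - f.1 x ∈
        (𝔪 ^ n • ⊤ : Submodule A M) := by
      refine S.isCompact.eventually_forall_of_forall_eventually fun x _ => ?_
      have h2 := continuous_madic_iff.1 f.2.1 x n
      have h3 : ∀ᶠ z : G × G in 𝓝 ((1 : G), x), f.1 (z.2 * z.1) - f.1 x ∈
          (𝔪 ^ n • ⊤ : Submodule A M) := by
        have hc : Continuous fun z : G × G => z.2 * z.1 := continuous_snd.mul continuous_fst
        have := hc.tendsto ((1 : G), x)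
        simp only [mul_one] at this
        exact this.eventually h2
      have h4 : ∀ᶠ z : G × G in 𝓝 ((1 : G), x), f.1 z.2 - f.1 x ∈
          (𝔪 ^ n • ⊤ : Submodule A M) := (continuous_snd.tendsto ((1 : G), x)).eventually h2
      filter_upwards [h3, h4] with z h3 h4
      rw [← sub_sub_sub_cancel_right _ _ (f.1 x)]
      exact sub_mem h3 h4
    filter_upwards [h1] with k hk
    rw [S.mem_pow_smul_top_contInd_iff hA hρ]
    intro g
    change f.1 (g * k) - f.1 g ∈ _
    have h5 : f.1 (g * k) = ρ (S.lev (S.fact g)) (f.1 (S.sec g * k)) :=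
      f.2.2 (S.fact g) _ (S.sec g * k) (g * k) ((S.lev_iff _ _).2 rfl) (by
        rw [Subgroup.coe_mul, Subgroup.coe_mul, ← mul_assoc, ← S.fact_mul_sec g])
    rw [h5, S.apply_eq f g, ← map_sub]
    exact Submodule.map_mem_smul_top _ (hk _ (S.sec_mem g))

/-- The isomorphism restricts to `X`, interchanges base change with `C(X, -)`, and extends back to
`G`. Right translation by `G` need not preserve `X`, so equivariance is checked on pure tensors,
where the formula no longer involves `X`, and extended by density. -/
theorem exists_completedBaseChange_equiv (S : ContSection G P L U) {A' : Type*} [CommRing A'] [IsLocalRing A'] [Algebra A A']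
    (hI : (𝔪).map (algebraMap A A') ≤ IsLocalRing.maximalIdeal A') (hA : (𝔪).FG)
    (hA' : (IsLocalRing.maximalIdeal A').FG) (hρ : IsMadicContinuous A ρ)
    (hL : IsMadicContinuous A' (completedBaseChangeRep A A' ρ)) :
    ∃ e : CompletedBaseChange A A' (contInd A G P U ρ) ≃ₗ[A']
        contInd A' G P U (completedBaseChangeRep A A' ρ),
      (∀ (x : G) (y : CompletedBaseChange A A' (contInd A G P U ρ)),
        e (completedBaseChangeRep A A' (contIndRep A G P U ρ) x y) =
          contIndRep A' G P U (completedBaseChangeRep A A' ρ) x (e y)) ∧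
      ∀ (a' : A') (f : contInd A G P U ρ) (g : G),
        (e (completedTmul A A' a' f)).1 g = completedTmul A A' a' (f.1 g) := by
  have := hρ.complete
  have : CompactSpace S.X := isCompact_iff_compactSpace.1 S.isCompact
  obtain ⟨e₀, he₀⟩ := exists_completedBaseChange_adicContFun_equiv (X := S.X) (M := M) hA hA' hI
  let e₁ : CompletedBaseChange A A' (contInd A G P U ρ) ≃ₗ[A']
      AdicCompletion (IsLocalRing.maximalIdeal A') (A' ⊗[A] adicContFun 𝔪 S.X M) :=
    (AdicCompletion.congr _ ((S.contIndEquiv ρ hρ).baseChange A A' _ _)).restrictScalars A'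
  let e := (e₁.trans e₀).trans (S.contIndEquiv _ hL).symm
  have he (a' : A') (f : contInd A G P U ρ) (g : G) :
      (e (completedTmul A A' a' f)).1 g = completedTmul A A' a' (f.1 g) := by
    have h1 : e₁ (completedTmul A A' a' f) =
        AdicCompletion.of _ _ (a' ⊗ₜ S.contIndEquiv ρ hρ f) := AdicCompletion.map_of _ _ _
    have h2 : (e (completedTmul A A' a' f)).1 g =
        completedBaseChangeRep A A' ρ (S.lev (S.fact g))
          ((e₀ (e₁ (completedTmul A A' a' f))).1 ⟨S.sec g, S.sec_mem g⟩) := rfl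
    rw [h2, h1, he₀, S.apply_eq f g]
    exact AdicCompletion.map_of _ _ _
  refine ⟨e, fun x => ?_, he⟩
  have hc := (S.isMadicContinuous_contIndRep hA' hL).complete
  have key : e.toLinearMap ∘ₗ completedBaseChangeRep A A' (contIndRep A G P U ρ) x =
      contIndRep A' G P U (completedBaseChangeRep A A' ρ) x ∘ₗ e.toLinearMap := by
    refine AdicCompletion.linearMap_ext_of hA' fun z => ?_
    induction z with
    | zero => simp
    | add z w hz hw => simp only [map_add, hz, hw]
    | tmul a' f =>
      refine Subtype.ext (funext fun g => ?_)
      have h1 : completedBaseChangeRep A A' (contIndRep A G P U ρ) x (completedTmul A A' a' f) =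
        completedTmul A A' a' (contIndRep A G P U ρ x f) := AdicCompletion.map_of _ _ _
      refine (congrArg (fun w => (e w).1 g) h1).trans ?_
      rw [he]
      exact (he a' f (g * x)).symm
  exact fun y => LinearMap.congr_fun key y

end ContSection
end


noncomputable section

/-! ### Differentials of polynomials and dual numbers -/

namespace MvPolynomial

section Differential

variable {k K ι κ : Type*} [CommRing k] [CommRing K] [Algebra k K] [Fintype ι]

/-- The differential of the polynomial `p` at the point `x`, applied to the vector `t`. -/
def differentialAt (p : MvPolynomial ι k) (x t : ι → K) : K :=
  ∑ i, aeval x (pderiv i p) * t i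

/-- First-order Taylor expansion: the differential is the `ε`-part of the value at the dual-number
point `x + ε t`. Rules for differentials thereby become properties of ring homomorphisms. -/
theorem aeval_inl_add_inr (p : MvPolynomial ι k) (x t : ι → K) :
    aeval (fun i => (TrivSqZeroExt.inl (x i) + TrivSqZeroExt.inr (t i) : DualNumber K)) p =
      TrivSqZeroExt.inl (aeval x p) + TrivSqZeroExt.inr (differentialAt p x t) := by
  classical
  induction p using MvPolynomial.induction_on with
  | C a =>
    rw [aeval_C, aeval_C]
    ext <;> simp [differentialAt, TrivSqZeroExt.algebraMap_eq_inl']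
  | add p q hp hq =>
    rw [map_add, hp, hq]
    ext <;> simp [differentialAt, add_mul, Finset.sum_add_distrib]
  | mul_X p i hp =>
    rw [map_mul, hp, aeval_X]
    ext
    · simp
    · have : differentialAt (p * X i) x t = x i * differentialAt p x t + aeval x p * t i := by
        simp only [differentialAt, Derivation.leibniz, pderiv_X, smul_eq_mul, map_add, map_mul,
          aeval_X, add_mul, Finset.sum_add_distrib, Finset.mul_sum]
        rw [add_comm]
        congr 1
        · exact Finset.sum_congr rfl fun j _ => by ring
        · rw [Finset.sum_eq_single i]
          · simp
          · intro j _ hj; simp [hj.symm]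
          · simp
      simp [this, mul_comm]

theorem differentialAt_eq_snd (p : MvPolynomial ι k) (x t : ι → K) :
    differentialAt p x t = TrivSqZeroExt.snd (aeval
      (fun i => (TrivSqZeroExt.inl (x i) + TrivSqZeroExt.inr (t i) : DualNumber K)) p) := by
  rw [aeval_inl_add_inr]
  simp

theorem differentialAt_bind₁ [Fintype κ] (Ψ : κ → MvPolynomial ι k) (p : MvPolynomial κ k) (x t : ι → K) :
    differentialAt (bind₁ Ψ p) x t =
      differentialAt p (fun j => aeval x (Ψ j)) (fun j => differentialAt (Ψ j) x t) := by
  have h := aeval_inl_add_inr (bind₁ Ψ p) x t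
  rw [aeval_bind₁] at h
  simp_rw [aeval_inl_add_inr] at h
  simpa using (congrArg TrivSqZeroExt.snd h).symm

theorem differentialAt_sub (p q : MvPolynomial ι k) (x t : ι → K) :
    differentialAt (p - q) x t = differentialAt p x t - differentialAt q x t := by
  simp [differentialAt_eq_snd]

theorem differentialAt_add (p q : MvPolynomial ι k) (x t : ι → K) :
    differentialAt (p + q) x t = differentialAt p x t + differentialAt q x t := by
  simp [differentialAt_eq_snd]

theorem differentialAt_mul (p q : MvPolynomial ι k) (x t : ι → K) :
    differentialAt (p * q) x t = aeval x p * differentialAt q x t +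
      aeval x q * differentialAt p x t := by
  rw [differentialAt_eq_snd, map_mul, aeval_inl_add_inr, aeval_inl_add_inr]
  simp [mul_comm]

theorem differentialAt_C (c : k) (x t : ι → K) : differentialAt (C c) x t = 0 := by
  simp [differentialAt]

theorem differentialAt_X (i : ι) (x t : ι → K) : differentialAt (X i : MvPolynomial ι k) x t = t i := by
  classical
  simp [differentialAt, pderiv_X, Pi.single_apply]

theorem differentialAt_sum {α : Type*} (s : Finset α) (p : α → MvPolynomial ι k) (x t : ι → K) :
    differentialAt (∑ j ∈ s, p j) x t = ∑ j ∈ s, differentialAt (p j) x t := by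
  classical
  induction s using Finset.induction_on with
  | empty => simp [differentialAt]
  | insert a s ha ih => rw [Finset.sum_insert ha, Finset.sum_insert ha, differentialAt_add, ih]

theorem differentialAt_smul (p : MvPolynomial ι k) (x t : ι → K) (c : K) :
    differentialAt p x (fun i => c * t i) = c * differentialAt p x t := by
  simp only [differentialAt, Finset.mul_sum]
  exact Finset.sum_congr rfl fun i _ => by ring

end Differential

section LinearForms

variable {k ι κ : Type*} [CommRing k] [Fintype ι]

/-- The linear forms given by a matrix. -/
def linearForms (m : Matrix κ ι k) (j : κ) : MvPolynomial ι k := ∑ i, C (m j i) * X i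

theorem aeval_linearForms (m : Matrix κ ι k) (x : ι → k) (j : κ) :
    aeval x (linearForms m j) = m.mulVec x j := by
  simp [linearForms, Matrix.mulVec, dotProduct]

theorem differentialAt_linearForms (m : Matrix κ ι k) (x t : ι → k) (j : κ) :
    differentialAt (linearForms m j) x t = m.mulVec t j := by
  simp [linearForms, Matrix.mulVec, dotProduct, differentialAt_sum, differentialAt_mul,
    differentialAt_C, differentialAt_X]

end LinearForms

end MvPolynomial

/-! ### Minimal primes over radical ideals -/

/-- Otherwise the multiplicative set generated by `f` and the complement of `q` avoids the radical
ideal `I`. A prime above `I` disjoint from that set would lie in `q` and miss `f`, against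
minimality. -/
theorem Ideal.exists_notMem_mul_mem_of_mem_minimalPrimes {R : Type*} [CommRing R] {I q : Ideal R}
    (hI : I.IsRadical) (hq : q ∈ I.minimalPrimes) {f : R} (hf : f ∈ q) : ∃ u ∉ q, u * f ∈ I := by
  have hqp : q.IsPrime := hq.1.1
  by_contra! h
  have hdisj : Disjoint (I : Set R) (q.primeCompl ⊔ Submonoid.powers f : Submonoid R) := by
    rw [Set.disjoint_left]
    intro x hxI hx
    obtain ⟨u, hu, _, ⟨n, rfl⟩, rfl⟩ := Submonoid.mem_sup.1 hx
    refine h u hu (hI ⟨n + 1, ?_⟩)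
    have : (u * f) ^ (n + 1) = u ^ n * f * (u * f ^ n) := by ring
    rw [this]
    exact I.mul_mem_left _ hxI
  obtain ⟨p, hp, hIp, hpd⟩ := Ideal.exists_le_prime_disjoint I _ hdisj
  have hpq : p ≤ q := fun x hx => by
    by_contra hxq
    exact Set.disjoint_left.1 hpd hx (Submonoid.mem_sup_left hxq)
  exact Set.disjoint_left.1 hpd (hq.2 ⟨hp, hIp⟩ hpq hf)
    (Submonoid.mem_sup_right (Submonoid.mem_powers f))

theorem Ideal.exists_notMem_forall_mul_mem {R : Type*} [CommRing R] [IsNoetherianRing R]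
    {I q : Ideal R} (hI : I.IsRadical) (hq : q ∈ I.minimalPrimes) :
    ∃ u ∉ q, ∀ f ∈ q, u * f ∈ I := by
  classical
  have hqp : q.IsPrime := hq.1.1
  obtain ⟨T, hT⟩ := (isNoetherianRing_iff_ideal_fg R).1 inferInstance q
  have h (f : T) : ∃ u ∉ q, u * f ∈ I :=
    Ideal.exists_notMem_mul_mem_of_mem_minimalPrimes hI hq (hT ▸ Ideal.subset_span f.2)
  choose u hu hu' using h
  refine ⟨∏ f, u f, fun hmem => ?_, fun f hf => ?_⟩
  · obtain ⟨f, _, hf⟩ := (Ideal.IsPrime.prod_mem_iff (p := q)).1 hmem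
    exact hu f hf
  · rw [← hT] at hf
    refine Submodule.span_induction (p := fun f _ => (∏ g, u g) * f ∈ I) ?_ ?_ ?_ ?_ hf
    · intro g hg
      rw [← Finset.prod_erase_mul _ _ (Finset.mem_univ (⟨g, hg⟩ : T)), mul_assoc]
      exact I.mul_mem_left _ (hu' ⟨g, hg⟩)
    · simp
    · intro x y _ _ hx hy
      rw [mul_add]; exact add_mem hx hy
    · intro a x _ hx
      rw [smul_eq_mul, mul_left_comm]; exact I.mul_mem_left _ hx

theorem Algebra.FormallySmooth.exists_ringHom_section {K₀ K B : Type*} [CommRing K₀] [CommRing K]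
    [CommRing B] [Algebra K₀ K] [Algebra.FormallySmooth K₀ K] (ψ₀ : K₀ →+* B) (π : B →+* K)
    (hπ : Function.Surjective π) (hker : IsNilpotent (RingHom.ker π))
    (h : ∀ a, π (ψ₀ a) = algebraMap K₀ K a) :
    ∃ ψ : K →+* B, (∀ a, π (ψ a) = a) ∧ ∀ a, ψ (algebraMap K₀ K a) = ψ₀ a := by
  let _ := ψ₀.toAlgebra
  let π' : B →ₐ[K₀] K := { π with commutes' := h }
  refine ⟨(Algebra.FormallySmooth.liftOfSurjective (AlgHom.id K₀ K) π' hπ hker : K →ₐ[K₀] B),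
    fun a => ?_, fun a => ?_⟩
  · exact Algebra.FormallySmooth.liftOfSurjective_apply (AlgHom.id K₀ K) π' hπ hker a
  · exact AlgHom.commutes _ a

theorem DualNumber.isNilpotent_ker_fst (K : Type*) [CommRing K] :
    IsNilpotent (RingHom.ker (TrivSqZeroExt.fstHom K K K : DualNumber K →+* K)) := by
  refine ⟨2, ?_⟩
  refine Eq.trans (pow_two (RingHom.ker (TrivSqZeroExt.fstHom K K K : DualNumber K →+* K))) ?_
  rw [Ideal.zero_eq_bot, eq_bot_iff, Ideal.mul_le]
  intro a ha b hb
  have ha' : a.fst = 0 := ha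
  have hb' : b.fst = 0 := hb
  rw [Ideal.mem_bot]
  ext <;> simp [ha', hb']
-- Lifting tangent vectors through an orbit map in characteristic zero
namespace MvPolynomial

/-- A tangent vector at `y` is a derivation of `k[y]` into `K`, encoded as a homomorphism to dual
numbers that lifts the inclusion. It extends to the fraction field `K₀`, and then to `K`, because
`K` is formally smooth over the perfect field `K₀` of characteristic zero. -/
theorem exists_extend_tangent {k K κ : Type*} [Field k] [CharZero k] [Field K] [Algebra k K]
    [Algebra.EssFiniteType k K] [Fintype κ] (y τ : κ → K)
    (h : ∀ p : MvPolynomial κ k, aeval y p = 0 → differentialAt p y τ = 0) :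
    ∃ ψ : K →ₐ[k] DualNumber K, (∀ a, (ψ a).fst = a) ∧ ∀ j, (ψ (y j)).snd = τ j := by
  let I := RingHom.ker (aeval (R := k) y)
  have hI : I.IsPrime := RingHom.ker_isPrime _
  let ψ₁ : MvPolynomial κ k ⧸ I →ₐ[k] DualNumber K := Ideal.Quotient.liftₐ I
    (aeval fun j => (TrivSqZeroExt.inl (y j) + TrivSqZeroExt.inr (τ j) : DualNumber K)) (by
      intro p hp
      have hp' : aeval y p = 0 := hp
      rw [aeval_inl_add_inr, hp', h p hp']
      simp)
  let j₁ : MvPolynomial κ k ⧸ I →ₐ[k] K := Ideal.Quotient.liftₐ I (aeval y) fun p hp => hp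
  have hj₁ : Function.Injective j₁ := by
    rw [injective_iff_map_eq_zero]
    intro p
    obtain ⟨p, rfl⟩ := Ideal.Quotient.mk_surjective p
    exact fun hp => Ideal.Quotient.eq_zero_iff_mem.2 hp
  have h1 (p) : (ψ₁ p).fst = j₁ p := by
    obtain ⟨p, rfl⟩ := Ideal.Quotient.mk_surjective p
    change (aeval _ p : DualNumber K).fst = aeval y p
    rw [aeval_inl_add_inr]
    simp
  let K₀ := FractionRing (MvPolynomial κ k ⧸ I)
  let j₀ : K₀ →+* K := IsFractionRing.lift (g := j₁.toRingHom) hj₁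
  let _ : Algebra K₀ K := j₀.toAlgebra
  have hj₀ (p) : j₀ (algebraMap _ K₀ p) = j₁ p := IsFractionRing.lift_algebraMap _ _
  have htower : IsScalarTower k K₀ K := IsScalarTower.of_algebraMap_eq fun c => by
    rw [IsScalarTower.algebraMap_apply k (MvPolynomial κ k ⧸ I) K₀]
    exact ((hj₀ _).trans (j₁.commutes c)).symm
  have : CharZero K₀ := charZero_of_injective_algebraMap (algebraMap k K₀).injective
  have : Algebra.EssFiniteType K₀ K := Algebra.EssFiniteType.of_comp k K₀ K
  have : Algebra.FormallySmooth K₀ K := Algebra.FormallySmooth.of_perfectField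
  let ψ₀ : K₀ →+* DualNumber K := IsLocalization.lift (M := nonZeroDivisors (MvPolynomial κ k ⧸ I))
    (g := (ψ₁ : _ →+* DualNumber K)) (by
      intro p
      rw [TrivSqZeroExt.isUnit_iff_isUnit_fst]
      change IsUnit (ψ₁ p).fst
      rw [h1]
      exact ((map_ne_zero_iff j₁ hj₁).2 (nonZeroDivisors.ne_zero p.2)).isUnit)
  have hψ₀ (p) : ψ₀ (algebraMap _ K₀ p) = ψ₁ p := IsLocalization.lift_eq _ _
  obtain ⟨ψ, hψ, hψ'⟩ := Algebra.FormallySmooth.exists_ringHom_section (K₀ := K₀) (K := K) ψ₀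
    (TrivSqZeroExt.fstHom K K K : DualNumber K →+* K) (fun a => ⟨TrivSqZeroExt.inl a, rfl⟩)
    (DualNumber.isNilpotent_ker_fst K) (by
      intro a
      change ((TrivSqZeroExt.fstHom K K K : DualNumber K →+* K).comp ψ₀) a = j₀ a
      congr 1
      refine IsLocalization.ringHom_ext (nonZeroDivisors (MvPolynomial κ k ⧸ I)) ?_
      refine RingHom.ext fun p => ?_
      change (ψ₀ (algebraMap _ K₀ p)).fst = j₀ (algebraMap _ K₀ p)
      rw [hψ₀, hj₀, h1])
  refine ⟨{ ψ with commutes' := fun c => ?_ }, hψ, fun j => ?_⟩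
  · change ψ (algebraMap k K c) = _
    rw [IsScalarTower.algebraMap_apply k K₀ K, hψ',
      IsScalarTower.algebraMap_apply k (MvPolynomial κ k ⧸ I) K₀, hψ₀]
    exact ψ₁.commutes c
  · change (ψ (y j)).snd = τ j
    have hy : y j = algebraMap K₀ K (algebraMap _ K₀ (Ideal.Quotient.mk I (X j))) := by
      refine Eq.trans ?_ (hj₀ _).symm
      exact (aeval_X y j).symm
    rw [hy, hψ', hψ₀]
    change (aeval _ (X j) : DualNumber K).snd = τ j
    rw [aeval_X]
    simp

/-- Generic smoothness plus homogeneity. Here `h ↦ Φ (a h)` is the orbit map, `M` the linear action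
on its target, and `lam` left translation on the source. The vector `t` at the base point is spread
to the field `h ↦ M(h) t` along the orbit, lifted at the generic point of a component of the closure
of `a(H)`, specialised to some `h`, and translated back to `1`. -/
theorem exists_tangent_lift {k H ι κ : Type*} [Field k] [CharZero k] [Group H] [Fintype ι]
    [Fintype κ] [DecidableEq κ] (a : H → ι → k) (Φ : κ → MvPolynomial ι k)
    (M : κ → κ → MvPolynomial ι k)
    (lam : H → ι → MvPolynomial ι k) (ha : ∀ g h, a (g * h) = fun i => aeval (a h) (lam g i))
    (hb : ∀ g h j, aeval (a (g * h)) (Φ j) = ∑ l, aeval (a g) (M j l) * aeval (a h) (Φ l))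
    (hM : ∀ g j l, ∑ i, aeval (a g⁻¹) (M j i) * aeval (a g) (M i l) = if j = l then 1 else 0)
    (t : κ → k)
    (ht : ∀ p ∈ vanishingIdeal k (Set.range fun h j => aeval (a h) (Φ j)),
      differentialAt p (fun j => aeval (a 1) (Φ j)) t = 0) :
    ∃ ζ : ι → k, (∀ q ∈ vanishingIdeal k (Set.range a), differentialAt q (a 1) ζ = 0) ∧
      ∀ j, differentialAt (Φ j) (a 1) ζ = t j := by
  set Ia := vanishingIdeal k (Set.range a) with hIa
  set b : H → κ → k := fun h j => aeval (a h) (Φ j) with hbdef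
  set Ib := vanishingIdeal k (Set.range b) with hIb
  have mem_Ia (f) : f ∈ Ia ↔ ∀ h, aeval (a h) f = 0 := by
    simp [hIa, mem_vanishingIdeal_iff]
  have mem_Ib (f) : f ∈ Ib ↔ ∀ h, aeval (b h) f = 0 := by
    simp [hIb, mem_vanishingIdeal_iff]
  have hbind (h) (f : MvPolynomial κ k) : aeval (a h) (bind₁ Φ f) = aeval (b h) f := by
    rw [aeval_bind₁]
  have hcomap : Ib = Ia.comap (bind₁ Φ) := by
    ext f
    rw [Ideal.mem_comap, mem_Ia, mem_Ib]
    simp only [hbind]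
  have radIa : Ia.IsRadical := by
    rintro f ⟨n, hn⟩
    rw [mem_Ia] at hn ⊢
    intro h
    have := hn h
    rw [map_pow] at this
    exact eq_zero_of_pow_eq_zero this
  have radIb : Ib.IsRadical := hcomap ▸ radIa.comap _
  have hIb_top : Ib ≠ ⊤ := by
    rw [Ne, Ideal.eq_top_iff_one, mem_Ib]
    intro h
    simpa using h 1
  -- `r` is a component of the orbit closure and `q` a component upstairs that dominates it; `K`
  -- will be the function field of `q`.
  obtain ⟨r, hr⟩ := Ideal.nonempty_minimalPrimes hIb_top
  obtain ⟨q, hq, hqr⟩ := Ideal.exists_minimalPrimes_comap_eq (bind₁ Φ : _ →+* MvPolynomial ι k)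
    (I := Ia) r (by rw [hcomap] at hr; exact hr)
  have hqr' (f) : f ∈ r ↔ bind₁ Φ f ∈ q := by
    rw [← hqr]; rfl
  have hqp : q.IsPrime := hq.1.1
  let Q := MvPolynomial ι k ⧸ q
  let K := FractionRing Q
  have : CharZero K := charZero_of_injective_algebraMap (algebraMap k K).injective
  let x : ι → K := fun i => algebraMap Q K (Ideal.Quotient.mk q (X i))
  have hx (f : MvPolynomial ι k) : aeval x f = algebraMap Q K (Ideal.Quotient.mk q f) := by
    have : aeval x = (IsScalarTower.toAlgHom k Q K).comp (Ideal.Quotient.mkₐ k q) := by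
      ext i
      simp [x]
      rfl
    rw [this]
    rfl
  have hx0 (f : MvPolynomial ι k) : aeval x f = 0 ↔ f ∈ q := by
    rw [hx, FaithfulSMul.algebraMap_eq_zero_iff, Ideal.Quotient.eq_zero_iff_mem]
  let T : κ → MvPolynomial ι k := fun j => ∑ l, M j l * C (t l)
  let y : κ → K := fun j => aeval x (Φ j)
  have hy (f : MvPolynomial κ k) : aeval y f = aeval x (bind₁ Φ f) := by
    rw [aeval_bind₁]
  -- The field `T` is tangent to the orbit closure: at `b h`, apply tangency of `t` at `b 1` to the
  -- translate of `p` by `M(h)`, which also vanishes on the orbit.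
  have step (p) (hp : p ∈ Ib) : differentialAt p y (fun j => aeval x (T j)) = 0 := by
    have : differentialAt p y (fun j => aeval x (T j)) =
        aeval x (∑ j, bind₁ Φ (pderiv j p) * T j) := by
      simp only [differentialAt, map_sum, map_mul, hy]
    rw [this, hx0]
    refine hq.1.2 ((mem_Ia _).2 fun h => ?_)
    let m : Matrix κ κ k := fun j l => aeval (a h) (M j l)
    have hmb (g) : m.mulVec (b g) = b (h * g) := by
      ext j
      simp only [Matrix.mulVec, dotProduct, m, hbdef, hb]
    have key := ht (bind₁ (linearForms m) p) ((mem_Ib _).2 fun g => by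
      rw [aeval_bind₁]
      simp only [aeval_linearForms, hmb]
      exact (mem_Ib _).1 hp _)
    rw [differentialAt_bind₁] at key
    simp only [aeval_linearForms, differentialAt_linearForms] at key
    have hb1 : m.mulVec (b 1) = b h := by rw [hmb, mul_one]
    rw [show (fun j => m.mulVec (fun j => aeval (a 1) (Φ j)) j) = b h from hb1] at key
    rw [← key]
    simp only [differentialAt, map_sum, map_mul, hbind, T, aeval_C, Matrix.mulVec, dotProduct, m,
      Algebra.algebraMap_self, RingHom.id_apply]
  obtain ⟨ψ, hψ, hψ'⟩ := exists_extend_tangent (k := k) y (fun j => aeval x (T j)) (by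
    intro p hp
    rw [hy, hx0] at hp
    have hpr : p ∈ r := (hqr' p).2 hp
    obtain ⟨s, hs, hsp⟩ := Ideal.exists_notMem_mul_mem_of_mem_minimalPrimes radIb hr hpr
    have h1 := step _ hsp
    rw [differentialAt_mul, hy p, (hx0 _).2 hp, zero_mul, add_zero] at h1
    refine (mul_eq_zero.1 h1).resolve_left fun h0 => hs ?_
    rw [hy, hx0] at h0
    exact (hqr' s).2 h0)
  let ξ : ι → K := fun i => (ψ (x i)).snd
  have hψx (f : MvPolynomial ι k) : (ψ (aeval x f)).snd = differentialAt f x ξ := by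
    have : ψ (aeval x f) = aeval (fun i => ψ (x i)) f := by
      rw [comp_aeval_apply]
    rw [this, differentialAt_eq_snd]
    congr 3
    ext i
    · simp [hψ]
    · simp [ξ]
  -- Clear denominators: `ξ` has rational functions as entries, while `s ξ` is given by polynomials
  -- `z`.
  obtain ⟨s', hs'⟩ := IsLocalization.exist_integer_multiples_of_finite (nonZeroDivisors Q) ξ
  obtain ⟨s, hs⟩ := Ideal.Quotient.mk_surjective (s' : Q)
  choose z' hz' using hs'
  choose z hz using fun i => Ideal.Quotient.mk_surjective (z' i)
  have hzξ (i) : aeval x (z i) = aeval x s * ξ i := by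
    rw [hx, hx, hz, hs, hz', Algebra.smul_def]
  have hsq : s ∉ q := by
    rw [← Ideal.Quotient.eq_zero_iff_mem, hs]
    exact nonZeroDivisors.ne_zero s'.2
  have hsum (f) : aeval x (∑ i, pderiv i f * z i) = aeval x s * differentialAt f x ξ := by
    rw [map_sum, differentialAt, Finset.mul_sum]
    refine Finset.sum_congr rfl fun i _ => ?_
    rw [map_mul, hzξ]
    ring
  -- Where `u` does not vanish, every element of `q` vanishes on `a(H)`. A point `h` with `u s ≠ 0`
  -- there lets identities at the generic point be specialised and divided by `s`.
  obtain ⟨u, hu, huq⟩ := Ideal.exists_notMem_forall_mul_mem radIa hq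
  obtain ⟨h, hh⟩ : ∃ h, aeval (a h) (u * s) ≠ 0 := by
    by_contra! h0
    exact (hqp.mem_or_mem (hq.1.2 ((mem_Ia _).2 h0))).elim hu hsq
  rw [map_mul, mul_ne_zero_iff] at hh
  have heval (f) (hf : f ∈ q) : aeval (a h) f = 0 := by
    have := (mem_Ia _).1 (huq f hf) h
    rw [map_mul] at this
    exact (mul_eq_zero.1 this).resolve_left hh.1
  let zh : ι → k := fun i => aeval (a h) (z i)
  have tang (f) (hf : f ∈ Ia) : differentialAt f (a h) zh = 0 := by
    have := heval (∑ i, pderiv i f * z i) ((hx0 _).1 (by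
      rw [hsum, ← hψx, (hx0 _).2 (hq.1.2 hf)]
      simp))
    simpa only [map_sum, map_mul, differentialAt] using this
  have hΦ (j) : differentialAt (Φ j) (a h) zh =
      aeval (a h) s * ∑ l, aeval (a h) (M j l) * t l := by
    have := heval (∑ i, pderiv i (Φ j) * z i - s * T j) ((hx0 _).1 (by
      rw [map_sub, hsum, ← hψx, map_mul, show aeval x (Φ j) = y j from rfl, hψ', sub_self]))
    rw [map_sub, sub_eq_zero] at this
    simpa only [map_sum, map_mul, differentialAt, T, aeval_C, Algebra.algebraMap_self,
      RingHom.id_apply] using this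
  have hla (g) : (fun i => aeval (a (h * g)) (lam h⁻¹ i)) = a g := by
    rw [← ha, inv_mul_cancel_left]
  -- The vector at `a h` is carried to `a 1` by left translation by `h⁻¹`, after division by `s(h)`.
  have trans (f : MvPolynomial ι k) : differentialAt f (a 1)
      (fun i => (aeval (a h) s)⁻¹ * differentialAt (lam h⁻¹ i) (a h) zh) =
      (aeval (a h) s)⁻¹ * differentialAt (bind₁ (lam h⁻¹) f) (a h) zh := by
    have h1 := hla 1
    rw [mul_one] at h1
    rw [differentialAt_smul, differentialAt_bind₁]
    rw [h1]
  refine ⟨_, fun f hf => (trans f).trans ?_, fun j => (trans (Φ j)).trans ?_⟩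
  · rw [tang, mul_zero]
    rw [mem_Ia] at hf ⊢
    intro g
    rw [aeval_bind₁]
    rw [← ha]
    exact hf _
  · have h2 : bind₁ (lam h⁻¹) (Φ j) - ∑ l, C (aeval (a h⁻¹) (M j l)) * Φ l ∈ Ia := by
      rw [mem_Ia]
      intro g
      rw [map_sub, aeval_bind₁]
      rw [← ha, hb, map_sum]
      simp
    have h3 := tang _ h2
    rw [differentialAt_sub, sub_eq_zero] at h3
    rw [h3, differentialAt_sum]
    simp only [differentialAt_mul, differentialAt_C, hΦ, aeval_C, mul_zero, add_zero,
      Algebra.algebraMap_self, RingHom.id_apply, Finset.mul_sum]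
    rw [Finset.sum_comm]
    have h4 (l) : ∑ i, (aeval (a h) s)⁻¹ * (aeval (a h⁻¹) (M j i) *
        (aeval (a h) s * (aeval (a h) (M i l) * t l))) = if j = l then t l else 0 := by
      have h5 := congrArg (· * t l) (hM h j l)
      simp only [Finset.sum_mul, ite_mul, one_mul, zero_mul] at h5
      rw [← h5]
      refine Finset.sum_congr rfl fun i _ => ?_
      rw [inv_mul_eq_iff_eq_mul₀ hh.2]
      ring
    simp only [h4]
    simp

end MvPolynomial

end


noncomputable section

/-! ### Galois descent for tangent vectors -/

namespace MvPolynomial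

section Galois

variable {F Ω ι : Type*} [Field F] [Field Ω] [Algebra F Ω] [Fintype ι]

theorem differentialAt_map (p : MvPolynomial ι F) (x t : ι → Ω) :
    differentialAt (map (algebraMap F Ω) p) x t = differentialAt p x t := by
  simp only [differentialAt, pderiv_map, aeval_map_algebraMap]

theorem differentialAt_algebraMap (p : MvPolynomial ι F) (x t : ι → F) :
    differentialAt p (fun i => algebraMap F Ω (x i)) (fun i => algebraMap F Ω (t i)) =
      algebraMap F Ω (differentialAt p x t) := by
  simp only [differentialAt, map_sum, map_mul]
  refine Finset.sum_congr rfl fun i _ => ?_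
  rw [← aeval_algebraMap_apply]
  rfl

/-- A rational vector that is tangent to a Galois stable set over the base field is tangent to it
over the extension field. -/
theorem differentialAt_eq_zero_of_galois [IsGalois F Ω] (X : Set (ι → Ω))
    (hX : ∀ σ : Ω ≃ₐ[F] Ω, ∀ x ∈ X, (fun i => σ (x i)) ∈ X) (e t : ι → F)
    (h : ∀ p ∈ vanishingIdeal F X, differentialAt p e t = 0) :
    ∀ p ∈ vanishingIdeal Ω X,
      differentialAt p (fun i => algebraMap F Ω (e i)) (fun i => algebraMap F Ω (t i)) = 0 := by
  -- Induction on the number of monomials. If all ratios of coefficients are Galois invariant, `p`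
  -- is a scalar times a polynomial over `F`; otherwise `p` is a combination of shorter elements of
  -- the ideal.
  suffices H : ∀ (N : ℕ) (p : MvPolynomial ι Ω), p.support.card = N → p ∈ vanishingIdeal Ω X →
      differentialAt p (fun i => algebraMap F Ω (e i)) (fun i => algebraMap F Ω (t i)) = 0 from
    fun p hp => H _ p rfl hp
  intro N
  induction N using Nat.strong_induction_on with
  | _ N ih =>
    intro p hpN hp
    have small (m) (hm : m ∈ p.support) (q : MvPolynomial ι Ω) (hq : q ∈ vanishingIdeal Ω X)
        (hqm : coeff m q = 0) (hqp : ∀ m', coeff m' p = 0 → coeff m' q = 0) :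
        differentialAt q (fun i => algebraMap F Ω (e i)) (fun i => algebraMap F Ω (t i)) = 0 := by
      refine ih _ ?_ q rfl hq
      rw [← hpN]
      refine Finset.card_lt_card (Finset.ssubset_iff_of_subset (fun m' hm' => ?_) |>.2
        ⟨m, hm, by simp [hqm]⟩)
      rw [mem_support_iff] at hm' ⊢
      exact fun h0 => hm' (hqp m' h0)
    rcases eq_or_ne p 0 with rfl | hp0
    · simp [differentialAt]
    obtain ⟨m₀, hm₀⟩ := support_nonempty.2 hp0
    have hc₀ := mem_support_iff.1 hm₀
    by_cases hfix : ∀ σ : Ω ≃ₐ[F] Ω, ∀ m, σ (coeff m p / coeff m₀ p) = coeff m p / coeff m₀ p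
    · have hF (m) : ∃ c : F, algebraMap F Ω c = coeff m p / coeff m₀ p :=
        (InfiniteGalois.mem_range_algebraMap_iff_fixed _).2 fun σ => hfix σ m
      have hrange : C (coeff m₀ p)⁻¹ * p ∈ Set.range (map (σ := ι) (algebraMap F Ω)) := by
        rw [mem_range_map_iff_coeffs_subset]
        intro c hc
        obtain ⟨m, -, rfl⟩ := mem_coeffs_iff.1 hc
        obtain ⟨c, hc⟩ := hF m
        exact ⟨c, by rw [hc, coeff_C_mul, div_eq_inv_mul]⟩
      obtain ⟨p₀, hp₀⟩ := hrange
      have hp₀' : p = C (coeff m₀ p) * map (algebraMap F Ω) p₀ := by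
        rw [hp₀, ← mul_assoc, ← C_mul, mul_inv_cancel₀ hc₀, C_1, one_mul]
      have hmem : p₀ ∈ vanishingIdeal F X := by
        intro x hx
        rw [← aeval_map_algebraMap Ω, hp₀, map_mul, hp x hx, mul_zero]
      rw [hp₀', differentialAt_mul, differentialAt_C, mul_zero, add_zero, differentialAt_map,
        differentialAt_algebraMap, h p₀ hmem, map_zero, mul_zero]
    · push Not at hfix
      obtain ⟨σ, m₁, hm₁⟩ := hfix
      -- Both terms have coefficient `1` at `m₀`, so `q` loses this monomial. It keeps `m₁`, and a
      -- multiple of it removes `m₁` from `p`.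
      let q : MvPolynomial ι Ω := C (σ (coeff m₀ p))⁻¹ * map (σ : Ω →+* Ω) p - C (coeff m₀ p)⁻¹ * p
      have hqc (m) : coeff m q = σ (coeff m p / coeff m₀ p) - coeff m p / coeff m₀ p := by
        simp [q, coeff_map, div_eq_inv_mul]
      have hσ : map (σ : Ω →+* Ω) p ∈ vanishingIdeal Ω X := by
        intro x hx
        have h1 := hp _ (hX σ.symm x hx)
        have h2 : aeval x (map (σ : Ω →+* Ω) p) = σ (aeval (fun i => σ.symm (x i)) p) := by
          rw [aeval_def, eval₂_map, aeval_def]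
          change _ = (σ : Ω →+* Ω) _
          rw [eval₂_comp_left (σ : Ω →+* Ω)]
          congr 1
          ext i
          simp
        rw [h2, h1, map_zero]
      have hq : q ∈ vanishingIdeal Ω X :=
        sub_mem (Ideal.mul_mem_left _ _ hσ) (Ideal.mul_mem_left _ _ hp)
      have hqp (m) (hm : coeff m p = 0) : coeff m q = 0 := by simp [hqc, hm]
      have hq₀ := small m₀ hm₀ q hq (by simp [hqc, hc₀]) hqp
      have hq₁ : coeff m₁ q ≠ 0 := by rw [hqc]; exact sub_ne_zero.2 hm₁
      have hm₁' : m₁ ∈ p.support := by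
        rw [mem_support_iff]; exact fun h0 => hq₁ (hqp _ h0)
      have h3 := small m₁ hm₁' (p - C (coeff m₁ p / coeff m₁ q) * q)
        (sub_mem hp (Ideal.mul_mem_left _ _ hq)) (by
          rw [coeff_sub, coeff_C_mul, div_mul_cancel₀ _ hq₁, sub_self])
        fun m hm => by rw [coeff_sub, coeff_C_mul, hm, hqp m hm, mul_zero, sub_zero]
      rwa [differentialAt_sub, differentialAt_mul, hq₀, differentialAt_C, mul_zero, mul_zero,
        add_zero, sub_zero] at h3

end Galois

end MvPolynomial

/-! ### Rational tangent vectors to an orbit -/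

namespace LinearAlgebraicGroup

open LinAlg MvPolynomial

variable {F : Type*} [Field F] {n : ℕ}

local notation "Ω" => AlgebraicClosure F

theorem coords_map {K K' : Type*} [Field K] [Field K'] (f : K →+* K') (g : GL (Fin n) K) :
    coords (Matrix.GeneralLinearGroup.map f g) = fun ij => f (coords g ij) := rfl

theorem map_mem_geom (G : LinearAlgebraicGroup F n) (σ : Ω ≃ₐ[F] Ω) {g : GL (Fin n) Ω}
    (hg : g ∈ G.geom) : Matrix.GeneralLinearGroup.map (σ : Ω →+* Ω) g ∈ G.geom := by
  obtain ⟨S, hS⟩ := G.definedOver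
  rw [hS] at hg ⊢
  intro p hp
  have h1 : σ (aeval (coords g) p) = aeval (fun i => σ (coords g i)) p :=
    comp_aeval_apply _ (σ : Ω →ₐ[F] Ω) p
  rw [hg p hp, map_zero] at h1
  exact h1.symm

/-- Coordinates on `GL_n × 𝔾_m`: the entries of `g`, the entries of `g⁻¹`, and the scalar. -/
def scaledCoords {K : Type*} [Field K] (g : GL (Fin n) K) (c : K) :
    ((Fin n × Fin n) ⊕ (Fin n × Fin n)) ⊕ Unit → K :=
  Sum.elim (Sum.elim (coords g) (coords g⁻¹)) fun _ => c

/-- The coordinates of the map `(g, c) ↦ c r(g) w`, where `r` is given by the matrix `a`. -/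
def orbitPoly {m : ℕ} (a : Fin m → Fin m → MvPolynomial ((Fin n × Fin n) ⊕ (Fin n × Fin n)) F)
    (w : Fin m → F) (j : Fin m) : MvPolynomial (((Fin n × Fin n) ⊕ (Fin n × Fin n)) ⊕ Unit) F :=
  X (Sum.inr ()) * ∑ l, rename Sum.inl (a j l) * C (w l)

theorem aeval_scaledCoords_orbitPoly {K : Type*} [Field K] [Algebra F K] {m : ℕ}
    (a : Fin m → Fin m → MvPolynomial ((Fin n × Fin n) ⊕ (Fin n × Fin n)) F) (w : Fin m → F)
    (g : GL (Fin n) K) (c : K) (j : Fin m) :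
    aeval (scaledCoords g c) (orbitPoly a w j) =
      c * (Matrix.mulVec (.of fun i l => aeval (Sum.elim (coords g) (coords g⁻¹)) (a i l))
        (fun i => algebraMap F K (w i))) j := by
  simp only [orbitPoly, map_mul, map_sum, aeval_X, aeval_rename, aeval_C, Matrix.mulVec, dotProduct,
    Matrix.of_apply]
  rfl

/-- The lifting theorem is applied over `Ω` to `G × 𝔾_m`, where `𝔾_m` acts by scaling. Tangency of
the rational vector `t` ascends to `Ω` because the orbit cone is Galois stable. The solution
descends because its conditions are linear with coefficients in `F`. -/
theorem exists_rational_tangent [CharZero F] (G : LinearAlgebraicGroup F n) {m : ℕ}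
    (r : G.geom →* GL (Fin m) Ω)
    (a : Fin m → Fin m → MvPolynomial ((Fin n × Fin n) ⊕ (Fin n × Fin n)) F)
    (ha : ∀ (g : G.geom) i j, (r g : Matrix (Fin m) (Fin m) Ω) i j =
      aeval (Sum.elim (coords (g : GL (Fin n) Ω)) (coords (g : GL (Fin n) Ω)⁻¹)) (a i j))
    (w t : Fin m → F)
    (ht : ∀ p ∈ vanishingIdeal F (Set.range fun (h : G.geom × Ωˣ) (j : Fin m) => (h.2 : Ω) *
        (r h.1 : Matrix (Fin m) (Fin m) Ω).mulVec (fun i => algebraMap F Ω (w i)) j),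
      differentialAt p w t = 0) :
    ∃ ζ : ((Fin n × Fin n) ⊕ (Fin n × Fin n)) ⊕ Unit → F,
      (∀ q ∈ vanishingIdeal F (Set.range fun h : G.geom × Ωˣ => scaledCoords h.1.1 (h.2 : Ω)),
        differentialAt q (scaledCoords 1 1) ζ = 0) ∧
      ∀ j, differentialAt (orbitPoly a w j) (scaledCoords 1 1) ζ = t j := by
  classical
  have hr (g : G.geom) : (r g : Matrix (Fin m) (Fin m) Ω) =
      .of fun i l => aeval (Sum.elim (coords (g : GL (Fin n) Ω)) (coords (g : GL (Fin n) Ω)⁻¹))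
        (a i l) := by
    ext i j; exact ha g i j
  have hmul (g h : G.geom) : (r (g * h) : Matrix (Fin m) (Fin m) Ω) = r g * r h := by
    rw [map_mul]; rfl
  let w' : Fin m → Ω := fun i => algebraMap F Ω (w i)
  have hΦ (h : G.geom × Ωˣ) (j) : aeval (scaledCoords h.1.1 (h.2 : Ω))
      (map (algebraMap F Ω) (orbitPoly a w j)) =
        h.2 * (r h.1 : Matrix (Fin m) (Fin m) Ω).mulVec w' j := by
    rw [aeval_map_algebraMap, aeval_scaledCoords_orbitPoly, ← hr]
  have hM (h : G.geom × Ωˣ) (j l) : aeval (scaledCoords h.1.1 (h.2 : Ω))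
      (X (Sum.inr ()) * rename Sum.inl (map (algebraMap F Ω) (a j l))) =
        h.2 * (r h.1 : Matrix (Fin m) (Fin m) Ω) j l := by
    rw [map_mul, aeval_X, aeval_rename, aeval_map_algebraMap, ha]
    rfl
  have hone : scaledCoords (1 : GL (Fin n) Ω) 1 =
      fun i => algebraMap F Ω (scaledCoords (1 : GL (Fin n) F) 1 i) := by
    have h1 : coords (1 : GL (Fin n) Ω) = fun ij => algebraMap F Ω (coords 1 ij) := by
      rw [← map_one (Matrix.GeneralLinearGroup.map (algebraMap F Ω)), coords_map]
    funext i
    rcases i with (i | i) | i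
    · exact congrFun h1 i
    · simp only [scaledCoords, inv_one, Sum.elim_inl, Sum.elim_inr, h1]
    · simp [scaledCoords]
  obtain ⟨ζ, hζ, hζ'⟩ := exists_tangent_lift (k := Ω)
    (fun h : G.geom × Ωˣ => scaledCoords h.1.1 (h.2 : Ω))
    (fun j => map (algebraMap F Ω) (orbitPoly a w j))
    (fun j l => X (Sum.inr ()) * rename Sum.inl (map (algebraMap F Ω) (a j l)))
    (fun h => Sum.elim (Sum.elim
      (fun ij => ∑ k, C (coords h.1.1 (ij.1, k)) * X (Sum.inl (Sum.inl (k, ij.2))))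
      (fun ij => ∑ k, C (coords (h.1.1)⁻¹ (k, ij.2)) * X (Sum.inl (Sum.inr (ij.1, k)))))
      fun _ => C (h.2 : Ω) * X (Sum.inr ()))
    (by
      intro g h
      funext i
      rcases i with (i | i) | i
      · simp [scaledCoords, coords, Matrix.mul_apply]
      · simp only [scaledCoords, coords, Prod.fst_mul, Subgroup.coe_mul, mul_inv_rev, Sum.elim_inl,
          Sum.elim_inr, map_sum, map_mul, aeval_C, aeval_X, Matrix.GeneralLinearGroup.coe_mul,
          Matrix.mul_apply, Algebra.algebraMap_self, RingHom.id_apply]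
        exact Finset.sum_congr rfl fun _ _ => mul_comm _ _
      · simp [scaledCoords])
    (by
      intro g h j
      simp only [hΦ, hM]
      rw [Prod.fst_mul, hmul, ← Matrix.mulVec_mulVec, Prod.snd_mul, Units.val_mul]
      change _ * ∑ l, (r g.1 : Matrix (Fin m) (Fin m) Ω) j l *
        (r h.1 : Matrix (Fin m) (Fin m) Ω).mulVec w' l = _
      rw [Finset.mul_sum]
      exact Finset.sum_congr rfl fun _ _ => by ring)
    (by
      intro g j l
      simp only [hM]
      have h1 : (r g.1⁻¹ : Matrix (Fin m) (Fin m) Ω) * r g.1 = 1 := by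
        rw [← hmul, inv_mul_cancel, map_one]; rfl
      have h2 := congrFun (congrFun h1 j) l
      rw [Matrix.mul_apply, Matrix.one_apply] at h2
      rw [← h2]
      refine Finset.sum_congr rfl fun i _ => ?_
      rw [Prod.fst_inv, Prod.snd_inv, mul_mul_mul_comm, Units.inv_mul, one_mul])
    (fun j => algebraMap F Ω (t j))
    (by
      simp only [hΦ]
      have h1 : (fun j => (((1 : G.geom × Ωˣ).2 : Ωˣ) : Ω) *
          (r (1 : G.geom × Ωˣ).1 : Matrix (Fin m) (Fin m) Ω).mulVec w' j) = w' := by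
        funext j
        simp
      rw [h1]
      refine differentialAt_eq_zero_of_galois _ ?_ w t ht
      rintro σ _ ⟨⟨g, c⟩, rfl⟩
      refine ⟨⟨⟨_, G.map_mem_geom σ g.2⟩, Units.map (σ : Ω →* Ω) c⟩, ?_⟩
      funext j
      simp only [Matrix.mulVec, dotProduct, map_mul, map_sum, ha, AlgEquiv.commutes, w']
      rw [Units.coe_map]
      congr 1
      refine Finset.sum_congr rfl fun l _ => ?_
      congr 1
      rw [← AlgEquiv.coe_toAlgHom, comp_aeval_apply]
      congr 2
      funext i
      rcases i with i | i
      · rfl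
      · simp only [Sum.elim_inr]
        rw [← map_inv]
        rfl)
  change ∀ q ∈ _, differentialAt q (scaledCoords 1 1) ζ = 0 at hζ
  change ∀ j, differentialAt _ (scaledCoords 1 1) ζ = _ at hζ'
  simp only [differentialAt_map] at hζ'
  -- An `F`-linear retraction `Ω → F`, applied to each coordinate, turns the solution over `Ω` into
  -- one over `F`.
  obtain ⟨ρ, hρ⟩ := (Algebra.linearMap F Ω).exists_leftInverse_of_injective
    (LinearMap.ker_eq_bot.2 (algebraMap F Ω).injective)
  have hρ' (c : F) : ρ (algebraMap F Ω c) = c := LinearMap.congr_fun hρ c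
  have hd (q : MvPolynomial (((Fin n × Fin n) ⊕ (Fin n × Fin n)) ⊕ Unit) F) :
      differentialAt q (scaledCoords 1 1) (fun i => ρ (ζ i)) =
        ρ (differentialAt q (scaledCoords 1 1) ζ) := by
    rw [hone]
    simp only [differentialAt, map_sum]
    refine Finset.sum_congr rfl fun i _ => ?_
    have h1 : aeval (fun i => algebraMap F Ω (scaledCoords (1 : GL (Fin n) F) 1 i)) (pderiv i q) =
        algebraMap F Ω (aeval (scaledCoords (1 : GL (Fin n) F) 1) (pderiv i q)) :=
      aeval_algebraMap_apply Ω (scaledCoords (1 : GL (Fin n) F) 1) _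
    rw [h1, ← Algebra.smul_def, map_smul, smul_eq_mul]
  refine ⟨fun i => ρ (ζ i), fun q hq => ?_, fun j => ?_⟩
  · rw [hd, ← differentialAt_map, hζ, map_zero]
    rintro x ⟨h, rfl⟩
    rw [aeval_map_algebraMap]
    exact hq _ ⟨h, rfl⟩
  · rw [hd, hζ', hρ']

end LinearAlgebraicGroup

end


noncomputable section

/-! ### The exponential of a matrix in the Lie algebra -/

/-- The `p`-adic valuation of `k!` is at most `k`, so `‖1 / k!‖ ≤ p ^ k` and the radius is at least
`1 / p`. -/
theorem NormedSpace.expSeries_radius_pos_of_padic (p : ℕ) [Fact p.Prime] (F 𝔸 : Type*)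
    [NontriviallyNormedField F] [NormedAlgebra ℚ_[p] F] [NormedRing 𝔸] [NormedAlgebra F 𝔸] :
    0 < (NormedSpace.expSeries F 𝔸).radius := by
  have hp : (0 : ℝ) < p := by exact_mod_cast (Fact.out : p.Prime).pos
  have hp1 : (1 : ℝ) ≤ p := by exact_mod_cast (Fact.out : p.Prime).one_le
  let s : NNReal := (p : NNReal)⁻¹
  have hs : 0 < s := inv_pos.2 (by exact_mod_cast (Fact.out : p.Prime).pos)
  refine lt_of_lt_of_le (ENNReal.coe_pos.2 hs)
    (FormalMultilinearSeries.le_radius_of_bound _ (max 1 ‖(1 : 𝔸)‖) fun k => ?_)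
  have hk : ‖((k.factorial : F))⁻¹‖ ≤ (p : ℝ) ^ k := by
    have h1 : (k.factorial : F) = algebraMap ℚ_[p] F k.factorial := by simp
    rw [norm_inv, h1, norm_algebraMap', Padic.norm_eq_zpow_neg_valuation
      (by exact_mod_cast k.factorial_ne_zero), Padic.valuation_natCast, ← zpow_neg, neg_neg,
      zpow_natCast]
    exact pow_le_pow_right₀ hp1 (padicValNat_factorial_le (p := p) k)
  calc ‖NormedSpace.expSeries F 𝔸 k‖ * (s : ℝ) ^ k
      ≤ ((p : ℝ) ^ k * max 1 ‖(1 : 𝔸)‖) * (s : ℝ) ^ k := by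
        gcongr
        refine (norm_smul_le ((k.factorial : F)⁻¹)
          (ContinuousMultilinearMap.mkPiAlgebraFin F k 𝔸)).trans ?_
        gcongr
        exact ContinuousMultilinearMap.norm_mkPiAlgebraFin_le
    _ = max 1 ‖(1 : 𝔸)‖ := by
        have : (s : ℝ) = (p : ℝ)⁻¹ := by simp [s]
        rw [this, inv_pow]
        field_simp

/-- Evaluation at parameter value `1` is multiplicative on absolutely summable series, by Cauchy
products. This passes from the formal exponential to the convergent one. -/
theorem PowerSeries.summable_coeff_aeval {F ι : Type*} [NontriviallyNormedField F]
    [CompleteSpace F] (e : ι → PowerSeries F) (x : ι → F)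
    (he : ∀ i, Summable fun k => ‖PowerSeries.coeff k (e i)‖)
    (hx : ∀ i, HasSum (fun k => PowerSeries.coeff k (e i)) (x i)) (q : MvPolynomial ι F) :
    (Summable fun k => ‖PowerSeries.coeff k (MvPolynomial.aeval e q)‖) ∧
      ∑' k, PowerSeries.coeff k (MvPolynomial.aeval e q) = MvPolynomial.aeval x q := by
  induction q using MvPolynomial.induction_on with
  | C c =>
    simp only [MvPolynomial.aeval_C]
    have h (k) (hk : k ≠ 0) : PowerSeries.coeff k (algebraMap F (PowerSeries F) c) = 0 := by
      rw [PowerSeries.algebraMap_apply, PowerSeries.coeff_C, if_neg hk]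
    refine ⟨summable_of_ne_finset_zero (s := {0}) fun k hk => ?_, ?_⟩
    · rw [h k (by simpa using hk), norm_zero]
    · rw [tsum_eq_single 0 h, PowerSeries.algebraMap_apply, PowerSeries.coeff_C, if_pos rfl]
  | add p q hp hq =>
    simp only [map_add]
    refine ⟨(hp.1.add hq.1).of_nonneg_of_le (fun _ => norm_nonneg _) fun _ => norm_add_le _ _, ?_⟩
    rw [hp.1.of_norm.tsum_add hq.1.of_norm, hp.2, hq.2]
  | mul_X p i hp =>
    obtain ⟨h1, h2⟩ := hp
    rw [map_mul, map_mul, MvPolynomial.aeval_X, MvPolynomial.aeval_X]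
    simp only [PowerSeries.coeff_mul]
    generalize MvPolynomial.aeval e p = P at *
    have h3 := summable_norm_sum_mul_antidiagonal_of_summable_norm h1 (he i)
    have h4 := tsum_mul_tsum_eq_tsum_sum_antidiagonal_of_summable_norm h1 (he i)
    rw [h2, (hx i).tsum_eq] at h4
    exact ⟨h3, h4.symm⟩

theorem Derivation.aeval_eq_differentialAt {k K ι : Type*} [CommRing k] [CommRing K] [Algebra k K]
    [Fintype ι] (d : Derivation k K K) (q : MvPolynomial ι k) (x : ι → K) :
    d (MvPolynomial.aeval x q) = q.differentialAt x fun i => d (x i) := by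
  induction q using MvPolynomial.induction_on with
  | C c => rw [MvPolynomial.aeval_C, Derivation.map_algebraMap, MvPolynomial.differentialAt_C]
  | add p q hp hq => rw [map_add, map_add, hp, hq, MvPolynomial.differentialAt_add]
  | mul_X p i hp =>
    rw [map_mul, Derivation.leibniz, hp, MvPolynomial.differentialAt_mul, MvPolynomial.aeval_X,
      MvPolynomial.differentialAt_X, smul_eq_mul, smul_eq_mul]

namespace LinearAlgebraicGroup

open LinAlg MvPolynomial

variable {F : Type*} [Field F] {n : ℕ}

local notation "Ω" => AlgebraicClosure F

/-- The ideal of polynomials over `F` that vanish on the group. -/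
def ideal (G : LinearAlgebraicGroup F n) : Ideal (MvPolynomial (Fin n × Fin n) F) :=
  vanishingIdeal F (Set.range fun g : G.geom => coords (g : GL (Fin n) Ω))

theorem mem_ideal (G : LinearAlgebraicGroup F n) (q : MvPolynomial (Fin n × Fin n) F) :
    q ∈ G.ideal ↔ ∀ g ∈ G.geom, aeval (coords g) q = 0 := by
  simp [ideal, mem_vanishingIdeal_iff]

theorem coords_one_algebraMap :
    coords (1 : GL (Fin n) Ω) = fun ij => algebraMap F Ω (coords (1 : GL (Fin n) F) ij) := by
  rw [← map_one (Matrix.GeneralLinearGroup.map (algebraMap F Ω)), coords_map]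

theorem mem_points_iff (G : LinearAlgebraicGroup F n) (g : GL (Fin n) F) :
    g ∈ G.points ↔ ∀ q ∈ G.ideal, aeval (coords g) q = 0 := by
  have key (q : MvPolynomial (Fin n × Fin n) F) :
      aeval (coords (Matrix.GeneralLinearGroup.map (algebraMap F Ω) g)) q =
        algebraMap F Ω (aeval (coords g) q) := aeval_algebraMap_apply Ω (coords g) q
  refine ⟨fun hg q hq => ?_, fun h => ?_⟩
  · have h1 := (G.mem_ideal q).1 hq _ hg
    rw [key] at h1
    exact (map_eq_zero _).1 h1
  · obtain ⟨S, hS⟩ := G.definedOver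
    refine (hS _).2 fun q hq => ?_
    rw [key, h q ((G.mem_ideal q).2 fun g hg => (hS g).1 hg q hq), map_zero]

/-- The Lie algebra: the tangent space at `1`. -/
def lie (G : LinearAlgebraicGroup F n) : Submodule F (Fin n × Fin n → F) where
  carrier := {ξ | ∀ q ∈ G.ideal, differentialAt q (coords 1) ξ = 0}
  add_mem' := by
    intro ξ ξ' h h' q hq
    have := h q hq
    have := h' q hq
    simp_all [differentialAt, mul_add, Finset.sum_add_distrib]
  zero_mem' := by
    intro q _
    simp [differentialAt]
  smul_mem' := by
    intro c ξ h q hq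
    rw [show c • ξ = fun i => c * ξ i from rfl, differentialAt_smul, h q hq, mul_zero]

/-- The derivation of the coordinate ring given by right translation along `ξ`. -/
def translationDerivation (ξ : Fin n × Fin n → F) (q : MvPolynomial (Fin n × Fin n) F) :
    MvPolynomial (Fin n × Fin n) F :=
  ∑ ij, pderiv ij q * ∑ k, X (ij.1, k) * C (ξ (k, ij.2))

/-- For `g` in `G` the translate `q (g ·)` vanishes on `G`, and its differential at `1` along `ξ` is
the value of the translation derivation at `g`. As `g` is only a geometric point, tangency of `ξ` is
needed over `Ω`, whence the Galois argument. -/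
theorem translationDerivation_mem [CharZero F] (G : LinearAlgebraicGroup F n)
    {ξ : Fin n × Fin n → F} (hξ : ξ ∈ G.lie) {q : MvPolynomial (Fin n × Fin n) F}
    (hq : q ∈ G.ideal) : translationDerivation ξ q ∈ G.ideal := by
  rw [mem_ideal]
  intro g hg
  have key := differentialAt_eq_zero_of_galois 
    (Set.range fun g : G.geom => coords (g : GL (Fin n) Ω)) (by
      rintro σ _ ⟨g, rfl⟩
      exact ⟨⟨_, G.map_mem_geom σ g.2⟩, rfl⟩) (coords 1) ξ hξ
    (bind₁ (fun ij => ∑ k, C (coords g (ij.1, k)) * X (k, ij.2)) (map (algebraMap F Ω) q)) (by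
      rintro _ ⟨h, rfl⟩
      rw [aeval_bind₁, aeval_map_algebraMap, ← (G.mem_ideal q).1 hq _ (mul_mem hg h.2)]
      congr 2
      funext ij
      simp [coords, Matrix.mul_apply])
  rw [differentialAt_bind₁, differentialAt_map, ← coords_one_algebraMap] at key
  rw [← key, translationDerivation, differentialAt]
  simp only [map_sum, map_mul, differentialAt_sum, differentialAt_mul, differentialAt_C,
    differentialAt_X, aeval_X, aeval_C, mul_zero, add_zero, Algebra.algebraMap_self,
    RingHom.id_apply]
  refine Finset.sum_congr rfl fun ij _ => ?_
  congr 3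
  funext ij
  simp [coords, Matrix.one_apply]

/-- The formal exponential `exp (s ξ)`. -/
def formalExp (ξ : Matrix (Fin n) (Fin n) F) (ij : Fin n × Fin n) : PowerSeries F :=
  PowerSeries.mk fun k => (k.factorial : F)⁻¹ * (ξ ^ k) ij.1 ij.2

theorem derivative_formalExp [CharZero F] (ξ : Matrix (Fin n) (Fin n) F) (ij : Fin n × Fin n) :
    PowerSeries.derivative F (formalExp ξ ij) =
      ∑ k, formalExp ξ (ij.1, k) * algebraMap F _ (ξ k ij.2) := by
  ext k
  rw [PowerSeries.coeff_derivative, map_sum]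
  simp only [formalExp, PowerSeries.algebraMap_apply, PowerSeries.coeff_mul_C, PowerSeries.coeff_mk,
    Algebra.algebraMap_self, RingHom.id_apply]
  rw [pow_succ, Matrix.mul_apply, Finset.mul_sum, Finset.sum_mul]
  refine Finset.sum_congr rfl fun l _ => ?_
  rw [Nat.factorial_succ]
  have : (k.factorial : F) ≠ 0 := by exact_mod_cast k.factorial_ne_zero
  have : (k : F) + 1 ≠ 0 := by exact_mod_cast k.succ_ne_zero
  push_cast
  field_simp

/-- The derivative in `s` of `q (exp (s ξ))` is `D q (exp (s ξ))`, where the translation derivation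
`D` preserves the ideal. Since the constant term is `q 1 = 0`, all coefficients vanish by induction;
characteristic zero permits division by `k + 1`. -/
theorem aeval_formalExp [CharZero F] (G : LinearAlgebraicGroup F n)
    (ξ : Matrix (Fin n) (Fin n) F) (hξ : (fun ij => ξ ij.1 ij.2) ∈ G.lie)
    {q : MvPolynomial (Fin n × Fin n) F} (hq : q ∈ G.ideal) : aeval (formalExp ξ) q = 0 := by
  ext k
  rw [map_zero]
  induction k generalizing q with
  | zero =>
    have h1 : PowerSeries.coeff 0 (aeval (formalExp ξ) q) = aeval (coords (1 : GL (Fin n) F)) q := by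
      rw [PowerSeries.coeff_zero_eq_constantCoeff_apply, aeval_def, aeval_def,
        eval₂_comp_left (PowerSeries.constantCoeff : PowerSeries F →+* F)]
      congr 1
      · ext ij
        simp [formalExp, coords, ← PowerSeries.coeff_zero_eq_constantCoeff_apply]
    rw [h1]
    exact (G.mem_points_iff 1).1 (one_mem _) q hq
  | succ k ih =>
    have h1 := ih (G.translationDerivation_mem hξ hq)
    have h2 : PowerSeries.derivative F (aeval (formalExp ξ) q) =
        aeval (formalExp ξ) (translationDerivation (fun ij => ξ ij.1 ij.2) q) := by
      rw [Derivation.aeval_eq_differentialAt, translationDerivation, differentialAt]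
      simp only [derivative_formalExp, map_sum, map_mul, aeval_X, aeval_C]
    rw [← h2, PowerSeries.coeff_derivative] at h1
    exact (mul_eq_zero.1 h1).resolve_right (by exact_mod_cast k.succ_ne_zero)

end LinearAlgebraicGroup

section Exp

open LinAlg MvPolynomial

variable {F 𝔸 : Type*} [NontriviallyNormedField F] [CompleteSpace F] [CharZero F] [NormedRing 𝔸]
  [NormedAlgebra F 𝔸] [CompleteSpace 𝔸] {n : ℕ}

theorem LinearAlgebraicGroup.aeval_exp_eq_zero [FiniteDimensional F 𝔸]
    (G : LinearAlgebraicGroup F n) (θ : 𝔸 →ₐ[F] Matrix (Fin n) (Fin n) F) (ξ : 𝔸)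
    (hξ : (fun ij => θ ξ ij.1 ij.2) ∈ G.lie)
    (hball : ξ ∈ Metric.eball 0 (NormedSpace.expSeries F 𝔸).radius)
    {q : MvPolynomial (Fin n × Fin n) F} (hq : q ∈ G.ideal) :
    aeval (fun ij : Fin n × Fin n => θ (NormedSpace.exp ξ) ij.1 ij.2) q = 0 := by
  let ℓ (i j : Fin n) : 𝔸 →L[F] F :=
    LinearMap.toContinuousLinearMap (Matrix.entryLinearMap F F i j ∘ₗ θ.toLinearMap)
  have hℓ (i j k) : PowerSeries.coeff k (formalExp (θ ξ) (i, j)) =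
      ℓ i j ((k.factorial : F)⁻¹ • ξ ^ k) := by
    simp [ℓ, formalExp]
  have h1 := NormedSpace.norm_expSeries_summable_of_mem_ball' ξ hball
  have h2 := NormedSpace.expSeries_hasSum_exp_of_mem_ball' ξ hball
  have h3 := PowerSeries.summable_coeff_aeval (formalExp (θ ξ))
    (fun ij : Fin n × Fin n => θ (NormedSpace.exp ξ) ij.1 ij.2)
    (by
      rintro ⟨i, j⟩
      simp only [hℓ]
      exact (h1.mul_left ‖ℓ i j‖).of_nonneg_of_le (fun _ => norm_nonneg _)
        fun _ => (ℓ i j).le_opNorm _)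
    (by
      rintro ⟨i, j⟩
      simp only [hℓ]
      exact h2.mapL (ℓ i j)) q
  rw [← h3.2, G.aeval_formalExp (θ ξ) hξ hq]
  simp

/-- The exponential of an element of the ball of convergence, as a unit. -/
def NormedSpace.expUnit (ξ : 𝔸) (hball : ξ ∈ Metric.eball 0 (NormedSpace.expSeries F 𝔸).radius) :
    𝔸ˣ :=
  have hball' : -ξ ∈ Metric.eball 0 (NormedSpace.expSeries F 𝔸).radius := by
    simpa using hball
  { val := NormedSpace.exp ξ
    inv := NormedSpace.exp (-ξ)
    val_inv := by
      rw [← NormedSpace.exp_add_of_commute_of_mem_ball (𝕂 := F) (Commute.refl ξ).neg_right hball hball',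
        add_neg_cancel, NormedSpace.exp_zero]
    inv_val := by
      rw [← NormedSpace.exp_add_of_commute_of_mem_ball (𝕂 := F) (Commute.refl ξ).neg_left hball' hball,
        neg_add_cancel, NormedSpace.exp_zero] }

theorem LinearAlgebraicGroup.map_expUnit_mem_points [FiniteDimensional F 𝔸]
    (G : LinearAlgebraicGroup F n) (θ : 𝔸 →ₐ[F] Matrix (Fin n) (Fin n) F) (ξ : 𝔸)
    (hξ : (fun ij => θ ξ ij.1 ij.2) ∈ G.lie)
    (hball : ξ ∈ Metric.eball 0 (NormedSpace.expSeries F 𝔸).radius) :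
    (Units.map (θ : 𝔸 →* Matrix (Fin n) (Fin n) F) (NormedSpace.expUnit ξ hball) : GL (Fin n) F) ∈
      G.points :=
  (G.mem_points_iff _).2 fun _ hq => G.aeval_exp_eq_zero θ ξ hξ hball hq

end Exp

/-- The matrix of a continuous endomorphism of `F^n`. -/
def ContinuousLinearMap.matrixAlgHom (F : Type*) [NontriviallyNormedField F] (n : ℕ) :
    ((Fin n → F) →L[F] (Fin n → F)) →ₐ[F] Matrix (Fin n) (Fin n) F :=
  (LinearMap.toMatrixAlgEquiv' : _ ≃ₐ[F] Matrix (Fin n) (Fin n) F).toAlgHom.comp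
    { ContinuousLinearMap.toLinearMapRingHom with commutes' := fun _ => rfl }

theorem ContinuousLinearMap.matrixAlgHom_bijective (F : Type*) [NontriviallyNormedField F]
    [CompleteSpace F] (n : ℕ) :
    Function.Bijective (ContinuousLinearMap.matrixAlgHom F n) := by
  refine (LinearMap.toMatrixAlgEquiv' : _ ≃ₐ[F] Matrix (Fin n) (Fin n) F).bijective.comp
    ⟨ContinuousLinearMap.coe_injective, fun f => ⟨LinearMap.toContinuousLinearMap f, ?_⟩⟩
  ext; rfl

end


/-! ### Local surjectivity onto zero sets, and the exponential chart -/

noncomputable section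

open Filter Topology

/-- If `ψ` parametrises part of the zero set of `f` and its derivative is onto the tangent space
`ker f'`, then the parametrisation is locally surjective onto the zero set. -/
theorem HasStrictFDerivAt.eventually_exists_of_ker_le_range {𝕜 E₁ E₂ E₃ : Type*}
    [NontriviallyNormedField 𝕜] [CompleteSpace 𝕜] [NormedAddCommGroup E₁] [NormedSpace 𝕜 E₁]
    [NormedAddCommGroup E₂] [NormedSpace 𝕜 E₂] [NormedAddCommGroup E₃] [NormedSpace 𝕜 E₃]
    [FiniteDimensional 𝕜 E₁] [FiniteDimensional 𝕜 E₂] {ψ : E₁ → E₂} {ψ' : E₁ →L[𝕜] E₂} {v₀ : E₁}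
    {f : E₂ → E₃} {f' : E₂ →L[𝕜] E₃} (hψ : HasStrictFDerivAt ψ ψ' v₀)
    (hf : HasStrictFDerivAt f f' (ψ v₀))
    (hker : (f' : E₂ →ₗ[𝕜] E₃).ker ≤ (ψ' : E₁ →ₗ[𝕜] E₂).range)
    (hzero : ∀ᶠ v in 𝓝 v₀, f (ψ v) = 0) {N : Set E₁} (hN : N ∈ 𝓝 v₀) :
    ∀ᶠ x in 𝓝 (ψ v₀), f x = 0 → ∃ v ∈ N, ψ v = x := by
  have : CompleteSpace E₁ := FiniteDimensional.complete 𝕜 E₁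
  have : CompleteSpace E₂ := FiniteDimensional.complete 𝕜 E₂
  obtain ⟨B, hB⟩ := Submodule.exists_isCompl (f' : E₂ →ₗ[𝕜] E₃).ker
  have : CompleteSpace B := FiniteDimensional.complete 𝕜 B
  -- Adding a complement `B` of `ker f'` makes the derivative surjective, so `Ψ` maps neighbourhoods
  -- onto neighbourhoods. It remains to see that zeros of `f` near the base point have vanishing
  -- `B`-component.
  let Ψ : E₁ × B → E₂ := fun z => ψ z.1 + z.2
  let Ψ' : E₁ × B →L[𝕜] E₂ := ψ'.comp (.fst 𝕜 E₁ B) + B.subtypeL.comp (.snd 𝕜 E₁ B)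
  have hΨ : HasStrictFDerivAt Ψ Ψ' (v₀, 0) := by
    refine HasStrictFDerivAt.add ?_ ?_
    · exact HasStrictFDerivAt.comp (v₀, (0 : B)) (f := Prod.fst) hψ hasStrictFDerivAt_fst
    · exact (B.subtypeL.comp (.snd 𝕜 E₁ B)).hasStrictFDerivAt
  have hΨ0 : Ψ (v₀, 0) = ψ v₀ := by simp [Ψ]
  have hsurj : (Ψ' : E₁ × B →ₗ[𝕜] E₂).range = ⊤ := by
    rw [eq_top_iff, ← hB.sup_eq_top]
    refine sup_le (hker.trans ?_) ?_
    · rintro _ ⟨v, rfl⟩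
      exact ⟨(v, 0), by simp [Ψ']⟩
    · intro b hb
      exact ⟨(0, ⟨b, hb⟩), by simp [Ψ']⟩
  have hmap := hΨ.map_nhds_eq_of_surj hsurj
  rw [hΨ0] at hmap
  have hinj : ((f' : E₂ →ₗ[𝕜] E₃).domRestrict B).ker = ⊥ := by
    rw [LinearMap.ker_eq_bot']
    intro b hb
    have : (b : E₂) ∈ (f' : E₂ →ₗ[𝕜] E₃).ker ⊓ B := ⟨hb, b.2⟩
    rw [hB.inf_eq_bot] at this
    exact Subtype.ext ((Submodule.mem_bot 𝕜).1 this)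
  obtain ⟨K, hK, hanti⟩ := LinearMap.exists_antilipschitzWith _ hinj
  -- On `B` the map `f'` is bounded below by `1 / K`. With error constant `1 / (2 K)`, two zeros of
  -- `f` differing by `b` in `B` satisfy `‖b‖ ≤ ‖b‖ / 2`, so `b = 0`.
  have hsmall := hf.isLittleO.def (c := ((K : ℝ) * 2)⁻¹) (by positivity)
  have hcont : Tendsto (fun z : E₁ × B => (Ψ z, ψ z.1)) (𝓝 (v₀, 0)) (𝓝 (ψ v₀, ψ v₀)) := by
    have h1 := hΨ.continuousAt.tendsto
    rw [hΨ0] at h1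
    exact h1.prodMk_nhds (hψ.continuousAt.tendsto.comp (continuous_fst.tendsto _))
  have hev : ∀ᶠ z : E₁ × B in 𝓝 (v₀, 0), f (Ψ z) = 0 → z.1 ∈ N ∧ ψ z.1 = Ψ z := by
    filter_upwards [hcont.eventually hsmall, (continuous_fst.tendsto (v₀, (0 : B))).eventually hzero,
      (continuous_fst.tendsto (v₀, (0 : B))).eventually hN] with z h1 h2 h3 h4
    refine ⟨h3, ?_⟩
    have hd : Ψ z - ψ z.1 = z.2 := by simp [Ψ]
    simp only [h4, h2, hd, sub_zero, zero_sub, norm_neg] at h1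
    have h5 := hanti.le_mul_dist z.2 0
    rw [dist_zero_right, map_zero, dist_zero_right] at h5
    have h6 : ‖z.2‖ ≤ K * (((K : ℝ) * 2)⁻¹ * ‖z.2‖) := h5.trans (by gcongr; exact h1)
    have h7 : (K : ℝ) * (((K : ℝ) * 2)⁻¹ * ‖z.2‖) = ‖z.2‖ / 2 := by
      have : (K : ℝ) ≠ 0 := by exact_mod_cast hK.ne'
      field_simp
    rw [h7] at h6
    have h8 : ‖z.2‖ = 0 := le_antisymm (by linarith) (norm_nonneg _)
    have h9 : (z.2 : E₂) = 0 := by simpa using h8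
    rw [← sub_eq_zero, ← neg_eq_zero, neg_sub, hd, h9]
  rw [← hmap, eventually_map]
  filter_upwards [hev] with z hz h0
  exact ⟨z.1, hz h0⟩

/-- The differential of a polynomial as a continuous linear map. -/
def MvPolynomial.differentialCLM {𝕜 ι : Type*} [NontriviallyNormedField 𝕜] [Fintype ι]
    (p : MvPolynomial ι 𝕜) (x : ι → 𝕜) : (ι → 𝕜) →L[𝕜] 𝕜 :=
  ∑ i, MvPolynomial.aeval x (MvPolynomial.pderiv i p) •
    ContinuousLinearMap.proj (R := 𝕜) (φ := fun _ : ι => 𝕜) i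

@[simp]
theorem MvPolynomial.differentialCLM_apply {𝕜 ι : Type*} [NontriviallyNormedField 𝕜] [Fintype ι]
    (p : MvPolynomial ι 𝕜) (x t : ι → 𝕜) : p.differentialCLM x t = p.differentialAt x t := by
  simp [differentialCLM, differentialAt]

theorem MvPolynomial.hasStrictFDerivAt_aeval {𝕜 ι : Type*} [NontriviallyNormedField 𝕜] [Fintype ι]
    (p : MvPolynomial ι 𝕜) (x : ι → 𝕜) :
    HasStrictFDerivAt (fun y : ι → 𝕜 => MvPolynomial.aeval y p) (p.differentialCLM x) x := by
  induction p using MvPolynomial.induction_on with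
  | C c =>
    simp only [MvPolynomial.aeval_C]
    refine (hasStrictFDerivAt_const (algebraMap 𝕜 𝕜 c) x).congr_fderiv
      (ContinuousLinearMap.ext fun t => ?_)
    simp [differentialAt_C]
  | add p q hp hq =>
    simp only [map_add]
    refine (hp.fun_add hq).congr_fderiv (ContinuousLinearMap.ext fun t => ?_)
    simp [differentialAt_add]
  | mul_X p j hp =>
    have h := hp.fun_mul
      (ContinuousLinearMap.proj (R := 𝕜) (φ := fun _ : ι => 𝕜) j).hasStrictFDerivAt
    simp only [map_mul, MvPolynomial.aeval_X]
    refine h.congr_fderiv (ContinuousLinearMap.ext fun t => ?_)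
    simp [differentialAt_mul, differentialAt_X]

theorem MvPolynomial.hasStrictFDerivAt_aeval_pi {𝕜 ι κ : Type*} [NontriviallyNormedField 𝕜]
    [Fintype ι] [Fintype κ] (P : κ → MvPolynomial ι 𝕜) (x : ι → 𝕜) :
    HasStrictFDerivAt (fun (y : ι → 𝕜) (j : κ) => MvPolynomial.aeval y (P j))
      (ContinuousLinearMap.pi fun j => (P j).differentialCLM x) x :=
  hasStrictFDerivAt_pi'.2 fun j => (P j).hasStrictFDerivAt_aeval x

theorem MvPolynomial.differentialAt_rename {k K ι κ : Type*} [CommRing k] [CommRing K] [Algebra k K]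
    [Fintype ι] [Fintype κ] (f : κ → ι) (q : MvPolynomial κ k) (x t : ι → K) :
    differentialAt (rename f q) x t = differentialAt q (fun j => x (f j)) fun j => t (f j) := by
  have : rename f q = bind₁ (fun j => X (f j)) q := by
    rw [rename_eq_aeval]
    rfl
  rw [this, differentialAt_bind₁]
  simp only [aeval_X, differentialAt_X]

theorem NormedSpace.exists_hasStrictFDerivAt_exp_prod {F 𝔸 : Type*} [NontriviallyNormedField F]
    [CharZero F] [NormedRing 𝔸] [NormedAlgebra F 𝔸] [CompleteSpace 𝔸]
    (hr : 0 < (NormedSpace.expSeries F 𝔸).radius) (V : Submodule F 𝔸) :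
    ∃ D : (V × F) →L[F] (𝔸 × 𝔸 × F),
      HasStrictFDerivAt (fun v : V × F => (NormedSpace.exp (v.1 : 𝔸), NormedSpace.exp (-v.1 : 𝔸),
        1 + v.2)) D 0 ∧ ∀ v, D v = (↑v.1, -↑v.1, v.2) := by
  have hexp := hasStrictFDerivAt_exp_zero_of_radius_pos hr
  refine ⟨(V.subtypeL.comp (.fst F V F)).prod
    ((-(V.subtypeL.comp (.fst F V F))).prod (.snd F V F)),
    HasStrictFDerivAt.prodMk ?_ (HasStrictFDerivAt.prodMk ?_ ?_), fun v => rfl⟩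
  · have h1 := (V.subtypeL.comp (.fst F V F)).hasStrictFDerivAt (x := 0)
    have h2 : HasStrictFDerivAt NormedSpace.exp (1 : 𝔸 →L[F] 𝔸)
        ((V.subtypeL.comp (.fst F V F)) 0) := by simpa using hexp
    exact h2.comp (0 : V × F) h1
  · have h1 := (-(V.subtypeL.comp (.fst F V F))).hasStrictFDerivAt (x := 0)
    have h2 : HasStrictFDerivAt NormedSpace.exp (1 : 𝔸 →L[F] 𝔸)
        ((-(V.subtypeL.comp (.fst F V F))) 0) := by simpa using hexp
    exact h2.comp (0 : V × F) h1
  · exact (ContinuousLinearMap.snd F V F).hasStrictFDerivAt.const_add 1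

namespace LinearAlgebraicGroup

open LinAlg MvPolynomial

section Orbit

variable {F : Type*} [NontriviallyNormedField F] [CompleteSpace F] {n : ℕ}

/-- The coordinates of `GL_n × 𝔾_m` as a linear function of `(g, g⁻¹, c)`. -/
def scaledCoordsCLM (F : Type*) [NontriviallyNormedField F] [CompleteSpace F] (n : ℕ) :
    (((Fin n → F) →L[F] (Fin n → F)) × ((Fin n → F) →L[F] (Fin n → F)) × F) →L[F]
      (((Fin n × Fin n) ⊕ (Fin n × Fin n)) ⊕ Unit → F) :=
  LinearMap.toContinuousLinearMap
    { toFun z := Sum.elim (Sum.elim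
        (fun ij => ContinuousLinearMap.matrixAlgHom F n z.1 ij.1 ij.2)
        (fun ij => ContinuousLinearMap.matrixAlgHom F n z.2.1 ij.1 ij.2)) fun _ => z.2.2
      map_add' x y := by ext ((i | i) | i) <;> simp
      map_smul' c x := by ext ((i | i) | i) <;> simp }

theorem scaledCoordsCLM_apply (z) : scaledCoordsCLM F n z = Sum.elim (Sum.elim
    (fun ij => ContinuousLinearMap.matrixAlgHom F n z.1 ij.1 ij.2)
    (fun ij => ContinuousLinearMap.matrixAlgHom F n z.2.1 ij.1 ij.2)) fun _ => z.2.2 := rfl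

/-- The Lie algebra as a space of endomorphisms. -/
def lieEnd (G : LinearAlgebraicGroup F n) : Submodule F ((Fin n → F) →L[F] (Fin n → F)) :=
  G.lie.comap (LinearMap.pi fun ij => Matrix.entryLinearMap F F ij.1 ij.2 ∘ₗ
    (ContinuousLinearMap.matrixAlgHom F n).toLinearMap)

/-- The exponential chart `(z, c) ↦ (exp z, exp (-z), 1 + c)`. -/
def expChart (G : LinearAlgebraicGroup F n) (v : G.lieEnd × F) :
    ((Fin n × Fin n) ⊕ (Fin n × Fin n)) ⊕ Unit → F :=
  scaledCoordsCLM F n (NormedSpace.exp (v.1 : (Fin n → F) →L[F] (Fin n → F)),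
    NormedSpace.exp (-(v.1 : (Fin n → F) →L[F] (Fin n → F))), 1 + v.2)

theorem expChart_zero (G : LinearAlgebraicGroup F n) : G.expChart 0 = scaledCoords 1 1 := by
  ext ((i | i) | i) <;> simp [expChart, scaledCoordsCLM_apply, scaledCoords, coords]

variable [CharZero F]

theorem exists_hasStrictFDerivAt_expChart (G : LinearAlgebraicGroup F n)
    (hr : 0 < (NormedSpace.expSeries F ((Fin n → F) →L[F] (Fin n → F))).radius) :
    ∃ D : (G.lieEnd × F) →L[F] (((Fin n × Fin n) ⊕ (Fin n × Fin n)) ⊕ Unit → F),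
      HasStrictFDerivAt G.expChart D 0 ∧ ∀ v, D v = scaledCoordsCLM F n (v.1, -v.1, v.2) := by
  have : CompleteSpace (Fin n → F) := FiniteDimensional.complete F _
  obtain ⟨D, hD, hD'⟩ := NormedSpace.exists_hasStrictFDerivAt_exp_prod hr G.lieEnd
  exact ⟨(scaledCoordsCLM F n).comp D,
    (scaledCoordsCLM F n).hasStrictFDerivAt.comp (0 : G.lieEnd × F) hD,
    fun v => congrArg (scaledCoordsCLM F n) (hD' v)⟩

/-- The group element with parameter `z`. -/
def expGL (G : LinearAlgebraicGroup F n) (z : G.lieEnd)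
    (hz : (z : (Fin n → F) →L[F] (Fin n → F)) ∈ Metric.eball 0
      (NormedSpace.expSeries F ((Fin n → F) →L[F] (Fin n → F))).radius) : GL (Fin n) F :=
  have : CompleteSpace (Fin n → F) := FiniteDimensional.complete F _
  Units.map (ContinuousLinearMap.matrixAlgHom F n : _ →* Matrix (Fin n) (Fin n) F)
    (NormedSpace.expUnit _ hz)

theorem expGL_mem (G : LinearAlgebraicGroup F n) (z : G.lieEnd) (hz) : G.expGL z hz ∈ G.points :=
  have : CompleteSpace (Fin n → F) := FiniteDimensional.complete F _
  G.map_expUnit_mem_points (ContinuousLinearMap.matrixAlgHom F n) _ z.2 hz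

theorem eventually_expGL_mem (G : LinearAlgebraicGroup F n)
    (hr : 0 < (NormedSpace.expSeries F ((Fin n → F) →L[F] (Fin n → F))).radius)
    {N : Set (GL (Fin n) F)} (hN : N ∈ 𝓝 1) :
    ∀ᶠ z : G.lieEnd in 𝓝 0, ∃ hz, G.expGL z hz ∈ N := by
  have : CompleteSpace (Fin n → F) := FiniteDimensional.complete F _
  have hexp := (hasStrictFDerivAt_exp_zero_of_radius_pos hr).continuousAt
  have hθ : Continuous (ContinuousLinearMap.matrixAlgHom F n) :=
    LinearMap.continuous_of_finiteDimensional (ContinuousLinearMap.matrixAlgHom F n).toLinearMap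
  rw [Units.isInducing_embedProduct.nhds_eq_comap, mem_comap] at hN
  obtain ⟨N', hN', hsub⟩ := hN
  have h1 : Tendsto (fun z : G.lieEnd => ((ContinuousLinearMap.matrixAlgHom F n (NormedSpace.exp z.1),
      MulOpposite.op (ContinuousLinearMap.matrixAlgHom F n (NormedSpace.exp (-z.1)))) :
        Matrix (Fin n) (Fin n) F × (Matrix (Fin n) (Fin n) F)ᵐᵒᵖ)) (𝓝 0)
      (𝓝 (Units.embedProduct _ (1 : GL (Fin n) F))) := by
    have e1 : Tendsto (fun z : G.lieEnd => (z : (Fin n → F) →L[F] (Fin n → F))) (𝓝 0) (𝓝 0) :=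
      continuous_subtype_val.tendsto' _ _ rfl
    have e2 : Tendsto (fun z : G.lieEnd => -(z : (Fin n → F) →L[F] (Fin n → F))) (𝓝 0) (𝓝 0) := by
      simpa using e1.neg
    have e3 : Tendsto (NormedSpace.exp : ((Fin n → F) →L[F] (Fin n → F)) → _) (𝓝 0) (𝓝 1) := by
      simpa using hexp.tendsto
    have e4 : Tendsto (ContinuousLinearMap.matrixAlgHom F n) (𝓝 1) (𝓝 1) :=
      hθ.tendsto' _ _ (map_one _)
    exact (e4.comp (e3.comp e1)).prodMk_nhds
      ((MulOpposite.continuous_op.tendsto _).comp (e4.comp (e3.comp e2)))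
  have h2 : ∀ᶠ z : G.lieEnd in 𝓝 0, (z : (Fin n → F) →L[F] (Fin n → F)) ∈ Metric.eball 0
      (NormedSpace.expSeries F ((Fin n → F) →L[F] (Fin n → F))).radius :=
    continuous_subtype_val.continuousAt.eventually_mem (Metric.eball_mem_nhds _ hr)
  filter_upwards [h1.eventually_mem hN', h2] with z hz hb
  exact ⟨hb, hsub hz⟩

end Orbit

end LinearAlgebraicGroup

end


/-! ### Openness of rational orbits -/

noncomputable section

open Filter Topology

namespace LinearAlgebraicGroup

open LinAlg MvPolynomial

section Orbit

variable {F : Type*} [NontriviallyNormedField F] [CompleteSpace F] {n m : ℕ}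

/-- A vector tangent to `GL_n × 𝔾_m` along the closure of `G × 𝔾_m` comes from the Lie algebra. -/
theorem exists_scaledCoordsCLM_eq (G : LinearAlgebraicGroup F n)
    (ζ : ((Fin n × Fin n) ⊕ (Fin n × Fin n)) ⊕ Unit → F)
    (hζ : ∀ q ∈ vanishingIdeal F (Set.range fun h : G.geom × (AlgebraicClosure F)ˣ =>
      scaledCoords h.1.1 (h.2 : AlgebraicClosure F)), differentialAt q (scaledCoords 1 1) ζ = 0) :
    ∃ v : G.lieEnd × F, scaledCoordsCLM F n (v.1, -v.1, v.2) = ζ := by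
  obtain ⟨z, hz⟩ := (ContinuousLinearMap.matrixAlgHom_bijective F n).2
    (.of fun i j => ζ (Sum.inl (Sum.inl (i, j))))
  have hlie : z ∈ G.lieEnd := by
    intro q hq
    have h1 := hζ (rename (fun ij => Sum.inl (Sum.inl ij)) q) (by
      rintro _ ⟨h, rfl⟩
      rw [aeval_rename]
      exact (G.mem_ideal q).1 hq _ h.1.2)
    rw [differentialAt_rename] at h1
    rw [← h1]
    congr 1
    funext ij
    exact congrFun (congrFun hz ij.1) ij.2
  -- Differentiating `g g⁻¹ = 1` at the identity shows that the inverse coordinates move by the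
  -- negative.
  have hinv (i j) : ζ (Sum.inl (Sum.inr (i, j))) = -ζ (Sum.inl (Sum.inl (i, j))) := by
    have h1 := hζ (∑ k, X (Sum.inl (Sum.inl (i, k))) * X (Sum.inl (Sum.inr (k, j))) -
      C ((1 : Matrix (Fin n) (Fin n) F) i j)) (by
        rintro _ ⟨h, rfl⟩
        have h2 : ((h.1.1 * (h.1.1)⁻¹ : GL (Fin n) (AlgebraicClosure F)) :
          Matrix (Fin n) (Fin n) (AlgebraicClosure F)) i j =
            (1 : Matrix (Fin n) (Fin n) (AlgebraicClosure F)) i j := by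
          rw [mul_inv_cancel]; rfl
        rw [Matrix.GeneralLinearGroup.coe_mul, Matrix.mul_apply] at h2
        simp only [map_sub, map_sum, map_mul, aeval_X, aeval_C]
        rw [sub_eq_zero]
        refine h2.trans ?_
        rw [Matrix.one_apply, Matrix.one_apply]
        split_ifs <;> simp)
    rw [differentialAt_sub, differentialAt_C, sub_zero, differentialAt_sum] at h1
    simp only [differentialAt_mul, aeval_X, differentialAt_X, scaledCoords, Sum.elim_inl,
      Sum.elim_inr, coords, inv_one, Units.val_one, Matrix.one_apply, ite_mul, one_mul, zero_mul,
      Finset.sum_add_distrib, Finset.sum_ite_eq, Finset.sum_ite_eq', Finset.mem_univ, if_true] at h1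
    exact eq_neg_of_add_eq_zero_left h1
  refine ⟨⟨⟨z, hlie⟩, ζ (Sum.inr ())⟩, ?_⟩
  rw [scaledCoordsCLM_apply]
  funext i
  rcases i with (⟨i, j⟩ | ⟨i, j⟩) | i
  · exact congrFun (congrFun hz i) j
  · rw [hinv]
    simp only [Sum.elim_inl, Sum.elim_inr, map_neg]
    rw [hz]
    rfl
  · rfl

theorem algebraMap_aeval_orbitPoly {F : Type*} [Field F] {n m : ℕ} (G : LinearAlgebraicGroup F n)
    (r : G.geom →* GL (Fin m) (AlgebraicClosure F))
    (a : Fin m → Fin m → MvPolynomial ((Fin n × Fin n) ⊕ (Fin n × Fin n)) F)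
    (ha : ∀ (g : G.geom) i j, (r g : Matrix (Fin m) (Fin m) (AlgebraicClosure F)) i j =
      aeval (Sum.elim (coords (g : GL (Fin n) (AlgebraicClosure F)))
        (coords (g : GL (Fin n) (AlgebraicClosure F))⁻¹)) (a i j))
    (w : Fin m → F) (g : GL (Fin n) F) (hg : g ∈ G.points) (c : F) (j : Fin m) :
    algebraMap F (AlgebraicClosure F) (aeval (scaledCoords g c) (orbitPoly a w j)) =
      algebraMap F (AlgebraicClosure F) c *
        (r ⟨_, hg⟩ : Matrix (Fin m) (Fin m) (AlgebraicClosure F)).mulVec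
          (fun i => algebraMap F (AlgebraicClosure F) (w i)) j := by
  have h1 : aeval (fun i => algebraMap F (AlgebraicClosure F) (scaledCoords g c i))
      (orbitPoly a w j) = algebraMap F (AlgebraicClosure F)
        (aeval (scaledCoords g c) (orbitPoly a w j)) := aeval_algebraMap_apply _ _ _
  have h2 : (fun i => algebraMap F (AlgebraicClosure F) (scaledCoords g c i)) =
      scaledCoords (Matrix.GeneralLinearGroup.map (algebraMap F (AlgebraicClosure F)) g)
        (algebraMap F (AlgebraicClosure F) c) := by
    funext i
    rcases i with (i | i) | i
    · rfl
    · simp only [scaledCoords, Sum.elim_inl, Sum.elim_inr]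
      rw [← map_inv]
      rfl
    · rfl
  rw [← h1, h2, aeval_scaledCoords_orbitPoly]
  congr 3
  ext i l
  exact (ha ⟨_, hg⟩ i l).symm

variable [CharZero F]

theorem exists_hasStrictFDerivAt_aeval_expChart (G : LinearAlgebraicGroup F n)
    (hrad : 0 < (NormedSpace.expSeries F ((Fin n → F) →L[F] (Fin n → F))).radius)
    (P : Fin m → MvPolynomial (((Fin n × Fin n) ⊕ (Fin n × Fin n)) ⊕ Unit) F) :
    ∃ D : (G.lieEnd × F) →L[F] (Fin m → F),
      HasStrictFDerivAt (fun v j => aeval (G.expChart v) (P j)) D 0 ∧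
      ∀ v j, D v j = differentialAt (P j) (scaledCoords 1 1)
        (scaledCoordsCLM F n (v.1, -v.1, v.2)) := by
  obtain ⟨D, hD, hD'⟩ := G.exists_hasStrictFDerivAt_expChart hrad
  have hg := hasStrictFDerivAt_aeval_pi P (G.expChart 0)
  refine ⟨_, hg.comp (0 : G.lieEnd × F) hD, fun v j => ?_⟩
  rw [expChart_zero, ← hD']
  simp

/-- The orbits of the rational points of `G × 𝔾_m` are open in the rational points of an orbit of
the geometric points. -/
theorem eventually_exists_mem_orbit (G : LinearAlgebraicGroup F n)
    (hrad : 0 < (NormedSpace.expSeries F ((Fin n → F) →L[F] (Fin n → F))).radius)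
    (r : G.geom →* GL (Fin m) (AlgebraicClosure F))
    (a : Fin m → Fin m → MvPolynomial ((Fin n × Fin n) ⊕ (Fin n × Fin n)) F)
    (ha : ∀ (g : G.geom) i j, (r g : Matrix (Fin m) (Fin m) (AlgebraicClosure F)) i j =
      aeval (Sum.elim (coords (g : GL (Fin n) (AlgebraicClosure F)))
        (coords (g : GL (Fin n) (AlgebraicClosure F))⁻¹)) (a i j))
    (w : Fin m → F) {N : Set (GL (Fin n) F)} (hN : N ∈ 𝓝 1) :
    ∀ᶠ x : Fin m → F in 𝓝 w, (∃ h : G.geom × (AlgebraicClosure F)ˣ, ∀ j,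
      algebraMap F (AlgebraicClosure F) (x j) = h.2 *
        (r h.1 : Matrix (Fin m) (Fin m) (AlgebraicClosure F)).mulVec
          (fun i => algebraMap F (AlgebraicClosure F) (w i)) j) →
      ∃ g ∈ G.points, ∃ c : F, c ≠ 0 ∧ g ∈ N ∧
        ∀ j, x j = aeval (scaledCoords g c) (orbitPoly a w j) := by
  set J := vanishingIdeal F (Set.range fun (h : G.geom × (AlgebraicClosure F)ˣ) (j : Fin m) =>
    (h.2 : AlgebraicClosure F) * (r h.1 : Matrix (Fin m) (Fin m) (AlgebraicClosure F)).mulVec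
      (fun i => algebraMap F (AlgebraicClosure F) (w i)) j) with hJ
  -- Finitely many equations cut out the orbit closure, so `f` has a finite-dimensional target.
  obtain ⟨T, hT⟩ := (isNoetherianRing_iff_ideal_fg _).1 inferInstance J
  have hJF (x : Fin m → F) (h : G.geom × (AlgebraicClosure F)ˣ)
      (hx : ∀ j, algebraMap F (AlgebraicClosure F) (x j) = h.2 *
        (r h.1 : Matrix (Fin m) (Fin m) (AlgebraicClosure F)).mulVec
          (fun i => algebraMap F (AlgebraicClosure F) (w i)) j) (p) (hp : p ∈ J) :
      aeval x p = 0 := by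
    have h1 := hp _ ⟨h, rfl⟩
    dsimp only at h1
    rw [← funext hx] at h1
    have h2 : aeval (fun j => algebraMap F (AlgebraicClosure F) (x j)) p =
      algebraMap F (AlgebraicClosure F) (aeval x p) := aeval_algebraMap_apply _ x p
    rw [h2] at h1
    exact (map_eq_zero _).1 h1
  have hw (p) (hp : p ∈ J) : aeval w p = 0 := hJF w 1 (fun j => by simp) p hp
  obtain ⟨D, hψ, hD⟩ := G.exists_hasStrictFDerivAt_aeval_expChart hrad (orbitPoly a w)
  set ψ : G.lieEnd × F → Fin m → F := fun v j => aeval (G.expChart v) (orbitPoly a w j) with hψdef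
  have hone : ∀ j, aeval (scaledCoords (1 : GL (Fin n) F) 1) (orbitPoly a w j) = w j := by
    intro j
    refine (algebraMap F (AlgebraicClosure F)).injective ?_
    have h1 : (⟨_, one_mem G.points⟩ : G.geom) = 1 := Subtype.ext (map_one _)
    rw [G.algebraMap_aeval_orbitPoly r a ha w 1 (one_mem _), h1]
    simp
  have hψ0 : ψ 0 = w := by
    funext j
    simp only [hψdef, expChart_zero, hone]
  let f : (Fin m → F) → (T → F) := fun x q => aeval x q.1
  let f' : (Fin m → F) →L[F] (T → F) := ContinuousLinearMap.pi fun q => q.1.differentialCLM w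
  have hf : HasStrictFDerivAt f f' (ψ 0) := by
    rw [hψ0]
    exact hasStrictFDerivAt_aeval_pi _ _
  -- The kernel of `f'` is the rational tangent space of the orbit closure at `w`. Each of its
  -- vectors comes from the Lie algebra and the scaling direction.
  have hker : (f' : (Fin m → F) →ₗ[F] (T → F)).ker ≤ (D : (G.lieEnd × F) →ₗ[F] (Fin m → F)).range := by
    intro t ht
    have ht' (q : T) : differentialAt q.1 w t = 0 := by
      have := congrFun (LinearMap.mem_ker.1 ht) q
      simpa [f'] using this
    have htJ : ∀ p ∈ J, differentialAt p w t = 0 := by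
      intro p hp
      rw [← hT] at hp
      induction hp using Submodule.span_induction with
      | mem q hq => exact ht' ⟨q, hq⟩
      | zero => simp [differentialAt]
      | add p q _ _ hp hq => rw [differentialAt_add, hp, hq, add_zero]
      | smul c p hp hq =>
        rw [smul_eq_mul, differentialAt_mul, hq, hw p (hT ▸ hp), mul_zero, zero_mul, add_zero]
    obtain ⟨ζ, hζ, hζ'⟩ := G.exists_rational_tangent r a ha w t htJ
    obtain ⟨v, hv⟩ := G.exists_scaledCoordsCLM_eq ζ hζ
    refine ⟨v, ?_⟩
    funext j
    rw [← hζ' j, ← hv]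
    exact hD v j
  have hchart : ∀ᶠ v : G.lieEnd × F in 𝓝 0, (∃ hz, G.expGL v.1 hz ∈ N) ∧ 1 + v.2 ≠ 0 := by
    refine ((continuous_fst.tendsto' (0 : G.lieEnd × F) 0 rfl).eventually
      (G.eventually_expGL_mem hrad hN)).and ?_
    exact (Continuous.tendsto' (by fun_prop : Continuous fun v : G.lieEnd × F => 1 + v.2) 0 1
      (by simp)).eventually_ne one_ne_zero
  have hzero : ∀ᶠ v in 𝓝 0, f (ψ v) = 0 := by
    filter_upwards [hchart] with v ⟨⟨hz, _⟩, hc⟩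
    funext q
    refine hJF _ ⟨⟨_, G.expGL_mem v.1 hz⟩, (Units.mk0 (1 + v.2) hc).map (algebraMap F _).toMonoidHom⟩
      (fun j => ?_) q.1 (hT ▸ Ideal.subset_span q.2)
    exact G.algebraMap_aeval_orbitPoly r a ha w _ (G.expGL_mem v.1 hz) (1 + v.2) j
  clear_value ψ
  have hmain := hψ.eventually_exists_of_ker_le_range hf hker hzero hchart
  rw [hψ0] at hmain
  filter_upwards [hmain] with x hx ⟨h, hh⟩
  obtain ⟨v, ⟨⟨hz, hzN⟩, hc⟩, rfl⟩ := hx (funext fun q =>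
    hJF x h hh q.1 (hT ▸ Ideal.subset_span q.2))
  exact ⟨_, G.expGL_mem v.1 hz, 1 + v.2, hc, hzN, fun j => congrFun (congrFun hψdef v) j⟩

end Orbit

end LinearAlgebraicGroup

end


/-! ### Compactness of the rational points modulo a parabolic subgroup -/

noncomputable section

open Filter Topology

/-- No topology on `K` is involved: an element of `K` vanishes iff all `F`-linear functionals kill
it, and each functional yields a polynomial condition over `F`. -/
theorem MvPolynomial.isClosed_setOf_eval_algebraMap_eq_zero {F K ι : Type*}
    [NontriviallyNormedField F] [Field K] [Algebra F K] (p : MvPolynomial ι K) :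
    IsClosed {x : ι → F | MvPolynomial.eval (fun i => algebraMap F K (x i)) p = 0} := by
  have h : {x : ι → F | MvPolynomial.eval (fun i => algebraMap F K (x i)) p = 0} =
      ⋂ ρ : Module.Dual F K, {x | ∑ d ∈ p.support, ρ (p.coeff d) * ∏ i ∈ d.support, x i ^ d i = 0} := by
    ext x
    rw [Set.mem_iInter]
    have hρ (ρ : Module.Dual F K) : ρ (MvPolynomial.eval (fun i => algebraMap F K (x i)) p) =
        ∑ d ∈ p.support, ρ (p.coeff d) * ∏ i ∈ d.support, x i ^ d i := by
      rw [MvPolynomial.eval_eq, map_sum]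
      refine Finset.sum_congr rfl fun d _ => ?_
      have h1 : p.coeff d * ∏ i ∈ d.support, algebraMap F K (x i) ^ d i =
          (∏ i ∈ d.support, x i ^ d i) • p.coeff d := by
        rw [Algebra.smul_def, map_prod, mul_comm]
        simp
      rw [h1, map_smul, smul_eq_mul, mul_comm]
    change _ = 0 ↔ ∀ ρ : Module.Dual F K, _ = (0 : F)
    simp only [← hρ]
    exact (Module.forall_dual_apply_eq_zero_iff F _).symm
  rw [h]
  exact isClosed_iInter fun ρ => isClosed_eq (by fun_prop) continuous_const

namespace LinearAlgebraicGroup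

open LinAlg MvPolynomial

variable {F : Type*} [NontriviallyNormedField F] {n : ℕ}

theorem continuous_coords : Continuous (coords : GL (Fin n) F → Fin n × Fin n → F) :=
  continuous_pi fun ij => Units.continuous_val.matrix_elem ij.1 ij.2

theorem isClosed_points (G : LinearAlgebraicGroup F n) :
    IsClosed (G.points : Set (GL (Fin n) F)) := by
  have h : (G.points : Set (GL (Fin n) F)) = ⋂ q ∈ G.ideal, {g | aeval (coords g) q = 0} := by
    ext g
    simp only [Set.mem_iInter]
    exact G.mem_points_iff g
  rw [h]
  refine isClosed_biInter fun q _ => isClosed_eq ?_ continuous_const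
  exact (continuous_iff_continuousAt.2 fun x =>
    (q.hasStrictFDerivAt_aeval x).continuousAt).comp continuous_coords

instance [LocallyCompactSpace F] : LocallyCompactSpace (Matrix (Fin n) (Fin n) F) :=
  inferInstanceAs (LocallyCompactSpace (Fin n → Fin n → F))

theorem locallyCompactSpace_GL [LocallyCompactSpace F] : LocallyCompactSpace (GL (Fin n) F) :=
  inferInstanceAs (LocallyCompactSpace (Matrix (Fin n) (Fin n) F)ˣ)

/-- The rational points of a group over a `p`-adic field are compact modulo the rational points of a
parabolic subgroup. -/
theorem IsParabolic.exists_isCompact [ProperSpace F] [CharZero F] {G P : LinearAlgebraicGroup F n}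
    (hrad : 0 < (NormedSpace.expSeries F ((Fin n → F) →L[F] (Fin n → F))).radius)
    (hP : G.IsParabolic P) :
    ∃ C : Set (GL (Fin n) F), IsCompact C ∧ C ⊆ G.points ∧
      ∀ g ∈ G.points, ∃ c ∈ C, ∃ p ∈ P.points, g = c * p := by
  obtain ⟨m, r, v, ⟨a, ha⟩, hv, hstab, S, hS⟩ := hP.complete
  let al (x : Fin m → F) : Fin m → AlgebraicClosure F := fun i => algebraMap F _ (x i)
  let R (g : G.geom) : Matrix (Fin m) (Fin m) (AlgebraicClosure F) := r g
  have hR (g h : G.geom) (u) : (R (g * h)).mulVec u = (R g).mulVec ((R h).mulVec u) := by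
    rw [Matrix.mulVec_mulVec]
    simp only [R, map_mul]
    rfl
  have hRinv (g : G.geom) (u) : (R g⁻¹).mulVec ((R g).mulVec u) = u := by
    rw [← hR, inv_mul_cancel]
    simp [R]
  have hal : Function.Injective al := fun x y h =>
    funext fun i => (algebraMap F (AlgebraicClosure F)).injective (congrFun h i)
  let ι (g : GL (Fin n) F) (hg : g ∈ G.points) : G.geom := ⟨_, hg⟩
  have hι (g h : GL (Fin n) F) (hg hh) : ι (g * h) (mul_mem hg hh) = ι g hg * ι h hh :=
    Subtype.ext (map_mul _ _ _)
  have hιinv (g : GL (Fin n) F) (hg) : ι g⁻¹ (inv_mem hg) = (ι g hg)⁻¹ :=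
    Subtype.ext (map_inv _ _)
  -- `A x` consists of the rational elements carrying the line of `v` to the line of `x`; it is
  -- empty or a single coset `g P(F)`.
  let A (x : Fin m → F) : Set (GL (Fin n) F) :=
    {g | ∃ hg : g ∈ G.points, ∃ c : (AlgebraicClosure F)ˣ, (R (ι g hg)).mulVec (al v) = (c : AlgebraicClosure F) • al x}
  have hact (g) (hg : g ∈ G.points) (c : F) (w : Fin m → F) :
      al (fun j => aeval (scaledCoords g c) (orbitPoly a w j)) =
        algebraMap F (AlgebraicClosure F) c • (R (ι g hg)).mulVec (al w) :=
    funext fun j => G.algebraMap_aeval_orbitPoly r a ha w g hg c j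
  have hA (w) (h k) (hh : h ∈ A w) (hk : k ∈ A w) : h⁻¹ * k ∈ P.points := by
    obtain ⟨hhG, c, hc⟩ := hh
    obtain ⟨hkG, d, hd⟩ := hk
    refine (hstab (ι _ (mul_mem (inv_mem hhG) hkG))).2 ⟨d * ((c⁻¹ : (AlgebraicClosure F)ˣ) : AlgebraicClosure F), ?_⟩
    change (R _).mulVec (al v) = _ • al v
    have h1 : al w = ((c⁻¹ : (AlgebraicClosure F)ˣ) : AlgebraicClosure F) • (R (ι h hhG)).mulVec (al v) := by
      rw [hc, smul_smul, Units.inv_mul, one_smul]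
    rw [hι _ _ (inv_mem hhG) hkG, hιinv _ hhG, hR, hd, h1, Matrix.mulVec_smul, Matrix.mulVec_smul,
      hRinv, smul_smul]
  have : LocallyCompactSpace (GL (Fin n) F) := locallyCompactSpace_GL
  obtain ⟨N, hNc, hN⟩ := exists_compact_mem_nhds (1 : GL (Fin n) F)
  -- By openness of the rational orbit of `w`, elements leading to points near `w` all lie in `N h
  -- P(F)` for one `h`, with `N` a fixed compact neighbourhood of `1`.
  have claim (w : Fin m → F) (hw0 : w ≠ 0) (hw : al w ∈ G.orbitCone r (al v)) :
      ∃ h ∈ G.points, ∀ᶠ x in 𝓝 w, ∀ g ∈ A x, ∃ γ ∈ N ∩ G.points, ∃ p ∈ P.points, g = γ * h * p := by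
    obtain ⟨c₀, g₀, hg₀⟩ := hw
    have hc₀ : c₀ ≠ 0 := by
      rintro rfl
      refine hw0 (hal ?_)
      rw [hg₀, zero_smul]
      funext i
      simp [al]
    change al w = c₀ • (R g₀).mulVec (al v) at hg₀
    have hg₀' : (R g₀⁻¹).mulVec (al w) = c₀ • al v := by
      rw [hg₀, Matrix.mulVec_smul, hRinv]
    have key : ∀ᶠ x in 𝓝 w, ∀ g ∈ A x, ∃ γ ∈ N ∩ G.points, γ⁻¹ * g ∈ A w := by
      filter_upwards [G.eventually_exists_mem_orbit hrad r a ha w hN] with x hx g ⟨hg, c, hc⟩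
      have hc' : al x = ((c⁻¹ : (AlgebraicClosure F)ˣ) : AlgebraicClosure F) • (R (ι g hg)).mulVec (al v) := by
        rw [hc, smul_smul, Units.inv_mul, one_smul]
      obtain ⟨γ, hγ, d, hd, hγN, hxγ⟩ := hx ⟨⟨ι g hg * g₀⁻¹, c⁻¹ * (Units.mk0 c₀ hc₀)⁻¹⟩, fun j => by
        have h1 : al x = ((c⁻¹ * (Units.mk0 c₀ hc₀)⁻¹ : (AlgebraicClosure F)ˣ) : AlgebraicClosure F) •
            (R (ι g hg * g₀⁻¹)).mulVec (al w) := by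
          rw [hR, hg₀', Matrix.mulVec_smul, smul_smul, hc']
          congr 1
          rw [Units.val_mul, mul_assoc, Units.val_inv_eq_inv_val (Units.mk0 c₀ hc₀), Units.val_mk0,
            inv_mul_cancel₀ hc₀, mul_one]
        exact congrFun h1 j⟩
      refine ⟨γ, ⟨hγN, hγ⟩, mul_mem (inv_mem hγ) hg,
        c * Units.mk0 (algebraMap F (AlgebraicClosure F) d) (by simpa using hd), ?_⟩
      have h2 : al x = algebraMap F (AlgebraicClosure F) d • (R (ι γ hγ)).mulVec (al w) := by
        rw [← hact, ← funext hxγ]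
      rw [hι _ _ (inv_mem hγ) hg, hιinv _ hγ, hR, hc, h2, Matrix.mulVec_smul, Matrix.mulVec_smul, hRinv,
        smul_smul, Units.val_mul, Units.val_mk0]
    by_cases hne : (A w).Nonempty
    · obtain ⟨h, hh⟩ := hne
      refine ⟨h, hh.1, key.mono fun x hx g hg => ?_⟩
      obtain ⟨γ, hγ, hγg⟩ := hx g hg
      exact ⟨γ, hγ, _, hA w h _ hh hγg, by group⟩
    -- If `A w` is empty, so is `A x` for all `x` near `w`. The witness `1` is arbitrary.
    · refine ⟨1, one_mem _, key.mono fun x hx g hg => ?_⟩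
      obtain ⟨γ, hγ, hγg⟩ := hx g hg
      exact (hne ⟨_, hγg⟩).elim
  obtain ⟨b, hb⟩ := NormedField.exists_one_lt_norm F
  -- The shell has ratio `‖b‖`, so every nonzero vector has a scalar multiple in it; it is closed
  -- and bounded, and stays away from `0`.
  let K : Set (Fin m → F) := {x | al x ∈ G.orbitCone r (al v)} ∩ {x | 1 / ‖b‖ ≤ ‖x‖ ∧ ‖x‖ ≤ 1}
  have hbpos : 0 < 1 / ‖b‖ := by positivity
  have hK : IsCompact K := by
    refine Metric.isCompact_of_isClosed_isBounded (IsClosed.inter ?_ ?_) ?_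
    · have : {x | al x ∈ G.orbitCone r (al v)} =
          ⋂ p ∈ S, {x : Fin m → F | MvPolynomial.eval (fun i => algebraMap F (AlgebraicClosure F) (x i)) p = 0} := by
        ext x
        simp only [Set.mem_iInter]
        exact hS (al x)
      rw [this]
      exact isClosed_biInter fun p _ => MvPolynomial.isClosed_setOf_eval_algebraMap_eq_zero p
    · exact (isClosed_le continuous_const continuous_norm).inter
        (isClosed_le continuous_norm continuous_const)
    · exact (Metric.isBounded_closedBall (x := 0) (r := 1)).subset fun x hx => by
        simpa using (hx.2.2 : ‖x‖ ≤ 1)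
  have hK0 (w) (hw : w ∈ K) : w ≠ 0 := by
    rintro rfl
    have := hw.2.1
    rw [norm_zero] at this
    exact absurd this (not_le.2 hbpos)
  choose! h hhG hh using fun w (hw : w ∈ K) => claim w (hK0 w hw) hw.1
  obtain ⟨s, hsK, hs⟩ := hK.elim_nhds_subcover _ hh
  refine ⟨⋃ w ∈ s, (fun γ => γ * h w) '' (N ∩ G.points), ?_, ?_, fun g hg => ?_⟩
  · exact s.isCompact_biUnion fun w _ => (hNc.inter_right G.isClosed_points).image (by fun_prop)
  · refine Set.iUnion₂_subset fun w hw => ?_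
    rintro _ ⟨γ, hγ, rfl⟩
    exact mul_mem hγ.2 (hhG w (hsK w hw))
  · let x₀ : Fin m → F := fun j => aeval (scaledCoords g 1) (orbitPoly a v j)
    have hx₀ : al x₀ = (R (ι g hg)).mulVec (al v) := by
      rw [hact g hg, map_one, one_smul]
    have hx₀0 : x₀ ≠ 0 := by
      intro h0
      have h1 := hRinv (ι g hg) (al v)
      have h2 : al x₀ = 0 := by
        rw [h0]; funext i; simp [al]
      rw [← hx₀, h2, Matrix.mulVec_zero] at h1
      refine hv (hal ?_)
      rw [← h1]; funext i; simp [al]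
    obtain ⟨d, hd0, hd1, hd2, -⟩ := rescale_to_shell hb one_pos hx₀0
    have hald : al (d • x₀) = algebraMap F (AlgebraicClosure F) d • al x₀ := by
      funext i; simp [al]
    have hdK : d • x₀ ∈ K := ⟨⟨algebraMap F _ d, ι g hg, by rw [hald, hx₀]⟩, hd2, hd1.le⟩
    have hgA : g ∈ A (d • x₀) := ⟨hg, (Units.mk0 (algebraMap F (AlgebraicClosure F) d) (by simpa using hd0))⁻¹, by
      rw [hald, smul_smul, hx₀]
      simp [hd0]⟩
    obtain ⟨w, hw, hgw⟩ := Set.mem_iUnion₂.1 (hs hdK)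
    obtain ⟨γ, hγ, p, hp, rfl⟩ := hgw g hgA
    exact ⟨γ * h w, Set.mem_iUnion₂.2 ⟨w, hw, γ, hγ, rfl⟩, p, hp, rfl⟩

end LinearAlgebraicGroup

end


noncomputable section

open Filter Topology

/-! ### Continuous sections of quotients of totally disconnected groups -/

theorem exists_isClopen_isCompact_superset {X : Type*} [TopologicalSpace X] [LocallyCompactSpace X]
    [T2Space X] [TotallyDisconnectedSpace X] {K : Set X} (hK : IsCompact K) :
    ∃ C, IsClopen C ∧ IsCompact C ∧ K ⊆ C := by
  obtain ⟨K', hK', hKK'⟩ := exists_compact_superset hK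
  have h (x) (hx : x ∈ K) : ∃ V, IsClopen V ∧ x ∈ V ∧ V ⊆ interior K' :=
    (loc_compact_Haus_tot_disc_of_zero_dim (H := X)).exists_subset_of_mem_open (hKK' hx)
      isOpen_interior
  choose! V hV hxV hVK using h
  obtain ⟨s, hs, hsK⟩ := hK.elim_nhds_subcover V fun x hx => (hV x hx).isOpen.mem_nhds (hxV x hx)
  have hclopen : IsClopen (⋃ x ∈ s, V x) := isClopen_biUnion_finset fun x hx => hV x (hs x hx)
  refine ⟨_, hclopen, hK'.of_isClosed_subset hclopen.isClosed ?_, hsK⟩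
  exact Set.iUnion₂_subset fun x hx => (hVK x (hs x hx)).trans interior_subset

/-- There are countably many clopen sets, and their indicators embed `X` in the Cantor set. With
ratio `1 / 3` the values are at most `∑ 3⁻ᵏ = 3 / 2`, which leaves `2` free as a value strictly
above them. -/
theorem exists_continuous_injective_real (X : Type*) [TopologicalSpace X] [CompactSpace X]
    [T2Space X] [TotallyDisconnectedSpace X] [SecondCountableTopology X] :
    ∃ φ : X → ℝ, Continuous φ ∧ Function.Injective φ ∧ ∀ x, φ x < 2 := by
  have : Countable (TopologicalSpace.Clopens X) :=
    TopologicalSpace.Clopens.countable_iff_secondCountable.2 inferInstance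
  obtain ⟨U, hU⟩ := exists_surjective_nat (TopologicalSpace.Clopens X)
  classical
  let b (x : X) (k : ℕ) : Bool := decide (x ∈ U k)
  refine ⟨fun x => Cardinal.cantorFunction (1 / 3) (b x), ?_, ?_, fun x => ?_⟩
  · refine continuous_tsum (u := fun k => (1 / 3 : ℝ) ^ k) (fun k => ?_)
      (summable_geometric_of_lt_one (by norm_num) (by norm_num)) fun k x => ?_
    · have : IsLocallyConstant fun x => Cardinal.cantorFunctionAux (1 / 3) (b x) k := by
        have hb : IsLocallyConstant fun x => b x k := by
          rw [IsLocallyConstant.iff_continuous]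
          exact (continuous_bool_rng true).2 (by
            have : (fun x => b x k) ⁻¹' {true} = (U k : Set X) := by ext; simp [b]
            rw [this]
            exact (U k).isClopen)
        exact hb.comp fun c => cond c ((1 / 3 : ℝ) ^ k) 0
      exact this.continuous
    · unfold Cardinal.cantorFunctionAux
      cases b x k <;> simp
  · intro x y hxy
    have hb := Cardinal.cantorFunction_injective (by norm_num) (by norm_num) hxy
    by_contra hne
    obtain ⟨V, hV, hx, hy⟩ := exists_isClopen_of_totally_separated hne
    obtain ⟨k, hk⟩ := hU ⟨V, hV⟩
    have h1 := congrFun hb k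
    have hx' : x ∈ U k := by rw [hk]; exact hx
    have hy' : y ∉ U k := by rw [hk]; exact hy
    simp [b, hx', hy'] at h1
  · have h1 : Cardinal.cantorFunction (1 / 3) (b x) ≤ Cardinal.cantorFunction (1 / 3) fun _ => true :=
      Cardinal.cantorFunction_le (by norm_num) (by norm_num) fun _ _ => rfl
    refine h1.trans_lt ?_
    unfold Cardinal.cantorFunction Cardinal.cantorFunctionAux
    simp only [cond_true]
    rw [tsum_geometric_of_lt_one (by norm_num) (by norm_num)]
    norm_num

open scoped Pointwise in
/-- A closed subgroup `P` of a locally compact totally disconnected group `H` such that `P \ H` is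
compact has a continuous section `P \ H → H`, given by a map that is constant on cosets. -/
theorem Subgroup.exists_continuous_section {H : Type*} [Group H] [TopologicalSpace H]
    [IsTopologicalGroup H] [LocallyCompactSpace H] [T2Space H] [TotallyDisconnectedSpace H]
    [SecondCountableTopology H] (P : Subgroup H) (hP : IsClosed (P : Set H)) {K : Set H}
    (hK : IsCompact K) (hcov : ∀ g, ∃ p ∈ P, p * g ∈ K) :
    ∃ s : H → H, Continuous s ∧ IsCompact (Set.range s) ∧ (∀ g, s g * g⁻¹ ∈ P) ∧
      ∀ p ∈ P, ∀ g, s (p * g) = s g := by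
  obtain ⟨C, hCclopen, hC, hKC⟩ := exists_isClopen_isCompact_superset hK
  have : CompactSpace C := isCompact_iff_compactSpace.1 hC
  obtain ⟨φ, hφ, hinj, hφ2⟩ := exists_continuous_injective_real C
  classical
  -- Outside `C` the value `2` exceeds all values on `C`. On each coset `P g` the minimum of `φ'` is
  -- attained in `C`, at one point only by injectivity of `φ`; this point is `s g`.
  let φ' : H → ℝ := fun x => if hx : x ∈ C then φ ⟨x, hx⟩ else 2
  have hφ' : Continuous φ' := by
    rw [continuous_iff_continuousAt]
    intro x
    by_cases hx : x ∈ C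
    · have h1 : ContinuousAt (fun y : C => φ' y) ⟨x, hx⟩ := by
        have : (fun y : C => φ' y) = φ := by
          funext y; simp [φ', y.2]
        rw [this]
        exact hφ.continuousAt
      exact (hCclopen.isOpen.isOpenEmbedding_subtypeVal.continuousAt_iff (x := ⟨x, hx⟩)).1 h1
    · have h1 : φ' =ᶠ[𝓝 x] fun _ => 2 := by
        filter_upwards [hCclopen.compl.isOpen.mem_nhds hx] with y hy
        exact dif_neg hy
      exact continuousAt_const.congr h1.symm
  have hle (x) : φ' x ≤ 2 := by
    by_cases hx : x ∈ C
    · simpa [φ', hx] using (hφ2 ⟨x, hx⟩).le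
    · simp [φ', hx]
  have hmin (g : H) : ∃ x ∈ C, x * g⁻¹ ∈ P ∧ ∀ y ∈ C, y * g⁻¹ ∈ P → φ' x ≤ φ' y := by
    have hcl : IsClosed {y | y * g⁻¹ ∈ P} := hP.preimage (continuous_mul_const g⁻¹)
    obtain ⟨p, hp, hpK⟩ := hcov g
    obtain ⟨x, hx, hxmin⟩ := (hC.inter_right hcl).exists_isMinOn
      ⟨p * g, hKC hpK, by simpa using hp⟩ hφ'.continuousOn
    exact ⟨x, hx.1, hx.2, fun y hy hyP => hxmin ⟨hy, hyP⟩⟩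
  choose s hsC hsP hsmin using hmin
  have hs_eq (p) (hp : p ∈ P) (g) : s (p * g) = s g := by
    have h1 : s (p * g) * g⁻¹ ∈ P := by
      have := mul_mem (hsP (p * g)) hp
      simpa [mul_assoc] using this
    have h2 : s g * (p * g)⁻¹ ∈ P := by
      have := mul_mem (hsP g) (inv_mem hp)
      simpa [mul_assoc] using this
    have h3 := le_antisymm (hsmin (p * g) _ (hsC g) h2) (hsmin g _ (hsC (p * g)) h1)
    simp only [φ', hsC, dif_pos] at h3
    exact congrArg Subtype.val (hinj h3)
  -- For `g` in a compact neighbourhood `W`, the minimum can be taken over `p` in the fixed compact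
  -- set `P ∩ C W⁻¹`, and an infimum over a compact parameter set is continuous.
  have hm : Continuous fun g => φ' (s g) := by
    rw [continuous_iff_continuousAt]
    intro g₀
    obtain ⟨W, hW, hWg⟩ := exists_compact_mem_nhds g₀
    have hQ : IsCompact ((P : Set H) ∩ (C * W⁻¹)) := (hC.mul hW.inv).inter_left hP
    have h1 := hQ.continuous_sInf (f := fun g p => φ' (p * g)) (by
      change Continuous fun z : H × H => φ' (z.2 * z.1)
      fun_prop)
    refine h1.continuousAt.congr ?_
    filter_upwards [hWg] with g hg
    refine IsLeast.csInf_eq ⟨⟨s g * g⁻¹, ⟨hsP g, Set.mul_mem_mul (hsC g) (Set.inv_mem_inv.2 hg)⟩,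
      by simp⟩, ?_⟩
    rintro _ ⟨q, ⟨hq, -⟩, rfl⟩
    by_cases hqC : q * g ∈ C
    · exact hsmin g _ hqC (by simpa using hq)
    · have : φ' (q * g) = 2 := dif_neg hqC
      simp only [this]
      exact hle _
  have hs : Continuous s := by
    have hemb : IsEmbedding φ := (hφ.isClosedEmbedding hinj).isEmbedding
    have h1 : Continuous fun g => (⟨s g, hsC g⟩ : C) := by
      rw [hemb.continuous_iff]
      convert hm using 2 with g
      simp [φ', hsC]
    exact continuous_subtype_val.comp h1
  refine ⟨s, hs, ?_, hsP, hs_eq⟩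
  -- Idempotence identifies the range with the fixed points of `s`, a closed subset of the compact
  -- set `C`.
  have hidem (g) : s (s g) = s g := by
    have := hs_eq _ (hsP g) g
    rwa [inv_mul_cancel_right] at this
  have hrange : Set.range s = {x | s x = x} := by
    ext x
    exact ⟨by rintro ⟨g, rfl⟩; exact hidem g, fun hx => ⟨x, hx⟩⟩
  refine hC.of_isClosed_subset ?_ (by rintro _ ⟨g, rfl⟩; exact hsC g)
  rw [hrange]
  exact isClosed_eq hs continuous_id

end


/-! ### Rational points of Levi decompositions, and the continuous section -/

noncomputable section

open Filter Topology

namespace LinearAlgebraicGroup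

open LinAlg

section Levi

variable {F : Type*} [Field F] {n : ℕ}

theorem points_mono {H K : LinearAlgebraicGroup F n} (h : H.geom ≤ K.geom) : H.points ≤ K.points :=
  Subgroup.comap_mono h

variable {H L U : LinearAlgebraicGroup F n}

theorem IsLeviDecomposition.le_left (h : IsLeviDecomposition H L U) : L.points ≤ H.points :=
  points_mono (h.sup_eq ▸ le_sup_left)

theorem IsLeviDecomposition.le_right (h : IsLeviDecomposition H L U) : U.points ≤ H.points :=
  points_mono (h.sup_eq ▸ le_sup_right)

theorem IsLeviDecomposition.conj_mem (h : IsLeviDecomposition H L U) {g u : GL (Fin n) F}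
    (hg : g ∈ H.points) (hu : u ∈ U.points) : g * u * g⁻¹ ∈ U.points := by
  have := h.radical.1.2.1 _ hg _ hu
  rw [← map_inv, ← map_mul, ← map_mul] at this
  exact this

theorem IsLeviDecomposition.eq_one (h : IsLeviDecomposition H L U) {g : GL (Fin n) F}
    (hL : g ∈ L.points) (hU : g ∈ U.points) : g = 1 := by
  have h1 : Matrix.GeneralLinearGroup.map (algebraMap F (AlgebraicClosure F)) g ∈ L.geom ⊓ U.geom :=
    ⟨hL, hU⟩
  rw [h.inf_eq, Subgroup.mem_bot] at h1
  refine Units.ext (Matrix.map_injective (algebraMap F (AlgebraicClosure F)).injective ?_)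
  have h2 := congrArg Units.val h1
  refine Eq.trans h2 ?_
  simp

theorem IsLeviDecomposition.eq_of_mem (h : IsLeviDecomposition H L U) {g l l' : GL (Fin n) F}
    (hl : l ∈ L.points) (hl' : l' ∈ L.points) (hg : l⁻¹ * g ∈ U.points)
    (hg' : l'⁻¹ * g ∈ U.points) : l = l' := by
  have h1 : l⁻¹ * l' ∈ U.points := by
    have := mul_mem hg (inv_mem hg')
    simpa [mul_assoc] using this
  exact (inv_mul_eq_one.1 (h.eq_one (mul_mem (inv_mem hl) hl') h1))

variable [CharZero F]

theorem exists_map_eq_of_galois (g : GL (Fin n) (AlgebraicClosure F))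
    (hg : ∀ σ : AlgebraicClosure F ≃ₐ[F] AlgebraicClosure F,
      Matrix.GeneralLinearGroup.map (σ : AlgebraicClosure F →+* AlgebraicClosure F) g = g) :
    ∃ g₀ : GL (Fin n) F, Matrix.GeneralLinearGroup.map (algebraMap F (AlgebraicClosure F)) g₀ = g := by
  have key (h : GL (Fin n) (AlgebraicClosure F))
      (hh : ∀ σ : AlgebraicClosure F ≃ₐ[F] AlgebraicClosure F,
        Matrix.GeneralLinearGroup.map (σ : AlgebraicClosure F →+* AlgebraicClosure F) h = h) :
      ∃ m : Matrix (Fin n) (Fin n) F, m.map (algebraMap F (AlgebraicClosure F)) = h := by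
    have h1 (i j) : ∃ c : F, algebraMap F (AlgebraicClosure F) c =
        (h : Matrix (Fin n) (Fin n) (AlgebraicClosure F)) i j :=
      (InfiniteGalois.mem_range_algebraMap_iff_fixed _).2 fun σ =>
        congrFun (congrArg coords (hh σ)) (i, j)
    choose m hm using h1
    exact ⟨.of m, by ext i j; exact hm i j⟩
  obtain ⟨m, hm⟩ := key g hg
  obtain ⟨m', hm'⟩ := key g⁻¹ fun σ => by rw [map_inv, hg]
  have hinj : Function.Injective fun m : Matrix (Fin n) (Fin n) F =>
      m.map (algebraMap F (AlgebraicClosure F)) :=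
    Matrix.map_injective (algebraMap F (AlgebraicClosure F)).injective
  have h1 : m * m' = 1 := hinj <| by
    simp only [Matrix.map_mul, hm, hm', Matrix.map_one, map_zero, map_one, Units.mul_inv]
  have h2 : m' * m = 1 := hinj <| by
    simp only [Matrix.map_mul, hm, hm', Matrix.map_one, map_zero, map_one, Units.inv_mul]
  exact ⟨(⟨m, m', h1, h2⟩ : (Matrix (Fin n) (Fin n) F)ˣ), Units.ext hm⟩

/-- Over `Ω` the factorisation `g = l u` is unique because `L ∩ U = 1`. For rational `g` it is
therefore Galois invariant, so `l` is rational. -/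
theorem IsLeviDecomposition.exists_mul (h : IsLeviDecomposition H L U) {g : GL (Fin n) F}
    (hg : g ∈ H.points) : ∃ l ∈ L.points, l⁻¹ * g ∈ U.points := by
  have hUn : L.geom ≤ Subgroup.normalizer (U.geom : Set (GL (Fin n) (AlgebraicClosure F))) := by
    intro l hl
    have hlH : l ∈ H.geom := h.sup_eq ▸ Subgroup.mem_sup_left hl
    rw [Subgroup.mem_normalizer_iff]
    refine fun u => ⟨fun hu => h.radical.1.2.1 l hlH u hu, fun hu => ?_⟩
    have := h.radical.1.2.1 l⁻¹ (inv_mem hlH) _ hu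
    simpa [mul_assoc] using this
  have hg' : Matrix.GeneralLinearGroup.map (algebraMap F (AlgebraicClosure F)) g ∈
      ((L.geom ⊔ U.geom : Subgroup _) : Set (GL (Fin n) (AlgebraicClosure F))) := h.sup_eq ▸ hg
  rw [Subgroup.coe_mul_of_left_le_normalizer_right _ _ hUn] at hg'
  obtain ⟨l, hl, u, hu, hlu⟩ := hg'
  have hfix (σ : AlgebraicClosure F ≃ₐ[F] AlgebraicClosure F) :
      Matrix.GeneralLinearGroup.map (σ : AlgebraicClosure F →+* AlgebraicClosure F) l = l := by
    set f := Matrix.GeneralLinearGroup.map (n := Fin n) (σ : AlgebraicClosure F →+* AlgebraicClosure F)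
    have h1 : f l * f u = l * u := by
      rw [← map_mul]
      change f ((fun x1 x2 => x1 * x2) l u) = (fun x1 x2 => x1 * x2) l u
      rw [hlu]
      refine Units.ext (Matrix.ext fun i j => ?_)
      exact σ.commutes _
    have h2 : l⁻¹ * f l = u * (f u)⁻¹ := by
      rw [inv_mul_eq_iff_eq_mul, ← mul_assoc, ← h1, mul_inv_cancel_right]
    have h3 : l⁻¹ * f l ∈ L.geom ⊓ U.geom := by
      refine Subgroup.mem_inf.2 ⟨L.geom.mul_mem (L.geom.inv_mem hl) (L.map_mem_geom σ hl), ?_⟩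
      rw [h2]
      exact U.geom.mul_mem hu (U.geom.inv_mem (U.map_mem_geom σ hu))
    rw [h.inf_eq, Subgroup.mem_bot, inv_mul_eq_one] at h3
    exact h3.symm
  obtain ⟨l₀, rfl⟩ := exists_map_eq_of_galois l hfix
  refine ⟨l₀, hl, ?_⟩
  change Matrix.GeneralLinearGroup.map _ _ ∈ U.geom
  rw [map_mul, map_inv, ← hlu]
  simpa using hu

/-- The projection of `H = L ⋉ U` to `L` on rational points. -/
def IsLeviDecomposition.proj (h : IsLeviDecomposition H L U) : H.points →* L.points :=
  MonoidHom.mk' (fun g => ⟨(h.exists_mul g.2).choose, (h.exists_mul g.2).choose_spec.1⟩) fun g g' => by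
    have h1 := (h.exists_mul g.2).choose_spec
    have h2 := (h.exists_mul g'.2).choose_spec
    have h3 := (h.exists_mul (g * g').2).choose_spec
    refine Subtype.ext (h.eq_of_mem h3.1 (mul_mem h1.1 h2.1) h3.2 ?_)
    have h4 := mul_mem (h.conj_mem (inv_mem (h.le_left h2.1)) h1.2) h2.2
    simpa [mul_assoc] using h4

theorem IsLeviDecomposition.proj_iff (h : IsLeviDecomposition H L U) (g : H.points) (l : L.points) :
    (l : GL (Fin n) F)⁻¹ * g ∈ U.points ↔ l = h.proj g := by
  have h1 := (h.exists_mul g.2).choose_spec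
  refine ⟨fun hl => Subtype.ext (h.eq_of_mem l.2 h1.1 hl h1.2), ?_⟩
  rintro rfl
  exact h1.2

end Levi

section Topology

variable {F : Type*} [NontriviallyNormedField F] {n : ℕ}

theorem secondCountableTopology_GL [SecondCountableTopology F] :
    SecondCountableTopology (GL (Fin n) F) := by
  have : SecondCountableTopology (Matrix (Fin n) (Fin n) F) :=
    inferInstanceAs (SecondCountableTopology (Fin n → Fin n → F))
  have : SecondCountableTopology (Matrix (Fin n) (Fin n) F)ᵐᵒᵖ :=
    MulOpposite.opHomeomorph.symm.isInducing.secondCountableTopology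
  exact Units.isInducing_embedProduct.secondCountableTopology

theorem coords_injective : Function.Injective (coords : GL (Fin n) F → Fin n × Fin n → F) :=
  fun _ _ h => Units.ext (Matrix.ext fun i j => congrFun h (i, j))

theorem totallyDisconnectedSpace_GL [TotallyDisconnectedSpace F] :
    TotallyDisconnectedSpace (GL (Fin n) F) :=
  ⟨fun _ _ hs _ hx _ hy => coords_injective
    ((hs.image _ continuous_coords.continuousOn).subsingleton (Set.mem_image_of_mem _ hx)
      (Set.mem_image_of_mem _ hy))⟩

theorem t2Space_GL : T2Space (GL (Fin n) F) := .of_injective_continuous coords_injective continuous_coords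

variable [ProperSpace F] [CharZero F] {H L U : LinearAlgebraicGroup F n}

/-- `L × U` acts transitively on `H` by `g ↦ l g u⁻¹`. By the open mapping theorem for σ-compact
groups the orbit map of `1` is open, hence a quotient map, and the projection becomes the first
coordinate after composition with it. -/
theorem IsLeviDecomposition.continuous_proj (h : IsLeviDecomposition H L U) : Continuous h.proj := by
  have := locallyCompactSpace_GL (F := F) (n := n)
  have := secondCountableTopology_GL (F := F) (n := n)
  have := t2Space_GL (F := F) (n := n)
  have : LocallyCompactSpace H.points :=
    H.isClosed_points.isClosedEmbedding_subtypeVal.locallyCompactSpace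
  have : LocallyCompactSpace L.points :=
    L.isClosed_points.isClosedEmbedding_subtypeVal.locallyCompactSpace
  have : SecondCountableTopology L.points :=
    inferInstanceAs (SecondCountableTopology (L.points : Set (GL (Fin n) F)))
  have : LocallyCompactSpace U.points :=
    U.isClosed_points.isClosedEmbedding_subtypeVal.locallyCompactSpace
  have : SecondCountableTopology U.points :=
    inferInstanceAs (SecondCountableTopology (U.points : Set (GL (Fin n) F)))
  let iL : L.points →* H.points := Subgroup.inclusion h.le_left
  let iU : U.points →* H.points := Subgroup.inclusion h.le_right
  have ciL : Continuous iL := continuous_inclusion h.le_left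
  have ciU : Continuous iU := continuous_inclusion h.le_right
  let _ : MulAction (L.points × U.points) H.points :=
    { smul := fun z g => iL z.1 * g * (iU z.2)⁻¹
      one_smul := fun g => by
        change iL 1 * g * (iU 1)⁻¹ = g
        simp
      mul_smul := fun z z' g => by
        change iL (z.1 * z'.1) * g * (iU (z.2 * z'.2))⁻¹ =
          iL z.1 * (iL z'.1 * g * (iU z'.2)⁻¹) * (iU z.2)⁻¹
        simp [mul_assoc] }
  have hsmul (z : L.points × U.points) (g : H.points) : z • g = iL z.1 * g * (iU z.2)⁻¹ := rfl
  have : ContinuousSMul (L.points × U.points) H.points := ⟨by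
    simp only [hsmul]
    fun_prop⟩
  have horb (g : H.points) : ∃ z : L.points × U.points, z • (1 : H.points) = g := by
    have h1 := (h.proj_iff g (h.proj g)).2 rfl
    refine ⟨(h.proj g, ⟨_, inv_mem h1⟩), Subtype.ext ?_⟩
    rw [hsmul]
    simp [iL, iU]
  have : MulAction.IsPretransitive (L.points × U.points) H.points := ⟨fun x y => by
    obtain ⟨z, rfl⟩ := horb x
    obtain ⟨z', rfl⟩ := horb y
    exact ⟨z' * z⁻¹, by rw [smul_smul, inv_mul_cancel_right]⟩⟩
  have hopen := isOpenMap_smul_of_sigmaCompact (G := L.points × U.points) (1 : H.points)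
  have hquot : IsQuotientMap fun z : L.points × U.points => z • (1 : H.points) :=
    hopen.isQuotientMap (by fun_prop) horb
  rw [hquot.continuous_iff]
  have hcomp : h.proj ∘ (fun z : L.points × U.points => z • (1 : H.points)) = Prod.fst := by
    funext z
    refine ((h.proj_iff _ _).1 ?_).symm
    change (z.1 : GL (Fin n) F)⁻¹ * ((iL z.1 * 1 * (iU z.2)⁻¹ : H.points) : GL (Fin n) F) ∈ _
    simp [iL, iU]
  rw [hcomp]
  exact continuous_fst

/-- The section of `P \ G` and the projection to the Levi factor, for a parabolic subgroup
`P = L ⋉ U` of `G`. -/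
theorem exists_contSection [TotallyDisconnectedSpace F] {G P L U : LinearAlgebraicGroup F n}
    (hrad : 0 < (NormedSpace.expSeries F ((Fin n → F) →L[F] (Fin n → F))).radius)
    (hP : G.IsParabolic P) (h : IsLeviDecomposition P L U) :
    Nonempty (ContSection G.points P.points L.points U.points) := by
  have := locallyCompactSpace_GL (F := F) (n := n)
  have := secondCountableTopology_GL (F := F) (n := n)
  have := t2Space_GL (F := F) (n := n)
  have := totallyDisconnectedSpace_GL (F := F) (n := n)
  have : LocallyCompactSpace G.points :=
    G.isClosed_points.isClosedEmbedding_subtypeVal.locallyCompactSpace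
  have : SecondCountableTopology G.points :=
    inferInstanceAs (SecondCountableTopology (G.points : Set (GL (Fin n) F)))
  obtain ⟨C, hC, hCG, hcov⟩ := hP.exists_isCompact hrad
  have hC' : IsCompact ((↑) ⁻¹' C : Set G.points) :=
    G.isClosed_points.isClosedEmbedding_subtypeVal.isCompact_preimage hC
  have hPG := points_mono hP.le
  -- Compactness is known for `G / P`; writing `g⁻¹ = c p` gives `p g = c⁻¹`, so the inverses of `C`
  -- cover `P \ G`.
  obtain ⟨s, hs, hsX, hsP, hs_eq⟩ := (P.points.subgroupOf G.points).exists_continuous_section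
    (P.isClosed_points.preimage continuous_subtype_val) hC'.inv fun g => by
      obtain ⟨c, hc, p, hp, hgcp⟩ := hcov (g⁻¹ : G.points) (g⁻¹ : G.points).2
      refine ⟨⟨p, hPG hp⟩, hp, ?_⟩
      have h1 : ((⟨p, hPG hp⟩ * g)⁻¹ : G.points) = ⟨c, hCG hc⟩ := by
        refine Subtype.ext ?_
        rw [mul_inv_rev, Subgroup.coe_mul, hgcp]
        simp
      rw [Set.mem_inv, h1]
      exact hc
  have hidem (g) : s (s g) = s g := by
    have := hs_eq _ (hsP g) g
    rwa [inv_mul_cancel_right] at this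
  have hfact (g : G.points) : (g : GL (Fin n) F) * (s g : GL (Fin n) F)⁻¹ ∈ P.points := by
    have := inv_mem (hsP g)
    rw [mul_inv_rev, inv_inv] at this
    exact this
  exact ⟨{
    X := Set.range s
    isCompact := hsX
    nonempty := Set.range_nonempty s
    sec := s
    continuous_sec := hs
    sec_mem := fun g => ⟨g, rfl⟩
    sec_of_mem := by rintro _ ⟨g, rfl⟩; exact hidem g
    sec_mul := fun p g g' hg => by
      have : g' = ⟨p, hPG p.2⟩ * g := Subtype.ext hg
      rw [this]
      exact hs_eq _ p.2 g
    fact := fun g => ⟨_, hfact g⟩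
    continuous_fact := by fun_prop
    fact_mul_sec := fun g => by simp
    lev := h.proj
    continuous_lev := h.continuous_proj
    lev_iff := h.proj_iff }⟩

end Topology

end LinearAlgebraicGroup

end

theorem mainTheorem7
    -- the coefficient field `E` and the base field `F`, finite extensions of `ℚ_p`
    (p : ℕ) [Fact p.Prime]
    (E : Type*) [Field E] [Algebra ℚ_[p] E] [FiniteDimensional ℚ_[p] E]
    [Algebra ℤ_[p] E] [IsScalarTower ℤ_[p] ℚ_[p] E]
    (F : Type*) [NontriviallyNormedField F] [NormedAlgebra ℚ_[p] F] [FiniteDimensional ℚ_[p] F]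
    -- a connected reductive group `G`, opposite parabolics `P = L ⋉ U` and `P' = L ⋉ U'` (`P'` is `P⁻`)
    (n : ℕ) (G P P' L U U' : LinearAlgebraicGroup F n)
    (hG : G.IsConnectedReductive)
    (hP : LinearAlgebraicGroup.IsOppositePair G P P' L U U')
    -- an object `A` of `Noe(𝒪_E)`, and an `𝔪_A`-adically continuous `A[L]`-module `σ`
    (A : Type*) [CommRing A] [IsLocalRing A] [Algebra (integralClosure ℤ_[p] E) A]
    (hA : IsNoe (integralClosure ℤ_[p] E) A)
    (M : Type*) [AddCommGroup M] [Module A M] (σ : Representation A L.points M)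
    (hσ : IsMadicContinuous A σ) :
    IsMadicContinuous A (contIndRep A G.points P'.points U'.points σ) ∧
    (IsOrthonormalizable A (contInd A G.points P'.points U'.points σ) ↔
      IsOrthonormalizable A M) ∧
    ∀ (A' : Type*) [CommRing A'] [IsLocalRing A'] [Algebra (integralClosure ℤ_[p] E) A']
      [Algebra A A'] [IsScalarTower (integralClosure ℤ_[p] E) A A'],
      IsNoe (integralClosure ℤ_[p] E) A' → IsLocalHom (algebraMap A A') →
      IsMadicContinuous A' (completedBaseChangeRep A A' σ) ∧
      -- the natural isomorphism: it is the (unique) one that sends `f ⊗ a'` to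
      -- the function `g ↦ f(g) ⊗ a'`
      ∃ e : CompletedBaseChange A A' (contInd A G.points P'.points U'.points σ) ≃ₗ[A']
          contInd A' G.points P'.points U'.points (completedBaseChangeRep A A' σ),
        (∀ (x : G.points)
          (y : CompletedBaseChange A A' (contInd A G.points P'.points U'.points σ)),
          e (completedBaseChangeRep A A' (contIndRep A G.points P'.points U'.points σ) x y) =
            contIndRep A' G.points P'.points U'.points (completedBaseChangeRep A A' σ) x (e y)) ∧
        ∀ (a' : A') (f : contInd A G.points P'.points U'.points σ) (g : G.points),
          (e (completedTmul A A' a' f)).1 g = completedTmul A A' a' (f.1 g) := by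
  have := hA.noetherian
  have hAfg : (IsLocalRing.maximalIdeal A).FG := IsNoetherian.noetherian _
  have : ProperSpace F := FiniteDimensional.proper ℚ_[p] F
  have : CharZero F := charZero_of_injective_algebraMap (algebraMap ℚ_[p] F).injective
  -- The norm of `F` extends the `p`-adic one, so integers have norm at most `1`. The resulting
  -- ultrametric inequality makes `F` totally disconnected.
  have : IsUltrametricDist F :=
    IsUltrametricDist.isUltrametricDist_of_forall_norm_natCast_le_one fun k => by
      have h1 : (k : F) = algebraMap ℚ_[p] F k := by simp
      rw [h1, norm_algebraMap']
      exact IsUltrametricDist.norm_natCast_le_one ℚ_[p] k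
  have := LinearAlgebraicGroup.totallyDisconnectedSpace_GL (F := F) (n := n)
  have := LinearAlgebraicGroup.t2Space_GL (F := F) (n := n)
  obtain ⟨S⟩ := LinearAlgebraicGroup.exists_contSection
    (NormedSpace.expSeries_radius_pos_of_padic p F _) hP.parabolic' hP.levi'
  refine ⟨S.isMadicContinuous_contIndRep hAfg hσ, S.isOrthonormalizable_contInd_iff hAfg hσ, ?_⟩
  intro A' _ _ _ _ _ hA' hloc
  have := hA'.noetherian
  have hAfg' : (IsLocalRing.maximalIdeal A').FG := IsNoetherian.noetherian _
  have hI : (IsLocalRing.maximalIdeal A).map (algebraMap A A') ≤ IsLocalRing.maximalIdeal A' :=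
    ((IsLocalRing.local_hom_TFAE (algebraMap A A')).out 0 2).1 hloc
  have hL := isMadicContinuous_completedBaseChangeRep hI hAfg' σ hσ
  exact ⟨hL, S.exists_completedBaseChange_equiv hI hAfg hAfg' hσ hL⟩
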